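/- **Theorem (isomorphism of quantum integrable systems).** Let $g\ge 0$, let $a_1,\dots,a_{g+3}\in\mathbb C$ be distinct, $\Pi(X)=\prod_{i=1}^{g+3}(X-a_i)$, and let $C_1,\dots,C_{g+3}\in\mathbb C$ satisfy $$\sum_i C_i=\sum_i a_iC_i=0 .$$ *The algebra $A_{\mathcal X}$.* Let $\mathbb C(\hat x_1,\dots,\hat x_g)[\hat y_1,\dots,\hat y_g]$ be the algebra with relations $[\hat y_\alpha,\hat y_\beta]=0$, $[\hat y_\alpha,f]=2\Pi(\hat x_\alpha)\,\partial f/\partial\hat x_\alpha$ for $f\in\mathbb C(\hat x_1,\dots,\hat x_g)$, and let $A_{\mathcal X}$ be its subalgebra of invariants under $\mathfrak S_g$ permuting the pairs $(\hat x_\alpha,\hat y_\alpha)$. For $\phi\in\mathbb C[X]$ put $\hat Y[\phi]=\sum_\alpha(\phi/\Pi)(\hat x_\alpha)\hat y_\alpha$. Put $$\hat T_\alpha=\Pi(\hat x_\alpha)\Big(\tfrac14\big(\Pi(\hat x_\alpha)^{-1}\hat y_\alpha\big)^2-\sum_{i=1}^{g+3}\frac{C_i/2}{(\hat x_\alpha-a_i)^2}\Big),\qquad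 \hat H^{\rm BM}_k=\sum_{\alpha=1}^g\Big(\prod_{\beta\ne\alpha}(\hat x_\beta-\hat x_\alpha)\Big)^{-1}\Big(\sum_{\substack{\beta_1<\dots<\beta_{g-k}\\ \beta_1,\dots,\beta_{g-k}\neq\alpha}}\hat x_{\beta_1}\cdots\hat x_{\beta_{g-k}}\Big)\hat T_\alpha$$ for $1\le k\le g$. *The algebra $A_{\mathcal U}$.* Put $\ell_0=\sum_if_i$, $\ell_1=\sum_ia_if_i$, let $\mathcal O$ be the localization of $\mathbb C[f_1,\dots,f_{g+3}]$ at the prime ideal $(\ell_0,\ell_1)$, $F=\mathcal O/(\ell_0,\ell_1)$ its residue field, and let $A=\mathcal O[f_1^*,\dots,f_{g+3}^*]$ with $[f_i^*,f_j]=\delta_{ij}$, $[f_i^*,f_j^*]=0$. Put $h_i=-2f_if_i^*$, $\hat I=A(\sum_ih_i-2)+A\ell_0+A\ell_1$, $\hat N=\{u\in A\mid \hat Iu\subset\hat I\}$ and $A_{\mathcal U}=\hat N/\hat I$. Put $\bar f_i=f_i/\sum_ja_j^2f_j$ and $P_f(X)=\sum_i f_i\prod_{j\ne i}(X-a_j)\in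 F[X]$. For $\phi\in\mathbb C[X]$ let $$\hat W[\phi]=\sum_i c_ih_i,\qquad c_i={\rm Res}_{t=\infty}\Big(\frac{P_f'}{P_f}(t)-\frac{P_f'}{P_f}(a_i)\Big)\frac{\phi(t)\,dt}{t-a_i}\in F,\qquad {\rm Res}_{t=\infty}\frac{dt}{t}=-1;$$ here $\hat W[\phi]$ denotes the class in $A_{\mathcal U}$ of $\sum_i\tilde c_ih_i$, for any lifts $\tilde c_i\in\mathcal O$ of the $c_i$ with $\sum_i\tilde c_if_i=\sum_ia_i\tilde c_if_i=0$. Put $$e_i=\frac{C_i}{2f_i}-\frac1{4f_i}h_i^2-\frac1{2f_i}h_i,\qquad \hat H_i^{\rm Hitch}=\sum_{j\ne i}\frac{e_if_j+f_ie_j+\frac12h_ih_j}{a_i-a_j}\in A,$$ so that $e_if_i+f_ie_i+\frac12h_i^2=C_i$. *Claim.* The elements $\hat W[\phi]$ of $A_{\mathcal U}$ are well defined (such lifts exist, $\sum_i\tilde c_ih_i\in\hat N$, and the class does not depend on the lifts); there is a unique algebra isomorphism $\hat\Lambda:A_{\mathcal X}\to A_{\mathcal U}$ with $$\sum_{\alpha_1<\dots<\alpha_k}\hat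 x_{\alpha_1}\cdots\hat x_{\alpha_k}\mapsto\sum_i\bar f_i\sum_{\substack{j_1<\dots<j_{k+2}\\ j_1,\dots,j_{k+2}\ne i}}a_{j_1}\cdots a_{j_{k+2}}\quad(1\le k\le g),\qquad \hat Y[\phi]\mapsto\hat W[\phi]\quad(\phi\in\mathbb C[X]);$$ the $\hat H_i^{\rm Hitch}$ belong to $\hat N$; and, denoting their classes in $A_{\mathcal U}$ by the same symbols, $\hat\Lambda$ maps the families $(\hat H^{\rm BM}_k)_{1\le k\le g}$ and $(\hat H^{\rm Hitch}_i)_{1\le i\le g+3}$ to each other: $$\sum_{k=0}^{g-1}(-1)^kX^k\,\hat\Lambda(\hat H^{\rm BM}_{k+1})=\Big(\sum_i\frac{\hat H_i^{\rm Hitch}}{X-a_i}\Big)\prod_{i=1}^{g+3}(X-a_i)\quad\text{in }A_{\mathcal U}[X],$$ that is, $$\hat H_i^{\rm Hitch}=\Big(\prod_{j\ne i}(a_i-a_j)\Big)^{-1}\sum_{k=0}^{g-1}(-1)^ka_i^k\,\hat\Lambda(\hat H^{\rm BM}_{k+1})\quad(1\le i\le g+3),$$ $$\hat H_k^{\rm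 BM}=(-1)^g\sum_i\hat\Lambda^{-1}(\hat H_i^{\rm Hitch})\sum_{\substack{j_1<\dots<j_{g+3-k}\\ j_1,\dots,j_{g+3-k}\ne i}}a_{j_1}\cdots a_{j_{g+3-k}}\quad(1\le k\le g).$$ -/

import Mathlib

noncomputable section

namespace QIS

/-! ### Algebras of differential operators by generators and relations -/

section Weyl

variable {R : Type} [CommRing R] [Algebra ℂ R] {n : ℕ}

/-- Relations of the algebra `R[y₁, …, yₙ]` generated by the commutative algebra `R` and by
commuting elements `yᵢ` with `[yᵢ, xⱼ] = δᵢⱼ pᵢ`. When `R` is a localization of `ℂ[x₁, …, xₙ]`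
this forces `[yᵢ, r] = pᵢ ∂r/∂xᵢ` for every `r` in `R`, so that the algebra is the crossed product
of `R` by the abelian Lie algebra with basis `y₁, …, yₙ` acting by the derivations `pᵢ ∂/∂xᵢ`. -/
inductive WeylRel (x p : Fin n → R) :
    FreeAlgebra ℂ (R ⊕ Fin n) → FreeAlgebra ℂ (R ⊕ Fin n) → Prop
  | add (r s : R) : WeylRel x p (FreeAlgebra.ι ℂ (Sum.inl (r + s)))
      (FreeAlgebra.ι ℂ (Sum.inl r) + FreeAlgebra.ι ℂ (Sum.inl s))
  | mul (r s : R) : WeylRel x p (FreeAlgebra.ι ℂ (Sum.inl (r * s)))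
      (FreeAlgebra.ι ℂ (Sum.inl r) * FreeAlgebra.ι ℂ (Sum.inl s))
  | scalar (c : ℂ) : WeylRel x p (FreeAlgebra.ι ℂ (Sum.inl (algebraMap ℂ R c)))
      (algebraMap ℂ (FreeAlgebra ℂ (R ⊕ Fin n)) c)
  | comm (i j : Fin n) : WeylRel x p
      (FreeAlgebra.ι ℂ (Sum.inr i) * FreeAlgebra.ι ℂ (Sum.inr j))
      (FreeAlgebra.ι ℂ (Sum.inr j) * FreeAlgebra.ι ℂ (Sum.inr i))
  | bracket (i j : Fin n) : WeylRel x p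
      (FreeAlgebra.ι ℂ (Sum.inr i) * FreeAlgebra.ι ℂ (Sum.inl (x j)))
      (FreeAlgebra.ι ℂ (Sum.inl (x j)) * FreeAlgebra.ι ℂ (Sum.inr i)
        + FreeAlgebra.ι ℂ (Sum.inl (if i = j then p i else 0)))

/-- The algebra `R[y₁, …, yₙ]` with `[yᵢ, xⱼ] = δᵢⱼ pᵢ`. -/
def Weyl (x p : Fin n → R) : Type := RingQuot (WeylRel x p)

instance (x p : Fin n → R) : Ring (Weyl x p) := inferInstanceAs (Ring (RingQuot (WeylRel x p)))

instance (x p : Fin n → R) : Algebra ℂ (Weyl x p) :=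
  inferInstanceAs (Algebra ℂ (RingQuot (WeylRel x p)))

/-- The projection from the free algebra. -/
def Weyl.mk (x p : Fin n → R) : FreeAlgebra ℂ (R ⊕ Fin n) →ₐ[ℂ] Weyl x p :=
  RingQuot.mkAlgHom ℂ (WeylRel x p)

theorem Weyl.mk_rel {x p : Fin n → R} {u v : FreeAlgebra ℂ (R ⊕ Fin n)} (h : WeylRel x p u v) :
    Weyl.mk x p u = Weyl.mk x p v :=
  RingQuot.mkAlgHom_rel ℂ h

/-- The canonical map `R → R[y₁, …, yₙ]`. -/
def Weyl.of (x p : Fin n → R) : R →ₐ[ℂ] Weyl x p :=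
  AlgHom.ofLinearMap
    { toFun := fun r => Weyl.mk x p (FreeAlgebra.ι ℂ (Sum.inl r))
      map_add' := fun r s => by
        rw [Weyl.mk_rel (WeylRel.add r s), map_add]
      map_smul' := fun c r => by
        rw [Algebra.smul_def, Weyl.mk_rel (WeylRel.mul _ r), map_mul,
          Weyl.mk_rel (WeylRel.scalar c), AlgHom.commutes, RingHom.id_apply, Algebra.smul_def] }
    (by
      change Weyl.mk x p (FreeAlgebra.ι ℂ (Sum.inl 1)) = 1
      have h := Weyl.mk_rel (WeylRel.scalar (x := x) (p := p) 1)
      simpa using h)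
    (fun r s => by
      change Weyl.mk x p (FreeAlgebra.ι ℂ (Sum.inl (r * s))) = _
      rw [Weyl.mk_rel (WeylRel.mul r s), map_mul]
      rfl)

/-- The generators `yᵢ`. -/
def Weyl.y (x p : Fin n → R) (i : Fin n) : Weyl x p :=
  Weyl.mk x p (FreeAlgebra.ι ℂ (Sum.inr i))

theorem Weyl.y_comm (x p : Fin n → R) (i j : Fin n) :
    Weyl.y x p i * Weyl.y x p j = Weyl.y x p j * Weyl.y x p i := by
  have h := Weyl.mk_rel (WeylRel.comm (x := x) (p := p) i j)
  rw [map_mul, map_mul] at h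
  exact h

theorem Weyl.y_mul_of (x p : Fin n → R) (i j : Fin n) :
    Weyl.y x p i * Weyl.of x p (x j) =
      Weyl.of x p (x j) * Weyl.y x p i + Weyl.of x p (if i = j then p i else 0) := by
  have h := Weyl.mk_rel (WeylRel.bracket (x := x) (p := p) i j)
  rw [map_mul, map_add, map_mul] at h
  exact h

/-- An endomorphism `φ` of `R` with `φ xᵢ = x_{s i}` and `φ pᵢ = p_{s i}` for a permutation `s`
extends to `R[y₁, …, yₙ]` by `yᵢ ↦ y_{s i}`. -/
def Weyl.map (x p : Fin n → R) (φ : R →ₐ[ℂ] R) (s : Equiv.Perm (Fin n))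
    (hx : ∀ i, φ (x i) = x (s i)) (hp : ∀ i, φ (p i) = p (s i)) : Weyl x p →ₐ[ℂ] Weyl x p :=
  RingQuot.liftAlgHom ℂ ⟨FreeAlgebra.lift ℂ
    (Sum.elim (fun r => Weyl.of x p (φ r)) (fun i => Weyl.y x p (s i))), by
      intro u v h
      induction h with
      | add r s => simp
      | mul r s => simp
      | scalar c => simp
      | comm i j => simpa using Weyl.y_comm x p (s i) (s j)
      | bracket i j =>
        have h := Weyl.y_mul_of x p (s i) (s j)
        by_cases hij : i = j
        · subst hij
          simpa [hx, hp] using h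
        · simpa [hx, hij] using h⟩

theorem Weyl.map_of (x p : Fin n → R) (φ : R →ₐ[ℂ] R) (s : Equiv.Perm (Fin n))
    (hx : ∀ i, φ (x i) = x (s i)) (hp : ∀ i, φ (p i) = p (s i)) (r : R) :
    Weyl.map x p φ s hx hp (Weyl.of x p r) = Weyl.of x p (φ r) := by
  change RingQuot.liftAlgHom ℂ _ (RingQuot.mkAlgHom ℂ _ _) = _
  rw [RingQuot.liftAlgHom_mkAlgHom_apply]
  simp

theorem Weyl.map_y (x p : Fin n → R) (φ : R →ₐ[ℂ] R) (s : Equiv.Perm (Fin n))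
    (hx : ∀ i, φ (x i) = x (s i)) (hp : ∀ i, φ (p i) = p (s i)) (i : Fin n) :
    Weyl.map x p φ s hx hp (Weyl.y x p i) = Weyl.y x p (s i) := by
  change RingQuot.liftAlgHom ℂ _ (RingQuot.mkAlgHom ℂ _ _) = _
  rw [RingQuot.liftAlgHom_mkAlgHom_apply]
  simp

end Weyl

variable {g : ℕ}

/-! ### The algebra `A_X` and the Beauville–Mukai Hamiltonians -/

/-- The field `ℂ(x₁, …, x_g)`. -/
abbrev KX (g : ℕ) : Type := FractionRing (MvPolynomial (Fin g) ℂ)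

/-- The variables `x_α` of `ℂ(x₁, …, x_g)`. -/
def xv (α : Fin g) : KX g := algebraMap (MvPolynomial (Fin g) ℂ) (KX g) (MvPolynomial.X α)

/-- `Π(X) = ∏ᵢ (X - aᵢ)`. -/
def PiPoly (a : Fin (g + 3) ↪ ℂ) : Polynomial ℂ := ∏ i, (Polynomial.X - Polynomial.C (a i))

/-- `2 Π(x_α)`. -/
def twoPi (a : Fin (g + 3) ↪ ℂ) (α : Fin g) : KX g := 2 * Polynomial.aeval (xv α) (PiPoly a)

/-- `ℂ(x₁, …, x_g)[y₁, …, y_g]`, with `[y_α, f] = 2 Π(x_α) ∂f/∂x_α` and `[y_α, y_β] = 0`. -/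
abbrev DX (a : Fin (g + 3) ↪ ℂ) : Type := Weyl (xv (g := g)) (twoPi a)

/-- The inclusion of `ℂ(x₁, …, x_g)`. -/
abbrev ofX (a : Fin (g + 3) ↪ ℂ) : KX g →ₐ[ℂ] DX a := Weyl.of (xv (g := g)) (twoPi a)

/-- The generator `y_α`. -/
abbrev yv (a : Fin (g + 3) ↪ ℂ) (α : Fin g) : DX a := Weyl.y (xv (g := g)) (twoPi a) α

/-- The permutation action on `ℂ(x₁, …, x_g)`. -/
def permK (s : Equiv.Perm (Fin g)) : KX g →ₐ[ℂ] KX g :=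
  (IsFractionRing.fieldEquivOfAlgEquiv ℂ (KX g) (KX g)
    (MvPolynomial.renameEquiv ℂ s) : KX g ≃ₐ[ℂ] KX g)

theorem permK_xv (s : Equiv.Perm (Fin g)) (α : Fin g) : permK s (xv α) = xv (s α) := by
  change IsFractionRing.fieldEquivOfAlgEquiv ℂ (KX g) (KX g) (MvPolynomial.renameEquiv ℂ s)
    (algebraMap (MvPolynomial (Fin g) ℂ) (KX g) (MvPolynomial.X α)) = _
  rw [IsFractionRing.fieldEquivOfAlgEquiv_algebraMap]
  simp [xv]

theorem permK_aeval (s : Equiv.Perm (Fin g)) (α : Fin g) (φ : Polynomial ℂ) :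
    permK s (Polynomial.aeval (xv α) φ) = Polynomial.aeval (xv (s α)) φ := by
  rw [← permK_xv, Polynomial.aeval_algHom_apply]

theorem permK_twoPi (a : Fin (g + 3) ↪ ℂ) (s : Equiv.Perm (Fin g)) (α : Fin g) :
    permK s (twoPi a α) = twoPi a (s α) := by
  rw [twoPi, map_mul, permK_aeval, map_ofNat, twoPi]

/-- The action of the symmetric group permuting the pairs `(x_α, y_α)`. -/
def permD (a : Fin (g + 3) ↪ ℂ) (s : Equiv.Perm (Fin g)) : DX a →ₐ[ℂ] DX a :=
  Weyl.map _ _ (permK s) s (permK_xv s) (permK_twoPi a s)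

/-- `A_X`: the invariants of the symmetric group in `ℂ(x₁, …, x_g)[y₁, …, y_g]`. -/
def AX (a : Fin (g + 3) ↪ ℂ) : Subalgebra ℂ (DX a) where
  carrier := {u | ∀ s, permD a s u = u}
  mul_mem' hu hv s := by rw [map_mul, hu s, hv s]
  add_mem' hu hv s := by rw [map_add, hu s, hv s]
  algebraMap_mem' c s := by rw [AlgHom.commutes]

theorem sum_mem_AX (a : Fin (g + 3) ↪ ℂ) (t : Fin g → DX a)
    (ht : ∀ s α, permD a s (t α) = t (s α)) : ∑ α, t α ∈ AX a := by
  intro s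
  rw [map_sum, Finset.sum_congr rfl fun α _ => ht s α]
  exact Equiv.sum_comp s t

theorem permD_of (a : Fin (g + 3) ↪ ℂ) (s : Equiv.Perm (Fin g)) (r : KX g) :
    permD a s (ofX a r) = ofX a (permK s r) :=
  Weyl.map_of _ _ _ _ _ _ r

theorem permD_y (a : Fin (g + 3) ↪ ℂ) (s : Equiv.Perm (Fin g)) (α : Fin g) :
    permD a s (yv a α) = yv a (s α) :=
  Weyl.map_y _ _ _ _ _ _ α

/-- The elementary symmetric function `∑_{α₁ < … < α_k} x_{α₁} ⋯ x_{α_k}`, in `A_X`. -/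
def esymX (a : Fin (g + 3) ↪ ℂ) (k : ℕ) : AX a :=
  ⟨ofX a (algebraMap _ (KX g) (MvPolynomial.esymm (Fin g) ℂ k)), by
    intro s
    rw [permD_of]
    congr 1
    change IsFractionRing.fieldEquivOfAlgEquiv ℂ (KX g) (KX g) (MvPolynomial.renameEquiv ℂ s) _ = _
    rw [IsFractionRing.fieldEquivOfAlgEquiv_algebraMap]
    congr 1
    exact MvPolynomial.esymm_isSymmetric (Fin g) ℂ k s⟩

/-- `Ŷ[φ] = ∑_α (φ/Π)(x_α) y_α`, in `A_X`. -/
def Yhat (a : Fin (g + 3) ↪ ℂ) (φ : Polynomial ℂ) : AX a :=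
  ⟨∑ α, ofX a (Polynomial.aeval (xv α) φ / Polynomial.aeval (xv α) (PiPoly a)) * yv a α,
    sum_mem_AX a _ fun s α => by
      rw [map_mul, permD_of, permD_y, map_div₀, permK_aeval, permK_aeval]⟩

/-- `T̂_α = Π(x_α) (¼ (Π(x_α)⁻¹ y_α)² - ∑ᵢ (Cᵢ/2) / (x_α - aᵢ)²)`. -/
def That (a : Fin (g + 3) ↪ ℂ) (C : Fin (g + 3) → ℂ) (α : Fin g) : DX a :=
  ofX a (Polynomial.aeval (xv α) (PiPoly a)) *
    ((1 / 4 : ℂ) • (ofX a (Polynomial.aeval (xv α) (PiPoly a))⁻¹ * yv a α) ^ 2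
      - ofX a (∑ i, algebraMap ℂ (KX g) (C i / 2) / (xv α - algebraMap ℂ (KX g) (a i)) ^ 2))

/-- `(∏_{β ≠ α} (x_β - x_α))⁻¹ ∑_{β₁ < … < β_m, β₁, …, β_m ≠ α} x_{β₁} ⋯ x_{β_m}`. -/
def bmCoeff (m : ℕ) (α : Fin g) : KX g :=
  (∏ β ∈ Finset.univ.erase α, (xv β - xv α))⁻¹ *
    ∑ t ∈ (Finset.univ.erase α).powersetCard m, ∏ β ∈ t, xv β

theorem permK_bmCoeff (m : ℕ) (s : Equiv.Perm (Fin g)) (α : Fin g) :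
    permK s (bmCoeff m α) = bmCoeff m (s α) := by
  have he : (Finset.univ.erase (s α)) = (Finset.univ.erase α).map s.toEmbedding := by
    rw [Finset.map_erase, Finset.map_univ_equiv]
    rfl
  rw [bmCoeff, bmCoeff, he, Finset.powersetCard_map, Finset.sum_map, Finset.prod_map]
  simp [permK_xv, Finset.prod_map]

theorem permD_That (a : Fin (g + 3) ↪ ℂ) (C : Fin (g + 3) → ℂ) (s : Equiv.Perm (Fin g))
    (α : Fin g) : permD a s (That a C α) = That a C (s α) := by
  simp only [That, map_mul, map_sub, map_smul, map_pow, permD_of, permD_y, permK_aeval, map_inv₀,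
    map_sum, map_div₀, permK_xv, AlgHom.commutes]

/-- The quantum Beauville–Mukai Hamiltonian `Ĥ_k^{BM}`, `1 ≤ k ≤ g`, in `A_X`. -/
def HBM (a : Fin (g + 3) ↪ ℂ) (C : Fin (g + 3) → ℂ) (k : ℕ) : AX a :=
  ⟨∑ α, ofX a (bmCoeff (g - k) α) * That a C α,
    sum_mem_AX a _ fun s α => by
      rw [map_mul, permD_of, permK_bmCoeff, permD_That]⟩

/-! ### The algebra `A_U` -/

/-- `ℓ₀ = ∑ᵢ fᵢ` in `ℂ[f₁, …, f_{g+3}]`. -/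
def ell0 (g : ℕ) : MvPolynomial (Fin (g + 3)) ℂ := ∑ i, MvPolynomial.X i

/-- `ℓ₁ = ∑ᵢ aᵢ fᵢ` in `ℂ[f₁, …, f_{g+3}]`. -/
def ell1 (a : Fin (g + 3) ↪ ℂ) : MvPolynomial (Fin (g + 3)) ℂ :=
  ∑ i, MvPolynomial.C (a i) * MvPolynomial.X i

/-- The ideal of `ℂ[f₁, …, f_{g+3}]` generated by `ℓ₀` and `ℓ₁`. -/
def idealW (a : Fin (g + 3) ↪ ℂ) : Ideal (MvPolynomial (Fin (g + 3)) ℂ) :=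
  Ideal.span {ell0 g, ell1 a}

/-- A linear substitution whose kernel is `(ℓ₀, ℓ₁)`; only used to see that this ideal is prime. -/
def projW (a : Fin (g + 3) ↪ ℂ) : MvPolynomial (Fin (g + 3)) ℂ →ₐ[ℂ] MvPolynomial (Fin (g + 3)) ℂ :=
  MvPolynomial.aeval fun i => MvPolynomial.X i
    - (if i = 0 then MvPolynomial.C (a 1 - a 0)⁻¹ * (MvPolynomial.C (a 1) * ell0 g - ell1 a) else 0)
    - (if i = 1 then MvPolynomial.C (a 1 - a 0)⁻¹ * (ell1 a - MvPolynomial.C (a 0) * ell0 g) else 0)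

theorem a_sub_ne (a : Fin (g + 3) ↪ ℂ) {i j : Fin (g + 3)} (h : i ≠ j) : a i - a j ≠ 0 :=
  sub_ne_zero.mpr fun e => h (a.injective e)

theorem ker_projW (a : Fin (g + 3) ↪ ℂ) : RingHom.ker (projW a) = idealW a := by
  have h0 : ell0 g ∈ idealW a := Ideal.subset_span (by simp)
  have h1 : ell1 a ∈ idealW a := Ideal.subset_span (by simp)
  have h10 : (1 : Fin (g + 3)) ≠ 0 := by simp
  have hC : (MvPolynomial.C (a 1 - a 0)⁻¹ : MvPolynomial (Fin (g + 3)) ℂ) *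
      (MvPolynomial.C (a 1) - MvPolynomial.C (a 0)) = 1 := by
    rw [← MvPolynomial.C_sub, ← MvPolynomial.C_mul, inv_mul_cancel₀ (a_sub_ne a h10),
      MvPolynomial.C_1]
  apply le_antisymm
  · have key : ∀ q, q - projW a q ∈ idealW a := by
      intro q
      induction q using MvPolynomial.induction_on with
      | C c =>
        have : projW a (MvPolynomial.C c) = MvPolynomial.C c := by simp [projW]
        simp [this]
      | add p q hp hq =>
        rw [map_add, add_sub_add_comm]
        exact Ideal.add_mem _ hp hq
      | mul_X p i hp =>
        have hX : MvPolynomial.X i - projW a (MvPolynomial.X i) ∈ idealW a := by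
          rw [projW, MvPolynomial.aeval_X]
          have e0 : MvPolynomial.C (a 1 - a 0)⁻¹ * (MvPolynomial.C (a 1) * ell0 g - ell1 a) ∈
              idealW a :=
            Ideal.mul_mem_left _ _ (Ideal.sub_mem _ (Ideal.mul_mem_left _ _ h0) h1)
          have e1 : MvPolynomial.C (a 1 - a 0)⁻¹ * (ell1 a - MvPolynomial.C (a 0) * ell0 g) ∈
              idealW a :=
            Ideal.mul_mem_left _ _ (Ideal.sub_mem _ h1 (Ideal.mul_mem_left _ _ h0))
          rw [sub_sub, sub_sub_cancel]
          refine Ideal.add_mem _ ?_ ?_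
          · split_ifs
            · exact e0
            · exact Ideal.zero_mem _
          · split_ifs
            · exact e1
            · exact Ideal.zero_mem _
        rw [map_mul, show p * MvPolynomial.X i - projW a p * projW a (MvPolynomial.X i) =
          (p - projW a p) * MvPolynomial.X i
            + projW a p * (MvPolynomial.X i - projW a (MvPolynomial.X i)) by ring]
        exact Ideal.add_mem _ (Ideal.mul_mem_right _ _ hp) (Ideal.mul_mem_left _ _ hX)
    intro q hq
    have := key q
    rwa [(RingHom.mem_ker).mp hq, sub_zero] at this
  · rw [idealW, Ideal.span_le]
    rintro q (rfl | rfl)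
    · change projW a (ell0 g) = 0
      have e : projW a (ell0 g) = ell0 g
          - MvPolynomial.C (a 1 - a 0)⁻¹ * (MvPolynomial.C (a 1) * ell0 g - ell1 a)
          - MvPolynomial.C (a 1 - a 0)⁻¹ * (ell1 a - MvPolynomial.C (a 0) * ell0 g) := by
        conv_lhs => rw [ell0]
        simp only [map_sum, projW, MvPolynomial.aeval_X, Finset.sum_sub_distrib,
          Finset.sum_ite_eq', Finset.mem_univ, if_true]
        rfl
      rw [e]
      linear_combination (-ell0 g) * hC
    · change projW a (ell1 a) = 0
      have e : projW a (ell1 a) = ell1 a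
          - MvPolynomial.C (a 0) *
            (MvPolynomial.C (a 1 - a 0)⁻¹ * (MvPolynomial.C (a 1) * ell0 g - ell1 a))
          - MvPolynomial.C (a 1) *
            (MvPolynomial.C (a 1 - a 0)⁻¹ * (ell1 a - MvPolynomial.C (a 0) * ell0 g)) := by
        conv_lhs => rw [ell1]
        simp only [map_sum, map_mul, projW, MvPolynomial.aeval_X, MvPolynomial.aeval_C,
          MvPolynomial.algebraMap_eq, mul_sub (MvPolynomial.C _) (_ - _),
          mul_sub (MvPolynomial.C _) (MvPolynomial.X _), mul_ite, mul_zero, Finset.sum_sub_distrib,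
          Finset.sum_ite_eq', Finset.mem_univ, if_true]
        rfl
      rw [e]
      linear_combination (-ell1 a) * hC

instance (a : Fin (g + 3) ↪ ℂ) : (idealW a).IsPrime := by
  rw [← ker_projW]
  exact RingHom.ker_isPrime _

/-- The localization `ℂ(f₁, …, f_{g+3})_{Span(ℓ₀, ℓ₁)}` of `ℂ[f₁, …, f_{g+3}]` at the prime ideal
`(ℓ₀, ℓ₁)`. -/
abbrev OU (a : Fin (g + 3) ↪ ℂ) : Type := Localization.AtPrime (idealW a)

/-- The functions `fᵢ`. -/
def fv (a : Fin (g + 3) ↪ ℂ) (i : Fin (g + 3)) : OU a :=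
  algebraMap (MvPolynomial (Fin (g + 3)) ℂ) (OU a) (MvPolynomial.X i)

/-- `∑ᵢ aᵢ² fᵢ`. -/
def sv (a : Fin (g + 3) ↪ ℂ) : OU a := ∑ i, (a i ^ 2 : ℂ) • fv a i

/-- A polynomial that does not vanish at the point of the subspace `ℓ₀ = ℓ₁ = 0` supported on three
indices is a unit of the localization. -/
theorem isUnit_of_eval (a : Fin (g + 3) ↪ ℂ) (i j k : Fin (g + 3))
    (q : MvPolynomial (Fin (g + 3)) ℂ)
    (hq : MvPolynomial.eval (Pi.single i (a k - a j) + Pi.single j (a i - a k)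
      + Pi.single k (a j - a i) : Fin (g + 3) → ℂ) q ≠ 0) :
    IsUnit (algebraMap (MvPolynomial (Fin (g + 3)) ℂ) (OU a) q) := by
  rw [IsLocalization.AtPrime.isUnit_to_map_iff (OU a) (idealW a)]
  intro hmem
  apply hq
  have hle : idealW a ≤ RingHom.ker (MvPolynomial.eval (Pi.single i (a k - a j)
      + Pi.single j (a i - a k) + Pi.single k (a j - a i) : Fin (g + 3) → ℂ)) := by
    rw [idealW, Ideal.span_le]
    rintro q (rfl | rfl)
    · simp [ell0, RingHom.mem_ker, Finset.sum_add_distrib]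
    · simp only [ell1, SetLike.mem_coe, RingHom.mem_ker, map_sum, map_mul, MvPolynomial.eval_C,
        MvPolynomial.eval_X, Pi.add_apply, mul_add, Finset.sum_add_distrib, Pi.single_apply,
        mul_ite, mul_zero, Finset.sum_ite_eq', Finset.mem_univ, if_true]
      ring
  exact hle hmem

theorem isUnit_fv (a : Fin (g + 3) ↪ ℂ) (i : Fin (g + 3)) : IsUnit (fv a i) := by
  obtain ⟨j, k, hij, hik, hjk⟩ : ∃ j k : Fin (g + 3), i ≠ j ∧ i ≠ k ∧ j ≠ k := by
    have h01 : (0 : Fin (g + 3)) ≠ 1 := by simp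
    have h02 : (0 : Fin (g + 3)) ≠ ⟨2, by omega⟩ := by simp [Fin.ext_iff]
    have h12 : (1 : Fin (g + 3)) ≠ ⟨2, by omega⟩ := by simp [Fin.ext_iff]
    by_cases h0 : i = 0
    · exact ⟨1, ⟨2, by omega⟩, h0 ▸ h01, h0 ▸ h02, h12⟩
    · by_cases h1 : i = 1
      · exact ⟨0, ⟨2, by omega⟩, h0, h1 ▸ h12, h02⟩
      · exact ⟨0, 1, h0, h1, h01⟩
  refine isUnit_of_eval a i j k _ ?_
  simpa [hij, hik] using a_sub_ne a hjk.symm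

theorem isUnit_sv (a : Fin (g + 3) ↪ ℂ) : IsUnit (sv a) := by
  have h01 : (0 : Fin (g + 3)) ≠ 1 := by simp
  have h02 : (0 : Fin (g + 3)) ≠ ⟨2, by omega⟩ := by simp [Fin.ext_iff]
  have h12 : (1 : Fin (g + 3)) ≠ ⟨2, by omega⟩ := by simp [Fin.ext_iff]
  have h := isUnit_of_eval a 0 1 ⟨2, by omega⟩
    (∑ i, (a i ^ 2 : ℂ) • MvPolynomial.X i) (by
      simp only [map_sum, MvPolynomial.smul_eval,
        MvPolynomial.eval_X, Pi.add_apply, mul_add, Finset.sum_add_distrib, Pi.single_apply,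
        mul_ite, mul_zero, Finset.sum_ite_eq', Finset.mem_univ, if_true]
      have := mul_ne_zero (mul_ne_zero (a_sub_ne a h01) (a_sub_ne a h02)) (a_sub_ne a h12)
      intro h
      apply this
      linear_combination -h)
  have e : sv a = algebraMap (MvPolynomial (Fin (g + 3)) ℂ) (OU a)
      (∑ i, (a i ^ 2 : ℂ) • MvPolynomial.X i) := by
    rw [map_sum]
    refine Finset.sum_congr rfl fun i _ => ?_
    rw [fv, Algebra.smul_def, Algebra.smul_def, map_mul,
      ← IsScalarTower.algebraMap_apply ℂ (MvPolynomial (Fin (g + 3)) ℂ) (OU a)]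
  rw [e]
  exact h

/-- `fᵢ⁻¹`. -/
def fInv (a : Fin (g + 3) ↪ ℂ) (i : Fin (g + 3)) : OU a := ((isUnit_fv a i).unit⁻¹ : (OU a)ˣ)

/-- `f̄ᵢ = fᵢ / ∑ⱼ aⱼ² fⱼ`. -/
def fNorm (a : Fin (g + 3) ↪ ℂ) (i : Fin (g + 3)) : OU a :=
  fv a i * ((isUnit_sv a).unit⁻¹ : (OU a)ˣ)

/-- The algebra `A = ℂ(f₁, …, f_{g+3})_{Span(ℓ₀, ℓ₁)}[f₁*, …, f_{g+3}*]`, with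
`[fᵢ*, fⱼ] = δᵢⱼ` and `[fᵢ*, fⱼ*] = 0`. -/
abbrev DU (a : Fin (g + 3) ↪ ℂ) : Type := Weyl (fv a) (fun _ => 1)

/-- The inclusion of the functions in `A`. -/
abbrev ofU (a : Fin (g + 3) ↪ ℂ) : OU a →ₐ[ℂ] DU a := Weyl.of (fv a) (fun _ => 1)

/-- `hᵢ = -2 fᵢ fᵢ*`. -/
def hv (a : Fin (g + 3) ↪ ℂ) (i : Fin (g + 3)) : DU a :=
  (-2 : ℂ) • (ofU a (fv a i) * Weyl.y (fv a) (fun _ => 1) i)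

/-- The left ideal `Î = A (∑ᵢ hᵢ - 2) + A ℓ₀ + A ℓ₁` of `A`. -/
def IHat (a : Fin (g + 3) ↪ ℂ) : Ideal (DU a) :=
  Ideal.span {∑ i, hv a i - 2, ofU a (∑ i, fv a i), ofU a (∑ i, a i • fv a i)}

/-- `N̂ = {u ∈ A | Î u ⊆ Î}`. -/
def NHat (a : Fin (g + 3) ↪ ℂ) : Subalgebra ℂ (DU a) where
  carrier := {u | ∀ v ∈ IHat a, v * u ∈ IHat a}
  mul_mem' hu hw v hv := by
    rw [← mul_assoc]
    exact hw _ (hu _ hv)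
  add_mem' hu hw v hv := by
    rw [mul_add]
    exact Ideal.add_mem _ (hu _ hv) (hw _ hv)
  algebraMap_mem' c v hv := by
    rw [← Algebra.commutes]
    exact Ideal.mul_mem_left _ _ hv

/-- `Î ∩ N̂`, an ideal of `N̂` (note that `Î ⊆ N̂`). -/
def INHat (a : Fin (g + 3) ↪ ℂ) : Ideal (NHat a) := (IHat a).comap (NHat a).val

instance (a : Fin (g + 3) ↪ ℂ) : (INHat a).IsTwoSided where
  mul_mem_of_left u hv := u.2 _ hv

/-- `A_U = N̂ / Î`. -/
abbrev AU (a : Fin (g + 3) ↪ ℂ) : Type := NHat a ⧸ INHat a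

/-- The class in `A_U` of an element of `N̂`. -/
def cls (a : Fin (g + 3) ↪ ℂ) (u : DU a) (hu : u ∈ NHat a) : AU a :=
  Ideal.Quotient.mk (INHat a) ⟨u, hu⟩

/-- `u` belongs to `N̂` and `w` is its class in `A_U`. -/
def IsClassOf (a : Fin (g + 3) ↪ ℂ) (u : DU a) (w : AU a) : Prop :=
  ∃ hu : u ∈ NHat a, w = cls a u hu

/-! ### The elements `Ŵ[φ]` and the isomorphism `Λ̂` -/

/-- The field `ℂ(V/W)` of rational functions on the subspace `ℓ₀ = ℓ₁ = 0`. -/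
abbrev FU (a : Fin (g + 3) ↪ ℂ) : Type := IsLocalRing.ResidueField (OU a)

/-- `P_f(X) = ∏ᵢ (X - aᵢ) · ∑ᵢ fᵢ / (X - aᵢ)`, as a polynomial over `ℂ(V/W)`. -/
def Pf (a : Fin (g + 3) ↪ ℂ) : Polynomial (FU a) :=
  ∑ i, Polynomial.C (IsLocalRing.residue (OU a) (fv a i)) *
    ∏ j ∈ Finset.univ.erase i, (Polynomial.X - Polynomial.C (algebraMap ℂ (FU a) (a j)))

/-- The expansion at `t = ∞` of a polynomial in `t`, as a Laurent series in `t⁻¹`. -/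
def atInfty (F : Type) [Field F] : Polynomial F →+* LaurentSeries F :=
  Polynomial.eval₂RingHom HahnSeries.C (HahnSeries.single (-1 : ℤ) (1 : F))

/-- `Res_{t=∞} ((P'/P)(t) - (P'/P)(b)) φ(t) dt / (t - b)`, where
`Res_{t=∞} (∑ₖ cₖ t⁻ᵏ dt) = -c₁`. -/
def resInfty {F : Type} [Field F] (P φ : Polynomial F) (b : F) : F :=
  - HahnSeries.coeff
      ((atInfty F P.derivative / atInfty F P - HahnSeries.C (P.derivative.eval b / P.eval b))
        / atInfty F (Polynomial.X - Polynomial.C b) * atInfty F φ) (1 : ℤ)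

/-- `Res_{t=∞} ((P_f'/P_f)(t) - (P_f'/P_f)(aᵢ)) φ(t) dt / (t - aᵢ)`, an element of `ℂ(V/W)`. -/
def resCoeff (a : Fin (g + 3) ↪ ℂ) (φ : Polynomial ℂ) (i : Fin (g + 3)) : FU a :=
  resInfty (Pf a) (φ.map (algebraMap ℂ (FU a))) (algebraMap ℂ (FU a) (a i))

/-- `w` is the class `Ŵ[φ]` of `∑ᵢ cᵢ hᵢ`, with `cᵢ` the residue above. The `cᵢ` are functions on
the subspace `ℓ₀ = ℓ₁ = 0`, and `∑ᵢ cᵢ hᵢ` is a vector field on it: `∑ᵢ cᵢ fᵢ = ∑ᵢ aᵢ cᵢ fᵢ = 0`.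
They are lifted to `A` in such a way that these two equalities still hold, i.e. that the lift of
`∑ᵢ cᵢ hᵢ` commutes with `ℓ₀` and `ℓ₁`. -/
def IsWhat (a : Fin (g + 3) ↪ ℂ) (φ : Polynomial ℂ) (w : AU a) : Prop :=
  ∃ c : Fin (g + 3) → OU a,
    (∀ i, IsLocalRing.residue (OU a) (c i) = resCoeff a φ i) ∧
    ∑ i, c i * fv a i = 0 ∧ ∑ i, a i • (c i * fv a i) = 0 ∧
    IsClassOf a (∑ i, ofU a (c i) * hv a i) w

/-- `∑_{j₁ < … < j_m, j₁, …, j_m ≠ i} a_{j₁} ⋯ a_{j_m}`. -/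
def esymA (a : Fin (g + 3) ↪ ℂ) (m : ℕ) (i : Fin (g + 3)) : ℂ :=
  ∑ t ∈ (Finset.univ.erase i).powersetCard m, ∏ j ∈ t, a j

/-- The values that characterize `Λ̂ : A_X → A_U`. -/
def IsLambdaHat (a : Fin (g + 3) ↪ ℂ) (Λ : AX a ≃ₐ[ℂ] AU a) : Prop :=
  (∀ k : ℕ, 1 ≤ k → k ≤ g →
    IsClassOf a (ofU a (∑ i, esymA a (k + 2) i • fNorm a i)) (Λ (esymX a k))) ∧
  ∀ φ : Polynomial ℂ, IsWhat a φ (Λ (Yhat a φ))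

/-! ### The Gaudin (Hitchin) Hamiltonians -/

/-- `eᵢ = (Cᵢ/2) fᵢ⁻¹ - ¼ fᵢ⁻¹ hᵢ² - ½ fᵢ⁻¹ hᵢ`, so that `eᵢ, fᵢ, hᵢ` satisfy the relations of
`sl₂` and `eᵢ fᵢ + fᵢ eᵢ + ½ hᵢ² = Cᵢ`. -/
def ev (a : Fin (g + 3) ↪ ℂ) (C : Fin (g + 3) → ℂ) (i : Fin (g + 3)) : DU a :=
  (C i / 2) • ofU a (fInv a i) - (1 / 4 : ℂ) • (ofU a (fInv a i) * hv a i ^ 2)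
    - (1 / 2 : ℂ) • (ofU a (fInv a i) * hv a i)

/-- `Ĥᵢ^{Hitch} = ∑_{j ≠ i} (eᵢ fⱼ + fᵢ eⱼ + ½ hᵢ hⱼ) / (aᵢ - aⱼ)`, in `A`. -/
def HHitch (a : Fin (g + 3) ↪ ℂ) (C : Fin (g + 3) → ℂ) (i : Fin (g + 3)) : DU a :=
  ∑ j ∈ Finset.univ.erase i, (a i - a j)⁻¹ •
    (ev a C i * ofU a (fv a j) + ofU a (fv a i) * ev a C j + (1 / 2 : ℂ) • (hv a i * hv a j))

end QIS

end

noncomputable section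
namespace QIS

/-! ### Operators with canonical commutation relations -/

/-! Both algebras are identified with one Weyl algebra `W0`, the differential operators in `e₁, …,
e_g` with coefficients in `ℂ(e₁, …, e_g)`, and the Hamiltonians are compared there.

On the side of `A_X` the `e_k` are the elementary symmetric functions of the `x_α`. On the side of
`A_U`, `P_f` has, up to signs, the coefficients `ε_m = ∑ᵢ esymA m i • fᵢ`. The forms `ε₀, ε₁` span
the same space as `ℓ₀, ℓ₁`, so on the subspace `P_f / ε₂` is monic of degree `g` and one puts `e_k =
ε_{k+2} / ε₂`. The `x_α` are thus the roots of `P_f`: this is separation of variables. On the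
subspace `fᵢ = ε₂ φᵢ`, where `φᵢ` is affine in the `e_k` (`phiE`), and `φᵢ = ∏_α (aᵢ - x_α) / ∏_{j ≠
i} (aᵢ - aⱼ)` in the variables `x_α` (`phiX_eq`).

Injectivity of the maps from `W0` follows from its simplicity (`W0_injective`), once the targets are
known to be nonzero; for `A_U` this is `one_notMem_IHat`. Surjectivity rests on normal forms `∑ r
D^m`, whose coefficients are recovered by commutators with the `e_k` (`mem_opSpan_ker`,
`mem_of_killed`). If an operator is invariant under permutations, so are its coefficients, which are
then functions of the `e_k` (`psiX_surjective`). If a class in `A / Î` comes from the normalizer, it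
is killed by `ε₀` and `ε₁`, hence is represented without transverse derivatives, and it is killed by
the Euler operator plus one, hence its coefficients are homogeneous of degree zero on the subspace
(`psiU_surjective`).

For the Hamiltonians, the `(i, j)` term of the Hitchin operator is a potential minus `fᵢ fⱼ (fᵢ* -
fⱼ*)²` (`hitch_pair`). Modulo `Î` the derivatives transverse to the subspace cancel in the sum over
`j` (`sum_transverse_mem`), which leaves the element `hitchW` of `W0`. The operator built from the
`T̂_α` and `hitchW` both have order at most two, so they agree when their symbols agree and they
have the same values on the `φ_l` (`W0_eq_zero`). Each family acts on `φ_l` by its potential alone.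
The equality of symbols and the equality of potentials (`kin_identity`, `pot_identity`) are two
cases of one Lagrange interpolation at the points `x_α` (`interp_pairs`); the conditions on the `Cᵢ`
are its degree conditions for the potential.

Finally `Ŷ[φ]` and `Ŵ[φ]` are the same vector field `yphi` of `W0`: the residue at infinity is a sum
over the roots `x_α` of `P_f` (`resInfty_prod`, `residue_cW`). The `Ŷ[X^j]` with `j < g` form a
basis of the vector fields, by a Vandermonde determinant, which gives the uniqueness of `Λ̂`. -/

section OpSpan

variable {ι V V' : Type*} [AddCommGroup V'] [Module ℂ V'] [AddCommGroup V] [Module ℂ V]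

/-- The span of the `D_{k₁}^{n₁} ⋯ D_{k_r}^{n_r} s`, for `s` in `S` and `[k₁, …, k_r]` a list. -/
def opSpan (D : ι → Module.End ℂ V) (S : Submodule ℂ V) : List ι → Submodule ℂ V
  | [] => S
  | k :: l => ⨆ n : ℕ, (opSpan D S l).map (D k ^ n)

theorem exists_sum_of_mem_iSup_pow (D : Module.End ℂ V) (S : Submodule ℂ V) {v : V}
    (hv : v ∈ ⨆ n : ℕ, S.map (D ^ n)) :
    ∃ (N : ℕ) (s : ℕ → V), (∀ k, s k ∈ S) ∧ v = ∑ k ∈ Finset.range N, (D ^ k) (s k) := by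
  induction hv using Submodule.iSup_induction' with
  | mem n x hx =>
    obtain ⟨y, hy, rfl⟩ := hx
    refine ⟨n + 1, fun k => if k = n then y else 0, fun k => ?_, ?_⟩
    · dsimp only
      split_ifs
      · exact hy
      · exact S.zero_mem
    · rw [Finset.sum_eq_single n]
      · simp
      · intro b _ hb
        simp [hb]
      · simp
  | zero => exact ⟨0, fun _ => 0, fun _ => S.zero_mem, by simp⟩
  | add x y _ _ hx hy =>
    obtain ⟨N, s, hs, rfl⟩ := hx
    obtain ⟨N', s', hs', rfl⟩ := hy
    have key : ∀ (N M : ℕ) (s : ℕ → V), N ≤ M → ∑ k ∈ Finset.range N, (D ^ k) (s k) =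
        ∑ k ∈ Finset.range M, (D ^ k) (if k < N then s k else 0) := by
      intro N M s h
      rw [← Finset.sum_subset (Finset.range_mono h)]
      · refine Finset.sum_congr rfl fun k hk => ?_
        rw [if_pos (Finset.mem_range.mp hk)]
      · intro k _ hk
        rw [if_neg (by simpa using hk), map_zero]
    refine ⟨max N N', fun k => (if k < N then s k else 0) + (if k < N' then s' k else 0),
      fun k => S.add_mem ?_ ?_, ?_⟩
    · split_ifs
      · exact hs k
      · exact S.zero_mem
    · split_ifs
      · exact hs' k
      · exact S.zero_mem
    · rw [key N _ s (le_max_left _ _), key N' _ s' (le_max_right N N'), ← Finset.sum_add_distrib]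
      simp_rw [map_add]

theorem apply_pow_of_ccr {δ D : Module.End ℂ V} (h : δ * D = D * δ + 1) {s : V} (hs : δ s = 0)
    (k : ℕ) : δ ((D ^ (k + 1)) s) = ((k + 1 : ℕ) : ℂ) • (D ^ k) s := by
  have h' : ∀ v, δ (D v) = D (δ v) + v := fun v => by
    simpa using congrArg (fun f : Module.End ℂ V => f v) h
  induction k with
  | zero => simp [h', hs]
  | succ k ih =>
    rw [pow_succ' D (k + 1), Module.End.mul_apply, h', ih, map_smul, pow_succ' D k,
      Module.End.mul_apply]
    push_cast
    module

/-- Applying `δ` lowers the degree by one, as differentiation does for a polynomial in `D`; the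
integer factors are invertible, so induction on the degree applies. -/
theorem eq_zero_of_sum_pow {δ D : Module.End ℂ V} (h : δ * D = D * δ + 1) (N : ℕ) (s : ℕ → V)
    (hs : ∀ k, δ (s k) = 0) (h0 : ∑ k ∈ Finset.range N, (D ^ k) (s k) = 0) :
    ∀ k < N, s k = 0 := by
  induction N generalizing s with
  | zero => intro k hk; omega
  | succ N ih =>
    have h1 := congrArg δ h0
    rw [Finset.sum_range_succ', map_add, map_sum, map_zero, pow_zero, Module.End.one_apply, hs 0,
      add_zero] at h1
    have h2 := ih (fun k => ((k + 1 : ℕ) : ℂ) • s (k + 1)) (fun k => by simp [hs]) (by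
      rw [← h1]
      refine Finset.sum_congr rfl fun k _ => ?_
      rw [apply_pow_of_ccr h (hs _), map_smul])
    have h3 : ∀ k < N, s (k + 1) = 0 := fun k hk =>
      (smul_eq_zero.mp (h2 k hk)).resolve_left (Nat.cast_ne_zero.mpr (Nat.succ_ne_zero k))
    intro k hk
    cases k with
    | succ k => exact h3 k (by omega)
    | zero =>
      rw [Finset.sum_range_succ', Finset.sum_eq_zero fun k hk => by
        rw [h3 k (Finset.mem_range.mp hk), map_zero]] at h0
      simpa using h0

/-- The image under `Ω` of an expansion `∑ D^k s_k` is an expansion in the target with coefficients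
killed by `δ'`, and uniqueness there makes each `Ω (s k)` vanish. -/
theorem mem_iSup_pow_ker {D : Module.End ℂ V} {δ' D' : Module.End ℂ V'}
    (h' : δ' * D' = D' * δ' + 1) (Ω : V →ₗ[ℂ] V') (hD : ∀ v, Ω (D v) = D' (Ω v))
    (S : Submodule ℂ V) (hS : ∀ s ∈ S, δ' (Ω s) = 0) {v : V}
    (hv : v ∈ ⨆ n : ℕ, S.map (D ^ n)) (h0 : Ω v = 0) :
    v ∈ ⨆ n : ℕ, (S ⊓ LinearMap.ker Ω).map (D ^ n) := by
  obtain ⟨N, s, hs, rfl⟩ := exists_sum_of_mem_iSup_pow D S hv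
  have hpow : ∀ (k : ℕ) v, Ω ((D ^ k) v) = (D' ^ k) (Ω v) := by
    intro k
    induction k with
    | zero => simp
    | succ k ih => intro v; rw [pow_succ, pow_succ, Module.End.mul_apply, Module.End.mul_apply,
        ih, hD]
  have := eq_zero_of_sum_pow h' N (fun k => Ω (s k)) (fun k => hS _ (hs k)) (by
    rw [← h0, map_sum]
    simp_rw [hpow])
  refine Submodule.sum_mem _ fun k hk => Submodule.mem_iSup_of_mem k ?_
  exact ⟨s k, ⟨hs k, this k (Finset.mem_range.mp hk)⟩, rfl⟩

/-- An expansion killed by `δ` has no term of positive degree in `D`, again by uniqueness of the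
coefficients. -/
theorem mem_of_apply_eq_zero {δ D : Module.End ℂ V} (h : δ * D = D * δ + 1) (S : Submodule ℂ V)
    (hS : ∀ s ∈ S, δ s = 0) {v : V} (hv : v ∈ ⨆ n : ℕ, S.map (D ^ n)) (h0 : δ v = 0) : v ∈ S := by
  obtain ⟨N, s, hs, rfl⟩ := exists_sum_of_mem_iSup_pow D S hv
  cases N with
  | zero => simp
  | succ N =>
    rw [Finset.sum_range_succ', map_add, map_sum, pow_zero, Module.End.one_apply, hS _ (hs 0),
      add_zero] at h0
    have h2 := eq_zero_of_sum_pow h N (fun k => ((k + 1 : ℕ) : ℂ) • s (k + 1))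
      (fun k => by simp [hS _ (hs _)]) (by
      rw [← h0]
      refine Finset.sum_congr rfl fun k _ => ?_
      rw [apply_pow_of_ccr h (hS _ (hs _)), map_smul])
    have h3 : ∀ k < N, s (k + 1) = 0 := fun k hk =>
      (smul_eq_zero.mp (h2 k hk)).resolve_left (Nat.cast_ne_zero.mpr (Nat.succ_ne_zero k))
    rw [Finset.sum_range_succ', Finset.sum_eq_zero fun k hk => by
        rw [h3 k (Finset.mem_range.mp hk), map_zero]]
    simpa using hs 0

theorem opSpan_le {D : ι → Module.End ℂ V} {S T : Submodule ℂ V} (hS : S ≤ T)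
    (hT : ∀ k, ∀ v ∈ T, D k v ∈ T) (l : List ι) : opSpan D S l ≤ T := by
  induction l with
  | nil => exact hS
  | cons k l ih =>
    refine iSup_le fun n => ?_
    rintro _ ⟨v, hv, rfl⟩
    have : ∀ n : ℕ, (D k ^ n) v ∈ T := fun n => by
      induction n with
      | zero => exact ih hv
      | succ n hn => rw [pow_succ', Module.End.mul_apply]; exact hT k _ hn
    exact this n

theorem le_opSpan (D : ι → Module.End ℂ V) (S : Submodule ℂ V) (l : List ι) :
    S ≤ opSpan D S l := by
  induction l with
  | nil => exact le_rfl
  | cons k l ih =>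
    refine ih.trans (le_trans ?_ (le_iSup _ 0))
    rw [pow_zero, Module.End.one_eq_id, Submodule.map_id]

theorem apply_mem_iSup_pow {D T : Module.End ℂ V} (h : ∀ v, T (D v) = D (T v)) {S : Submodule ℂ V}
    (hS : ∀ s ∈ S, T s ∈ S) {v : V} (hv : v ∈ ⨆ n : ℕ, S.map (D ^ n)) :
    T v ∈ ⨆ n : ℕ, S.map (D ^ n) := by
  obtain ⟨N, s, hs, rfl⟩ := exists_sum_of_mem_iSup_pow D S hv
  have hpow : ∀ (k : ℕ) v, T ((D ^ k) v) = (D ^ k) (T v) := by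
    intro k
    induction k with
    | zero => simp
    | succ k ih => intro v; rw [pow_succ, Module.End.mul_apply, Module.End.mul_apply, ih, h]
  rw [map_sum]
  refine Submodule.sum_mem _ fun k _ => Submodule.mem_iSup_of_mem k ?_
  exact ⟨T (s k), hS _ (hs k), (hpow k _).symm⟩

theorem apply_mem_opSpan {D : ι → Module.End ℂ V} {T : Module.End ℂ V}
    (h : ∀ k v, T (D k v) = D k (T v)) {S : Submodule ℂ V} (hS : ∀ s ∈ S, T s ∈ S) (l : List ι)
    {v : V} (hv : v ∈ opSpan D S l) : T v ∈ opSpan D S l := by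
  induction l generalizing v with
  | nil => exact hS v hv
  | cons k l ih => exact apply_mem_iSup_pow (h k) (fun s hs => ih hs) hv

theorem op_mem_opSpan {D : ι → Module.End ℂ V} (h : ∀ j k v, D j (D k v) = D k (D j v))
    {S : Submodule ℂ V} {l : List ι} {k : ι} (hk : k ∈ l) {v : V} (hv : v ∈ opSpan D S l) :
    D k v ∈ opSpan D S l := by
  induction l generalizing v with
  | nil => simp at hk
  | cons j l ih =>
    by_cases hkj : k = j
    · subst hkj
      obtain ⟨N, s, hs, rfl⟩ := exists_sum_of_mem_iSup_pow _ _ hv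
      rw [map_sum]
      refine Submodule.sum_mem _ fun n _ => Submodule.mem_iSup_of_mem (n + 1) ⟨s n, hs n, ?_⟩
      rw [pow_succ', Module.End.mul_apply]
    · have hk' : k ∈ l := by simpa [hkj] using hk
      exact apply_mem_iSup_pow (h k j) (fun s hs => ih hk' hs) hv

variable [DecidableEq ι]

/-- The canonical commutation relations `δⱼ D_k = D_k δⱼ + δⱼₖ`. -/
def CCR (δ D : ι → Module.End ℂ V) : Prop :=
  ∀ j k, δ j * D k = D k * δ j + if j = k then 1 else 0

/-- For `k` outside the list, `δ k` commutes with every operator used in the span, so it only sees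
the coefficients. -/
theorem opSpan_killed {δ D : ι → Module.End ℂ V} (h : CCR δ D) {S : Submodule ℂ V}
    {k : ι} (hS : ∀ s ∈ S, δ k s = 0) {l : List ι} (hk : k ∉ l) {v : V}
    (hv : v ∈ opSpan D S l) : δ k v = 0 := by
  induction l generalizing v with
  | nil => exact hS v hv
  | cons j l ih =>
    have hkj : k ≠ j := fun e => hk (e ▸ List.mem_cons_self)
    have hk' : k ∉ l := fun e => hk (List.mem_cons_of_mem _ e)
    have hc : ∀ v, δ k (D j v) = D j (δ k v) := fun v => by
      simpa [hkj] using congrArg (fun f : Module.End ℂ V => f v) (h k j)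
    obtain ⟨N, s, hs, rfl⟩ := exists_sum_of_mem_iSup_pow _ _ hv
    rw [map_sum]
    refine Finset.sum_eq_zero fun n _ => ?_
    have hpow : ∀ (n : ℕ) v, δ k ((D j ^ n) v) = (D j ^ n) (δ k v) := by
      intro n
      induction n with
      | zero => simp
      | succ n ih => intro v; rw [pow_succ, Module.End.mul_apply, Module.End.mul_apply, ih, hc]
    rw [hpow, ih hk' (hs n), map_zero]

/-- The coefficients of an element of the kernel of a map that intertwines the operators are in
the kernel. -/
theorem mem_opSpan_ker {δ D : ι → Module.End ℂ V} {δ' D' : ι → Module.End ℂ V'} (h : CCR δ D)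
    (h' : CCR δ' D') (Ω : V →ₗ[ℂ] V') (hD : ∀ k v, Ω (D k v) = D' k (Ω v))
    (hδ : ∀ k v, Ω (δ k v) = δ' k (Ω v)) {S : Submodule ℂ V} (hS : ∀ k, ∀ s ∈ S, δ k s = 0)
    {l : List ι} (hl : l.Nodup) {v : V} (hv : v ∈ opSpan D S l) (h0 : Ω v = 0) :
    v ∈ opSpan D (S ⊓ LinearMap.ker Ω) l := by
  induction l generalizing v with
  | nil => exact ⟨hv, h0⟩
  | cons k l ih =>
    rw [List.nodup_cons] at hl
    have h1 := mem_iSup_pow_ker (δ' := δ' k) (D' := D' k) (by simpa using h' k k) Ω (hD k)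
      (opSpan D S l) (fun s hs => by rw [← hδ, opSpan_killed h (hS k) hl.1 hs, map_zero]) hv h0
    refine (iSup_mono fun n => Submodule.map_mono ?_) h1
    rintro w ⟨hw, hw0⟩
    exact ih hl.2 hw hw0

theorem mem_of_killed {δ D : ι → Module.End ℂ V} (h : CCR δ D) {S : Submodule ℂ V}
    (hS : ∀ k, ∀ s ∈ S, δ k s = 0) {l : List ι} (hl : l.Nodup) {v : V} (hv : v ∈ opSpan D S l)
    (h0 : ∀ k ∈ l, δ k v = 0) : v ∈ S := by
  induction l with
  | nil => exact hv
  | cons k l ih =>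
    rw [List.nodup_cons] at hl
    refine ih hl.2 ?_ fun j hj => h0 j (List.mem_cons_of_mem _ hj)
    exact mem_of_apply_eq_zero (by simpa using h k k) (opSpan D S l)
      (fun s hs => opSpan_killed h (hS k) hl.1 hs) hv (h0 k List.mem_cons_self)

end OpSpan

/-! ### Derivations of localizations -/

section LocDer

variable {P S : Type*} [CommRing P] [Algebra ℂ P] [CommRing S] [Algebra ℂ S] [Algebra P S]
  [IsScalarTower ℂ P S]

/-- `r ↦ r + ε d(r)`. -/
def dualHom (d : Derivation ℂ P S) : P →+* TrivSqZeroExt S S where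
  toFun r := TrivSqZeroExt.inl (algebraMap P S r) + TrivSqZeroExt.inr (d r)
  map_one' := by ext <;> simp
  map_zero' := by ext <;> simp
  map_add' r s := by ext <;> simp
  map_mul' r s := by
    ext
    · simp
    · simp only [Derivation.leibniz, Algebra.smul_def, TrivSqZeroExt.snd_add,
        TrivSqZeroExt.snd_inl, TrivSqZeroExt.snd_inr, TrivSqZeroExt.snd_mul, TrivSqZeroExt.fst_add,
        TrivSqZeroExt.fst_inl, TrivSqZeroExt.fst_inr, smul_eq_mul, MulOpposite.smul_eq_mul_unop,
        MulOpposite.unop_op, Algebra.algebraMap_self, RingHom.id_apply]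
      ring

variable (M : Submonoid P) [IsLocalization M S]

/-- The extension to dual numbers of `dualHom`. -/
def dualLift (d : Derivation ℂ P S) : S →+* TrivSqZeroExt S S :=
  IsLocalization.lift (M := M) (g := dualHom d) fun m => by
    rw [TrivSqZeroExt.isUnit_iff_isUnit_fst]
    simpa [dualHom] using IsLocalization.map_units S m

theorem dualLift_algebraMap (d : Derivation ℂ P S) (r : P) :
    dualLift M d (algebraMap P S r) = dualHom d r :=
  IsLocalization.lift_eq _ _

/-- This is what turns multiplicativity of `dualLift` into the Leibniz rule for its second
component. -/
theorem fst_dualLift (d : Derivation ℂ P S) (s : S) : (dualLift M d s).fst = s := by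
  have : (TrivSqZeroExt.fstHom S S S : TrivSqZeroExt S S →+* S).comp (dualLift M d) =
      RingHom.id S := by
    refine IsLocalization.ringHom_ext M (RingHom.ext fun r => ?_)
    simp [dualLift_algebraMap, dualHom]
  exact congrArg (fun f : S →+* S => f s) this

/-- The extension of a derivation to a localization. -/
def locDer (d : Derivation ℂ P S) : Derivation ℂ S S :=
  Derivation.mk'
    { toFun := fun s => (dualLift M d s).snd
      map_add' := fun s t => by simp
      map_smul' := fun c s => by
        have h : (dualLift M d (algebraMap ℂ S c)).snd = 0 := by
          rw [IsScalarTower.algebraMap_apply ℂ P S, dualLift_algebraMap]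
          simp [dualHom]
        rw [Algebra.smul_def, map_mul, TrivSqZeroExt.snd_mul, h, fst_dualLift]
        simp [Algebra.smul_def] }
    (fun s t => by simp [fst_dualLift, mul_comm])

theorem locDer_algebraMap (d : Derivation ℂ P S) (r : P) :
    locDer M d (algebraMap P S r) = d r := by
  change (dualLift M d (algebraMap P S r)).snd = d r
  simp [dualLift_algebraMap, dualHom]

end LocDer

/-- `R` is generated by the `xⱼ` and by inverses. -/
def LocGen {R ι : Type*} [CommRing R] [Algebra ℂ R] (x : ι → R) : Prop :=
  ∀ S : Subalgebra ℂ R, (∀ j, x j ∈ S) → (∀ u : Rˣ, (u : R) ∈ S → ((u⁻¹ : Rˣ) : R) ∈ S) → S = ⊤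

theorem locGen_of_isLocalization {R ι : Type*} [CommRing R] [Algebra ℂ R]
    [Algebra (MvPolynomial ι ℂ) R] [IsScalarTower ℂ (MvPolynomial ι ℂ) R]
    (M : Submonoid (MvPolynomial ι ℂ)) [IsLocalization M R] :
    LocGen fun j => algebraMap (MvPolynomial ι ℂ) R (MvPolynomial.X j) := by
  intro S hx hu
  have hp : ∀ p, algebraMap (MvPolynomial ι ℂ) R p ∈ S := by
    intro p
    induction p using MvPolynomial.induction_on with
    | C c =>
      rw [← MvPolynomial.algebraMap_eq, ← IsScalarTower.algebraMap_apply]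
      exact S.algebraMap_mem c
    | add p q hp hq => rw [map_add]; exact S.add_mem hp hq
    | mul_X p i hp => rw [map_mul]; exact S.mul_mem hp (hx i)
  refine eq_top_iff.mpr fun r _ => ?_
  obtain ⟨p, q, rfl⟩ := IsLocalization.exists_mk'_eq M r
  have h := hu (IsLocalization.map_units R q).unit (hp q)
  have e : IsLocalization.mk' R p q = algebraMap _ R p *
      (((IsLocalization.map_units R q).unit⁻¹ : Rˣ) : R) := by
    rw [IsLocalization.mk'_eq_iff_eq_mul, mul_assoc, IsUnit.val_inv_mul, mul_one]
  rw [e]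
  exact S.mul_mem (hp p) h

/-- The equalizer of two homomorphisms is stable under inverses because inverses are unique. -/
theorem LocGen.algHom_ext {R ι B : Type*} [CommRing R] [Algebra ℂ R] {x : ι → R} (hx : LocGen x)
    [Ring B] [Algebra ℂ B] {f h : R →ₐ[ℂ] B} (he : ∀ j, f (x j) = h (x j)) : f = h := by
  have := hx (AlgHom.equalizer f h) he (fun u hu => by
    change f u = h u at hu
    change f (u⁻¹ : Rˣ) = h (u⁻¹ : Rˣ)
    have h1 : f u * f (u⁻¹ : Rˣ) = 1 := by rw [← map_mul]; simp
    have h2 : h (u⁻¹ : Rˣ) * h u = 1 := by rw [← map_mul]; simp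
    calc f (u⁻¹ : Rˣ) = h (u⁻¹ : Rˣ) * h u * f (u⁻¹ : Rˣ) := by rw [h2, one_mul]
      _ = h (u⁻¹ : Rˣ) := by rw [← hu, mul_assoc, h1, mul_one])
  ext r
  exact (this ▸ Algebra.mem_top : r ∈ AlgHom.equalizer f h)

/-- In an algebra, a commutation relation with the generators extends to all of `R`. -/
theorem LocGen.commutator {R ι B : Type*} [CommRing R] [Algebra ℂ R] {x : ι → R} (hx : LocGen x)
    [Ring B] [Algebra ℂ B] (f : R →ₐ[ℂ] B) (d : Derivation ℂ R R) (D : B)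
    (h : ∀ j, D * f (x j) = f (x j) * D + f (d (x j))) (r : R) :
    D * f r = f r * D + f (d r) := by
  let S : Subalgebra ℂ R :=
    { carrier := {r | D * f r = f r * D + f (d r)}
      mul_mem' := fun {r s} hr hs => by
        simp only [Set.mem_ofPred_eq] at hr hs ⊢
        rw [map_mul, ← mul_assoc, hr, add_mul, mul_assoc, hs, Derivation.leibniz, map_add,
          smul_eq_mul, smul_eq_mul, mul_comm s, map_mul, map_mul, mul_add, mul_assoc, add_assoc]
      add_mem' := fun {r s} hr hs => by
        simp only [Set.mem_ofPred_eq] at hr hs ⊢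
        rw [map_add, mul_add, hr, hs, map_add, map_add, add_mul]
        abel
      algebraMap_mem' := fun c => by
        simp only [Set.mem_ofPred_eq, AlgHom.commutes, Derivation.map_algebraMap, map_zero,
          add_zero]
        exact (Algebra.commutes c D).symm }
  have hS : S = ⊤ := by
    -- Stability under inverses: multiply the relation for `u` by `f u⁻¹` on both sides and use `d
    -- (u * u⁻¹) = 0`.
    refine hx S h fun u hu => ?_
    change D * f u = f u * D + f (d u) at hu
    change D * f (u⁻¹ : Rˣ) = f (u⁻¹ : Rˣ) * D + f (d (u⁻¹ : Rˣ))
    have h1 : f u * f (u⁻¹ : Rˣ) = 1 := by rw [← map_mul]; simp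
    have h2 : f (u⁻¹ : Rˣ) * f u = 1 := by rw [← map_mul]; simp
    have h3 : f (u : R) * f (d (u⁻¹ : Rˣ)) + f (u⁻¹ : Rˣ) * f (d u) = 0 := by
      rw [← map_mul, ← map_mul, ← map_add]
      have : (u : R) * d (u⁻¹ : Rˣ) + (u⁻¹ : Rˣ) * d u = d ((u : R) * (u⁻¹ : Rˣ)) := by
        rw [Derivation.leibniz, smul_eq_mul, smul_eq_mul]
      rw [this, Units.mul_inv, Derivation.map_one_eq_zero, map_zero]
    have h4 : f (d (u⁻¹ : Rˣ)) = - (f (u⁻¹ : Rˣ) * (f (d u) * f (u⁻¹ : Rˣ))) := by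
      have h3' : f (u : R) * f (d (u⁻¹ : Rˣ)) = - (f (d u) * f (u⁻¹ : Rˣ)) := by
        rw [eq_neg_iff_add_eq_zero, ← h3, ← map_mul f (d u), mul_comm (d (u : R)), map_mul]
      calc f (d (u⁻¹ : Rˣ)) = f (u⁻¹ : Rˣ) * f u * f (d (u⁻¹ : Rˣ)) := by rw [h2, one_mul]
        _ = _ := by rw [mul_assoc, h3', mul_neg]
    calc D * f (u⁻¹ : Rˣ) = f (u⁻¹ : Rˣ) * (f u * D) * f (u⁻¹ : Rˣ) := by
          rw [← mul_assoc, h2, one_mul]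
      _ = f (u⁻¹ : Rˣ) * (D * f u - f (d u)) * f (u⁻¹ : Rˣ) := by rw [hu, add_sub_cancel_right]
      _ = f (u⁻¹ : Rˣ) * D * (f u * f (u⁻¹ : Rˣ)) - f (u⁻¹ : Rˣ) * (f (d u) * f (u⁻¹ : Rˣ)) := by
          noncomm_ring
      _ = _ := by rw [h1, mul_one, h4, sub_eq_add_neg]
  exact (hS ▸ Algebra.mem_top : r ∈ S)

/-- For the operator `0`, the relation of `LocGen.commutator` says exactly that the derivation `d -
d'` vanishes. -/
theorem LocGen.derivation_ext {R ι : Type*} [CommRing R] [Algebra ℂ R] {x : ι → R} (hx : LocGen x)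
    {d d' : Derivation ℂ R R} (h : ∀ j, d (x j) = d' (x j)) (r : R) : d r = d' r := by
  have := hx.commutator (AlgHom.id ℂ R) (d - d') (0 : R) (fun j => by simp [h j]) r
  simp only [zero_mul, mul_zero, zero_add, AlgHom.id_apply, Derivation.sub_apply] at this
  exact sub_eq_zero.mp this.symm

/-! ### Homomorphisms from algebras of differential operators -/

section Weyl

variable {R : Type} [CommRing R] [Algebra ℂ R] {n : ℕ} {x p : Fin n → R}

/-- The universal property of `R[y₁, …, yₙ]`. -/
def Weyl.lift {B : Type*} [Ring B] [Algebra ℂ B] (f : R →ₐ[ℂ] B) (Y : Fin n → B)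
    (hc : ∀ i j, Y i * Y j = Y j * Y i)
    (hb : ∀ i j, Y i * f (x j) = f (x j) * Y i + f (if i = j then p i else 0)) :
    Weyl x p →ₐ[ℂ] B :=
  RingQuot.liftAlgHom ℂ ⟨FreeAlgebra.lift ℂ (Sum.elim (fun r => f r) Y), by
    intro u v h
    induction h with
    | add r s => simp
    | mul r s => simp
    | scalar c => simp
    | comm i j => simpa using hc i j
    | bracket i j => simpa using hb i j⟩

section

variable {B : Type*} [Ring B] [Algebra ℂ B] (f : R →ₐ[ℂ] B) (Y : Fin n → B)
    (hc : ∀ i j, Y i * Y j = Y j * Y i)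
    (hb : ∀ i j, Y i * f (x j) = f (x j) * Y i + f (if i = j then p i else 0))

theorem Weyl.lift_of (r : R) : Weyl.lift f Y hc hb (Weyl.of x p r) = f r := by
  change RingQuot.liftAlgHom ℂ _ (RingQuot.mkAlgHom ℂ _ _) = _
  rw [RingQuot.liftAlgHom_mkAlgHom_apply]
  simp

theorem Weyl.lift_y (i : Fin n) : Weyl.lift f Y hc hb (Weyl.y x p i) = Y i := by
  change RingQuot.liftAlgHom ℂ _ (RingQuot.mkAlgHom ℂ _ _) = _
  rw [RingQuot.liftAlgHom_mkAlgHom_apply]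
  simp

end

theorem Weyl.eq_top_of_generators (S : Subalgebra ℂ (Weyl x p)) (ho : ∀ r, Weyl.of x p r ∈ S)
    (hy : ∀ i, Weyl.y x p i ∈ S) : S = ⊤ := by
  refine eq_top_iff.mpr fun w _ => ?_
  obtain ⟨u, rfl⟩ : ∃ u, Weyl.mk x p u = w := RingQuot.mkAlgHom_surjective ℂ (WeylRel x p) w
  induction u using FreeAlgebra.induction with
  | grade0 c => rw [AlgHom.commutes]; exact S.algebraMap_mem c
  | grade1 t =>
    cases t with
    | inl r => exact ho r
    | inr i => exact hy i
  | mul u v hu hv => rw [map_mul]; exact S.mul_mem (hu trivial) (hv trivial)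
  | add u v hu hv => rw [map_add]; exact S.add_mem (hu trivial) (hv trivial)

theorem Weyl.algHom_ext {B : Type*} [Ring B] [Algebra ℂ B] {f h : Weyl x p →ₐ[ℂ] B}
    (ho : ∀ r, f (Weyl.of x p r) = h (Weyl.of x p r))
    (hy : ∀ i, f (Weyl.y x p i) = h (Weyl.y x p i)) : f = h := by
  have := Weyl.eq_top_of_generators (AlgHom.equalizer f h) ho hy
  ext w
  exact (this ▸ Algebra.mem_top : w ∈ AlgHom.equalizer f h)

/-- A subspace containing `1` and stable under left multiplication by generators is everything. -/
theorem Weyl.mem_of_left_stable (T : Submodule ℂ (Weyl x p)) (h1 : 1 ∈ T)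
    (ho : ∀ r, ∀ t ∈ T, Weyl.of x p r * t ∈ T) (hy : ∀ i, ∀ t ∈ T, Weyl.y x p i * t ∈ T)
    (w : Weyl x p) : w ∈ T := by
  let S : Subalgebra ℂ (Weyl x p) :=
    { carrier := {b | ∀ t ∈ T, b * t ∈ T}
      mul_mem' := fun {a b} ha hb t ht => by rw [mul_assoc]; exact ha _ (hb t ht)
      add_mem' := fun {a b} ha hb t ht => by rw [add_mul]; exact T.add_mem (ha t ht) (hb t ht)
      algebraMap_mem' := fun c t ht => by rw [← Algebra.smul_def]; exact T.smul_mem c ht }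
  have hS : S = ⊤ := Weyl.eq_top_of_generators S ho hy
  have : w ∈ S := hS ▸ Algebra.mem_top
  simpa using this 1 h1

end Weyl

/-! ### Normal forms of differential operators. -/

section CrossedProduct

variable {B : Type*} [Ring B] [Algebra ℂ B] {n : ℕ}

/-- `u ↦ u e - e u`. -/
def adOp (e : B) : Module.End ℂ B := LinearMap.mulRight ℂ e - LinearMap.mulLeft ℂ e

@[simp] theorem adOp_apply (e u : B) : adOp e u = u * e - e * u := rfl

/-- The commutator with `e` is a derivation for products and sends `D` to `1` or `0`. It therefore
plays the role of `∂/∂D` on operators written with the `D` on the right. -/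
theorem ccr_adOp (e D : Fin n → B) (h : ∀ j k, D k * e j = e j * D k + if j = k then 1 else 0) :
    CCR (fun j => adOp (e j)) (fun k => LinearMap.mulRight ℂ (D k)) := by
  intro j k
  ext u
  have := h j k
  by_cases hjk : j = k
  · simp only [hjk, if_true] at this ⊢
    simp [mul_assoc, this, mul_add, sub_mul]
    abel
  · simp only [hjk, if_false] at this ⊢
    simp [mul_assoc, this, sub_mul]

/-- The span of the `r D^m`. -/
def crossSpan {R : Type*} [CommRing R] [Algebra ℂ R] (f : R →ₐ[ℂ] B) (D : Fin n → B) :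
    Submodule ℂ B :=
  opSpan (fun k => LinearMap.mulRight ℂ (D k)) (LinearMap.range f.toLinearMap) (List.finRange n)

variable {R : Type*} [CommRing R] [Algebra ℂ R] (f : R →ₐ[ℂ] B) (D : Fin n → B)

theorem of_mem_crossSpan (r : R) : f r ∈ crossSpan f D :=
  le_opSpan _ _ _ ⟨r, rfl⟩

theorem of_mul_mem_crossSpan (r : R) {u : B} (hu : u ∈ crossSpan f D) :
    f r * u ∈ crossSpan f D := by
  refine apply_mem_opSpan (T := LinearMap.mulLeft ℂ (f r)) (fun k v => ?_) ?_ _ hu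
  · simp [mul_assoc]
  · rintro _ ⟨s, rfl⟩
    exact ⟨r * s, by simp⟩

theorem mul_D_mem_crossSpan (hc : ∀ i j, D i * D j = D j * D i) (k : Fin n) {u : B}
    (hu : u ∈ crossSpan f D) :
    u * D k ∈ crossSpan f D := by
  refine op_mem_opSpan (D := fun k => LinearMap.mulRight ℂ (D k)) (fun i j v => ?_)
    (List.mem_finRange k) hu
  simp [mul_assoc, hc i j]

/-- The commutator with `b` commutes with right multiplication by the `D i` and maps coefficients to
coefficients, so it preserves normal forms. -/
theorem mul_mem_crossSpan (b : B) (hcb : ∀ i, b * D i = D i * b)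
    (hb : ∀ r, ∃ r', b * f r = f r * b + f r')
    {u : B} (hu : u ∈ crossSpan f D) : b * u - u * b ∈ crossSpan f D := by
  have := apply_mem_opSpan (D := fun k => LinearMap.mulRight ℂ (D k)) (T := - adOp b)
    (S := LinearMap.range f.toLinearMap) (fun k v => ?_) ?_ _ hu
  · rw [crossSpan]
    simpa using this
  · simp [mul_assoc, sub_mul, hcb k]
  · rintro _ ⟨s, rfl⟩
    obtain ⟨r', hr'⟩ := hb s
    exact ⟨r', by simp [hr']⟩

theorem D_mul_mem_crossSpan (hc : ∀ i j, D i * D j = D j * D i)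
    (hd : ∀ k r, ∃ r', D k * f r = f r * D k + f r') (k : Fin n) {u : B}
    (hu : u ∈ crossSpan f D) : D k * u ∈ crossSpan f D := by
  have := mul_mem_crossSpan f D (D k) (fun i => hc k i) (hd k) hu
  simpa using Submodule.add_mem _ this (mul_D_mem_crossSpan f D hc k hu)

end CrossedProduct

/-! ### Elementary symmetric functions and Lagrange interpolation -/

section Esym

open Finset

/-- The elementary symmetric function of degree `m` of the `bⱼ`, `j ∈ s`. -/
def esymOn {ι F : Type*} [CommRing F] (s : Finset ι) (b : ι → F) (m : ℕ) : F :=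
  ∑ t ∈ s.powersetCard m, ∏ j ∈ t, b j

variable {ι F : Type*} [CommRing F]

theorem esymOn_zero (s : Finset ι) (b : ι → F) : esymOn s b 0 = 1 := by
  simp [esymOn]

theorem map_esymOn {F' : Type*} [CommRing F'] (f : F →+* F') (s : Finset ι) (b : ι → F) (m : ℕ) :
    f (esymOn s b m) = esymOn s (fun j => f (b j)) m := by
  simp [esymOn, map_sum, map_prod]

theorem esymOn_insert [DecidableEq ι] {s : Finset ι} {i : ι} (hi : i ∉ s) (b : ι → F) (m : ℕ) :
    esymOn (insert i s) b (m + 1) = esymOn s b (m + 1) + b i * esymOn s b m := by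
  rw [esymOn, powersetCard_succ_insert hi, sum_union, sum_image]
  · rw [esymOn, esymOn, mul_sum]
    congr 1
    refine sum_congr rfl fun t ht => prod_insert fun h => hi ?_
    exact (mem_powersetCard.mp ht).1 h
  · intro t ht t' ht' h
    have h1 : i ∉ t := fun h => hi ((mem_powersetCard.mp ht).1 h)
    have h2 : i ∉ t' := fun h => hi ((mem_powersetCard.mp ht').1 h)
    rw [← erase_insert h1, h, erase_insert h2]
  · refine disjoint_left.mpr fun t ht ht' => ?_
    obtain ⟨t', -, rfl⟩ := mem_image.mp ht'
    exact hi ((mem_powersetCard.mp ht).1 (mem_insert_self _ _))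

theorem esymOn_erase [DecidableEq ι] {s : Finset ι} {i : ι} (hi : i ∈ s) (b : ι → F) (m : ℕ) :
    esymOn s b (m + 1) = esymOn (s.erase i) b (m + 1) + b i * esymOn (s.erase i) b m := by
  rw [← esymOn_insert (notMem_erase i s), insert_erase hi]

theorem prod_sub_eq_sum_esymOn (s : Finset ι) (b : ι → F) (y : F) :
    ∏ j ∈ s, (y - b j) = ∑ m ∈ range (#s + 1), (-1) ^ m * esymOn s b m * y ^ (#s - m) := by
  have h := congrArg (Polynomial.eval y) (Multiset.prod_X_sub_X_eq_sum_esymm (s.val.map b))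
  rw [Multiset.map_map, Polynomial.eval_multiset_prod, Multiset.map_map,
    Polynomial.eval_finsetSum, Multiset.card_map] at h
  simp only [Function.comp_def, Polynomial.eval_sub, Polynomial.eval_X, Polynomial.eval_C,
    Polynomial.eval_mul, Polynomial.eval_pow, Polynomial.eval_neg, Polynomial.eval_one,
    Finset.esymm_map_val] at h
  refine h.trans (sum_congr rfl fun m _ => ?_)
  rw [esymOn, mul_assoc]
  rfl

end Esym

section Lagrange

open Finset

variable {F : Type*} [Field F] {n : ℕ}

theorem prod_erase_sub_eq_sum {R : Type*} [CommRing R] (b : Fin n → R) (i : Fin n) (y : R) :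
    ∏ j ∈ univ.erase i, (y - b j) =
      ∑ m : Fin n, (-1) ^ (m : ℕ) * esymOn (univ.erase i) b m * y ^ (n - 1 - m) := by
  have hn : n - 1 + 1 = n := Nat.sub_add_cancel (Fin.pos i)
  rw [prod_sub_eq_sum_esymOn, card_erase_of_mem (mem_univ i), card_univ, Fintype.card_fin, hn,
    ← Fin.sum_univ_eq_sum_range fun m => (-1) ^ m * esymOn (univ.erase i) b m * y ^ (n - 1 - m)]

/-- The matrix with entries `(-1)^m bᵢ^{n-1-m} / ∏_{j ≠ i} (bᵢ - bⱼ)`. -/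
def lagN (b : Fin n → F) (i : Fin n) (m : ℕ) : F :=
  (-1) ^ m * b i ^ (n - 1 - m) / ∏ j ∈ univ.erase i, (b i - b j)

theorem prod_erase_ne_zero {b : Fin n → F} (hb : Function.Injective b) (i : Fin n) :
    ∏ j ∈ univ.erase i, (b i - b j) ≠ 0 :=
  prod_ne_zero_iff.mpr fun _ hj => sub_ne_zero.mpr fun e => ne_of_mem_erase hj (hb e).symm

/-- The sum is the polynomial `∏_{l ≠ j} (X - b_l)`, expanded by Vieta, evaluated at `bᵢ` and
divided by its value at `bᵢ` for `j = i`. -/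
theorem sum_lagN_mul_esymOn {b : Fin n → F} (hb : Function.Injective b) (i j : Fin n) :
    ∑ m : Fin n, lagN b i m * esymOn (univ.erase j) b m = if i = j then 1 else 0 := by
  have h : ∑ m : Fin n, lagN b i m * esymOn (univ.erase j) b m =
      (∏ l ∈ univ.erase j, (b i - b l)) / ∏ l ∈ univ.erase i, (b i - b l) := by
    rw [prod_erase_sub_eq_sum b j, sum_div]
    refine sum_congr rfl fun m _ => ?_
    rw [lagN]
    ring
  rw [h]
  split_ifs with hij
  · subst hij
    exact div_self (prod_erase_ne_zero hb i)
  · rw [prod_eq_zero (i := i) (mem_erase.mpr ⟨hij, mem_univ i⟩) (sub_self _), zero_div]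

/-- The preceding identity in the other order: a one-sided inverse of a square matrix is two-sided.
-/
theorem sum_esymOn_mul_lagN {b : Fin n → F} (hb : Function.Injective b) (m m' : Fin n) :
    ∑ i : Fin n, esymOn (univ.erase i) b m * lagN b i m' = if m = m' then 1 else 0 := by
  let A : Matrix (Fin n) (Fin n) F := fun i m => lagN b i m
  let B : Matrix (Fin n) (Fin n) F := fun m i => esymOn (univ.erase i) b m
  have h : A * B = 1 := by
    ext i j
    rw [Matrix.mul_apply, Matrix.one_apply]
    exact sum_lagN_mul_esymOn hb i j
  have h' : B * A = 1 := mul_eq_one_comm.mp h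
  have := congrFun (congrFun h' m) m'
  rwa [Matrix.mul_apply, Matrix.one_apply] at this

end Lagrange

/-! ### The field `ℂ(x₁, …, x_g)` -/

section KX

variable {g : ℕ}

theorem locGen_xv : LocGen (xv (g := g)) :=
  locGen_of_isLocalization (nonZeroDivisors (MvPolynomial (Fin g) ℂ))

/-- The derivation `∂/∂x_α`. -/
def dX (α : Fin g) : Derivation ℂ (KX g) (KX g) :=
  locDer (nonZeroDivisors (MvPolynomial (Fin g) ℂ))
    (MvPolynomial.mkDerivation ℂ (Pi.single α (1 : KX g)))

theorem dX_xv (α β : Fin g) : dX α (xv β) = if α = β then 1 else 0 := by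
  rw [dX, xv, locDer_algebraMap, MvPolynomial.mkDerivation_X, Pi.single_apply]
  simp [eq_comm]

theorem xv_injective : Function.Injective (xv (g := g)) := fun _ _ h =>
  MvPolynomial.X_injective (IsFractionRing.injective (MvPolynomial (Fin g) ℂ) (KX g) h)

theorem derivation_sum_apply {R ι : Type*} [CommRing R] [Algebra ℂ R] (s : Finset ι)
    (d : ι → Derivation ℂ R R) (r : R) : (∑ i ∈ s, d i) r = ∑ i ∈ s, d i r := by
  classical
  induction s using Finset.induction_on with
  | empty => simp
  | insert i s hi ih => rw [Finset.sum_insert hi, Finset.sum_insert hi, Derivation.add_apply, ih]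

theorem derivation_eq_sum (d : Derivation ℂ (KX g) (KX g)) (r : KX g) :
    d r = ∑ α, d (xv α) * dX α r := by
  have := locGen_xv.derivation_ext (d := d) (d' := ∑ α, d (xv α) • dX α) (fun β => by
    simp [derivation_sum_apply, dX_xv]) r
  simpa [derivation_sum_apply] using this

theorem dX_comm (α β : Fin g) (r : KX g) : dX α (dX β r) = dX β (dX α r) := by
  have : ∀ r, (⁅dX α, dX β⁆ : Derivation ℂ (KX g) (KX g)) r =
      (0 : Derivation ℂ (KX g) (KX g)) r :=
    locGen_xv.derivation_ext fun j => by
      rw [Derivation.commutator_apply, dX_xv, dX_xv]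
      split_ifs <;> simp
  have h := this r
  rwa [Derivation.commutator_apply, Derivation.zero_apply, sub_eq_zero] at h

theorem xv_sub_ne (α : Fin g) (c : ℂ) : xv α - algebraMap ℂ (KX g) c ≠ 0 := by
  intro h
  have h1 : (MvPolynomial.X α : MvPolynomial (Fin g) ℂ) = MvPolynomial.C c := by
    apply IsFractionRing.injective (MvPolynomial (Fin g) ℂ) (KX g)
    rw [← MvPolynomial.algebraMap_eq, ← IsScalarTower.algebraMap_apply]
    exact sub_eq_zero.mp h
  have := congrArg MvPolynomial.totalDegree h1
  simp at this

theorem dX_algebraMap (α : Fin g) (c : ℂ) : dX α (algebraMap ℂ (KX g) c) = 0 :=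
  Derivation.map_algebraMap _ _

/-- The elementary symmetric function of degree `m` of `x₁, …, x_g`. -/
def eX (g m : ℕ) : KX g := esymOn Finset.univ (xv (g := g)) m

theorem eX_eq (m : ℕ) :
    eX g m = algebraMap (MvPolynomial (Fin g) ℂ) (KX g) (MvPolynomial.esymm (Fin g) ℂ m) := by
  simp [eX, esymOn, MvPolynomial.esymm, xv, map_sum, map_prod]

theorem dX_esymOn_of_notMem {s : Finset (Fin g)} {α : Fin g} (h : α ∉ s) (m : ℕ) :
    dX α (esymOn s xv m) = 0 := by
  rw [esymOn, map_sum]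
  refine Finset.sum_eq_zero fun t ht => ?_
  have hα : ∀ β ∈ t, dX α (xv β) = 0 := fun β hβ => by
    rw [dX_xv, if_neg]
    rintro rfl
    exact h ((Finset.mem_powersetCard.mp ht).1 hβ)
  clear ht
  induction t using Finset.induction_on with
  | empty => simp
  | insert β t hβ ih =>
    rw [Finset.prod_insert hβ, Derivation.leibniz, hα β (Finset.mem_insert_self _ _),
      ih fun γ hγ => hα γ (Finset.mem_insert_of_mem hγ)]
    simp

/-- Splitting off `x_α` makes `e_{m+1}` affine in it. These derivatives form the Jacobian of `x ↦
e`, whose inverse is `lagN`; hence the definition of `dE`. -/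
theorem dX_eX (α : Fin g) (m : ℕ) :
    dX α (eX g (m + 1)) = esymOn (Finset.univ.erase α) xv m := by
  rw [eX, esymOn_erase (Finset.mem_univ α), map_add, Derivation.leibniz,
    dX_esymOn_of_notMem (Finset.notMem_erase _ _), dX_esymOn_of_notMem (Finset.notMem_erase _ _),
    dX_xv]
  simp

/-- The derivation `∂/∂e_{k+1}` of `ℂ(x₁, …, x_g)`. -/
def dE (k : Fin g) : Derivation ℂ (KX g) (KX g) := ∑ α, lagN xv α k • dX α

theorem dE_apply (k : Fin g) (r : KX g) : dE k r = ∑ α, lagN xv α k * dX α r := by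
  simp [dE, derivation_sum_apply]

theorem dE_xv (k α : Fin g) : dE k (xv α) = lagN xv α k := by
  simp [dE_apply, dX_xv]

theorem dE_eX (k m : Fin g) : dE k (eX g (m + 1)) = if m = k then 1 else 0 := by
  rw [dE_apply, ← sum_esymOn_mul_lagN xv_injective m k]
  exact Finset.sum_congr rfl fun α _ => by rw [dX_eX, mul_comm]

/-- The Jacobian of `x ↦ e` is invertible, so the values on the `x_α` are recovered from the values
on the `e_k`. -/
theorem derivation_eq_zero_of_eX {d : Derivation ℂ (KX g) (KX g)}
    (h : ∀ m : Fin g, d (eX g (m + 1)) = 0) (r : KX g) : d r = 0 := by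
  have hx : ∀ α, d (xv α) = 0 := by
    intro α
    calc d (xv α) = ∑ β, d (xv β) * if α = β then 1 else 0 := by simp
      _ = ∑ β, d (xv β) * ∑ m : Fin g, lagN xv α m * esymOn (Finset.univ.erase β) xv m := by
          simp_rw [sum_lagN_mul_esymOn xv_injective]
      _ = ∑ m : Fin g, lagN xv α m * ∑ β, d (xv β) * dX β (eX g (m + 1)) := by
          simp_rw [Finset.mul_sum]
          rw [Finset.sum_comm]
          refine Finset.sum_congr rfl fun m _ => Finset.sum_congr rfl fun β _ => ?_
          rw [dX_eX]
          ring
      _ = 0 := by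
          refine Finset.sum_eq_zero fun m _ => ?_
          rw [← derivation_eq_sum, h, mul_zero]
  rw [derivation_eq_sum]
  simp [hx]

theorem dE_comm (j k : Fin g) (r : KX g) : dE j (dE k r) = dE k (dE j r) := by
  have := derivation_eq_zero_of_eX (d := ⁅dE j, dE k⁆) (fun m => by
    rw [Derivation.commutator_apply, dE_eX, dE_eX]
    split_ifs <;> simp) r
  rwa [Derivation.commutator_apply, sub_eq_zero] at this

/-- The embedding of `ℂ(e₁, …, e_g)` in `ℂ(x₁, …, x_g)`. -/
def iotaX (g : ℕ) : KX g →ₐ[ℂ] KX g :=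
  IsFractionRing.liftAlgHom (K := KX g)
    (g := ((Algebra.algHom ℂ (MvPolynomial (Fin g) ℂ) (KX g)).comp
      (MvPolynomial.symmetricSubalgebra (Fin g) ℂ).val).comp
      (MvPolynomial.esymmAlgHom (Fin g) ℂ g)) (by
    rw [AlgHom.coe_comp, AlgHom.coe_comp]
    exact ((IsFractionRing.injective (MvPolynomial (Fin g) ℂ) (KX g)).comp
      Subtype.val_injective).comp (MvPolynomial.esymmAlgHom_injective ℂ (by simp)))

theorem iotaX_algebraMap (p : MvPolynomial (Fin g) ℂ) :
    iotaX g (algebraMap _ (KX g) p) = algebraMap _ (KX g)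
      (MvPolynomial.esymmAlgHom (Fin g) ℂ g p : MvPolynomial (Fin g) ℂ) := by
  rw [iotaX, IsFractionRing.liftAlgHom_apply, IsFractionRing.lift_algebraMap]
  rfl

theorem iotaX_xv (k : Fin g) : iotaX g (xv k) = eX g (k + 1) := by
  rw [xv, iotaX_algebraMap, MvPolynomial.esymmAlgHom_apply, MvPolynomial.aeval_X, eX_eq]

theorem permK_algebraMap (s : Equiv.Perm (Fin g)) (p : MvPolynomial (Fin g) ℂ) :
    permK s (algebraMap _ (KX g) p) = algebraMap _ (KX g) (MvPolynomial.rename s p) := by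
  change IsFractionRing.fieldEquivOfAlgEquiv ℂ (KX g) (KX g) (MvPolynomial.renameEquiv ℂ s) _ = _
  rw [IsFractionRing.fieldEquivOfAlgEquiv_algebraMap]
  rfl

theorem permK_iotaX (s : Equiv.Perm (Fin g)) (r : KX g) : permK s (iotaX g r) = iotaX g r := by
  have : (permK s).comp (iotaX g) = iotaX g := locGen_xv.algHom_ext fun k => by
    rw [AlgHom.comp_apply, iotaX_xv, eX_eq, permK_algebraMap]
    congr 1
    exact MvPolynomial.esymm_isSymmetric (Fin g) ℂ _ s
  exact congrArg (fun f : KX g →ₐ[ℂ] KX g => f r) this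

/-- Multiplying numerator and denominator by the other conjugates of the denominator makes the
denominator symmetric. The numerator is then symmetric too, and the fundamental theorem on symmetric
polynomials applies to both. -/
theorem exists_iotaX_eq {r : KX g} (h : ∀ s, permK s r = r) : ∃ r', iotaX g r' = r := by
  have hsym : ∀ p : MvPolynomial (Fin g) ℂ, p.IsSymmetric →
      ∃ r', iotaX g r' = algebraMap _ (KX g) p := by
    intro p hp
    obtain ⟨q, hq⟩ := MvPolynomial.esymmAlgHom_surjective (σ := Fin g) (n := g) ℂ (by simp) ⟨p, hp⟩
    exact ⟨algebraMap _ _ q, by rw [iotaX_algebraMap, hq]⟩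
  obtain ⟨p, q, hq, rfl⟩ := IsFractionRing.div_surjective (A := MvPolynomial (Fin g) ℂ) r
  have hq0 : q ≠ 0 := nonZeroDivisors.ne_zero hq
  let N : MvPolynomial (Fin g) ℂ := ∏ s : Equiv.Perm (Fin g), MvPolynomial.rename s q
  have hN : N.IsSymmetric := by
    intro s
    rw [map_prod]
    refine Fintype.prod_equiv (Equiv.mulLeft s) _ _ fun t => ?_
    rw [MvPolynomial.rename_rename]
    rfl
  have hN0 : N ≠ 0 := Finset.prod_ne_zero_iff.mpr fun s _ =>
    (map_ne_zero_iff _ (MvPolynomial.rename_injective s s.injective)).mpr hq0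
  have hqN : q ∣ N := by
    have := Finset.dvd_prod_of_mem (fun s : Equiv.Perm (Fin g) => MvPolynomial.rename s q)
      (Finset.mem_univ 1)
    simpa using this
  obtain ⟨q', hq'⟩ := hqN
  have hinj := IsFractionRing.injective (MvPolynomial (Fin g) ℂ) (KX g)
  have e : algebraMap _ (KX g) p / algebraMap _ (KX g) q =
      algebraMap _ (KX g) (p * q') / algebraMap _ (KX g) N := by
    have h1 : algebraMap _ (KX g) q ≠ 0 := (map_ne_zero_iff _ hinj).mpr hq0
    have h2 : algebraMap _ (KX g) N ≠ 0 := (map_ne_zero_iff _ hinj).mpr hN0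
    rw [div_eq_div_iff h1 h2, hq', map_mul, map_mul]
    ring
  have hp : (p * q').IsSymmetric := by
    intro s
    have hs := h s
    rw [e, map_div₀, permK_algebraMap, permK_algebraMap, hN s] at hs
    have h2 : algebraMap _ (KX g) N ≠ 0 := (map_ne_zero_iff _ hinj).mpr hN0
    exact hinj ((div_left_inj' h2).mp hs)
  obtain ⟨u, hu⟩ := hsym _ hp
  obtain ⟨v, hv⟩ := hsym _ hN
  exact ⟨u / v, by rw [map_div₀, hu, hv, e]⟩

/-- Both sides agree on generators, where this is `dE_eX`. The general case is a commutation
relation between `dE k` and multiplication operators, evaluated at `1`. -/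
theorem dE_iotaX (k : Fin g) (r : KX g) : dE k (iotaX g r) = iotaX g (dX k r) := by
  have h := locGen_xv.commutator (iotaX g |> (Algebra.lmul ℂ (KX g)).comp) (dX k)
    (dE k : Module.End ℂ (KX g)) (fun j => by
      ext v
      simp only [AlgHom.comp_apply, Module.End.mul_apply, LinearMap.add_apply, Algebra.coe_lmul_eq_mul,
        LinearMap.mul_apply', Derivation.coeFn_coe, Derivation.leibniz, smul_eq_mul, iotaX_xv, dE_eX,
        dX_xv]
      by_cases hjk : j = k
      · simp [hjk]
      · simp [hjk, Ne.symm hjk]) r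
  have := congrArg (fun f : Module.End ℂ (KX g) => f 1) h
  simpa using this

end KX

/-! ### The Weyl algebra over `ℂ(e₁, …, e_g)` -/

/-- The algebra `ℂ(e₁, …, e_g)[∂/∂e₁, …, ∂/∂e_g]`. -/
abbrev W0 (g : ℕ) : Type := Weyl (xv (g := g)) (fun _ => (1 : KX g))

/-- The inclusion of `ℂ(e₁, …, e_g)`. -/
abbrev ofW : KX g →ₐ[ℂ] W0 g := Weyl.of (xv (g := g)) (fun _ => (1 : KX g))

/-- The generators `∂/∂e_{k+1}`. -/
abbrev yW (k : Fin g) : W0 g := Weyl.y (xv (g := g)) (fun _ => (1 : KX g)) k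

theorem yW_mul_ofW (k : Fin g) (r : KX g) : yW k * ofW r = ofW r * yW k + ofW (dX k r) :=
  locGen_xv.commutator ofW (dX k) (yW k) (fun j => by rw [Weyl.y_mul_of, dX_xv]) r

theorem crossSpan_W0 (w : W0 g) : w ∈ crossSpan ofW (yW (g := g)) :=
  Weyl.mem_of_left_stable _ (by simpa using of_mem_crossSpan ofW (yW (g := g)) 1)
    (fun r _ ht => of_mul_mem_crossSpan ofW yW r ht)
    (fun i _ ht => D_mul_mem_crossSpan ofW yW (Weyl.y_comm _ _)
      (fun k r => ⟨_, yW_mul_ofW k r⟩) i ht) w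

theorem ccr_W0 : CCR (fun j => adOp (ofW (xv (g := g) j)))
    (fun k => LinearMap.mulRight ℂ (yW (g := g) k)) :=
  ccr_adOp _ _ fun j k => by
    rw [yW_mul_ofW, dX_xv]
    split_ifs <;> simp_all

theorem adOp_ofW (k : Fin g) : ∀ s ∈ LinearMap.range (ofW (g := g)).toLinearMap,
    adOp (ofW (xv k)) s = 0 := by
  rintro _ ⟨r, rfl⟩
  simp only [AlgHom.toLinearMap_apply, adOp_apply]
  rw [← map_mul, ← map_mul, mul_comm, sub_self]

/-- `W0` is simple. -/
theorem W0_injective {B : Type*} [Ring B] [Algebra ℂ B] [Nontrivial B] (f : W0 g →ₐ[ℂ] B) :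
    Function.Injective f := by
  rw [injective_iff_map_eq_zero]
  intro w hw
  have h' : CCR (fun j => adOp (f (ofW (xv (g := g) j))))
      (fun k => LinearMap.mulRight ℂ (f (yW (g := g) k))) :=
    ccr_adOp _ _ fun j k => by
      rw [← map_mul, yW_mul_ofW, dX_xv, map_add, map_mul]
      split_ifs <;> simp_all
  -- The coefficients of a normal form in the kernel lie in the kernel. They belong to a field, so
  -- they vanish because the target is nontrivial.
  have h := mem_opSpan_ker ccr_W0 h' f.toLinearMap (fun k v => by simp) (fun k v => by simp)
    adOp_ofW (List.nodup_finRange g) (crossSpan_W0 w) hw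
  have hbot : LinearMap.range (ofW (g := g)).toLinearMap ⊓ LinearMap.ker f.toLinearMap ≤ ⊥ := by
    rintro _ ⟨⟨r, rfl⟩, hr⟩
    have hr' : (f.comp ofW).toRingHom r = 0 := hr
    rw [map_eq_zero_iff _ (f.comp ofW).toRingHom.injective] at hr'
    simp [hr']
  simpa using opSpan_le hbot (by simp) _ h

/-- Commuting with all the `e_k` means being killed by all the formal derivatives `∂/∂D`, so only
the term of degree zero remains. -/
theorem exists_ofW_of_comm {w : W0 g} (h : ∀ k, w * ofW (xv k) = ofW (xv k) * w) :
    ∃ r, w = ofW r := by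
  obtain ⟨r, hr⟩ := mem_of_killed ccr_W0 adOp_ofW (List.nodup_finRange g) (crossSpan_W0 w)
    (fun k _ => by rw [adOp_apply, h k, sub_self])
  exact ⟨r, hr.symm⟩

/-! ### Differential operators in the variables `x₁, …, x_g` -/

theorem aeval_PiPoly (a : Fin (g + 3) ↪ ℂ) (α : Fin g) :
    Polynomial.aeval (xv α) (PiPoly a) = ∏ i, (xv α - algebraMap ℂ (KX g) (a i)) := by
  simp [PiPoly, map_prod]

/-- `Π(x_α)`. -/
def piX (a : Fin (g + 3) ↪ ℂ) (α : Fin g) : KX g := Polynomial.aeval (xv α) (PiPoly a)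

theorem piX_ne_zero (a : Fin (g + 3) ↪ ℂ) (α : Fin g) : piX a α ≠ 0 := by
  rw [piX, aeval_PiPoly]
  exact Finset.prod_ne_zero_iff.mpr fun i _ => xv_sub_ne α (a i)

theorem yv_mul_ofX (a : Fin (g + 3) ↪ ℂ) (α : Fin g) (r : KX g) :
    yv a α * ofX a r = ofX a r * yv a α + ofX a (twoPi a α * dX α r) :=
  locGen_xv.commutator (ofX a) (twoPi a α • dX α) (yv a α) (fun j => by
    rw [Weyl.y_mul_of, Derivation.smul_apply, dX_xv]
    simp) r

/-- `∂/∂x_α = ½ Π(x_α)⁻¹ y_α`. -/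
def dhat (a : Fin (g + 3) ↪ ℂ) (α : Fin g) : DX a := ofX a (twoPi a α)⁻¹ * yv a α

theorem twoPi_ne_zero (a : Fin (g + 3) ↪ ℂ) (α : Fin g) : twoPi a α ≠ 0 :=
  mul_ne_zero two_ne_zero (piX_ne_zero a α)

theorem dhat_mul_ofX (a : Fin (g + 3) ↪ ℂ) (α : Fin g) (r : KX g) :
    dhat a α * ofX a r = ofX a r * dhat a α + ofX a (dX α r) := by
  rw [dhat, mul_assoc, yv_mul_ofX, mul_add, ← mul_assoc, ← map_mul, ← map_mul, ← mul_assoc,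
    inv_mul_cancel₀ (twoPi_ne_zero a α), one_mul, mul_comm, map_mul, mul_assoc]

theorem yv_eq (a : Fin (g + 3) ↪ ℂ) (α : Fin g) : yv a α = ofX a (twoPi a α) * dhat a α := by
  rw [dhat, ← mul_assoc, ← map_mul, mul_inv_cancel₀ (twoPi_ne_zero a α), map_one, one_mul]

theorem dX_aeval_of_ne {α β : Fin g} (h : α ≠ β) (φ : Polynomial ℂ) :
    dX α (Polynomial.aeval (xv β) φ) = 0 := by
  induction φ using Polynomial.induction_on' with
  | add p q hp hq => rw [map_add, map_add, hp, hq, add_zero]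
  | monomial n c =>
    rw [Polynomial.aeval_monomial, Derivation.leibniz, Derivation.leibniz_pow, dX_xv, if_neg h]
    simp

theorem dX_two (α : Fin g) : dX α (2 : KX g) = 0 := by
  have := dX_algebraMap α (2 : ℂ)
  rwa [map_ofNat] at this

theorem dX_twoPi_inv {α β : Fin g} (h : α ≠ β) (a : Fin (g + 3) ↪ ℂ) :
    dX α (twoPi a β)⁻¹ = 0 := by
  rw [Derivation.leibniz_inv, twoPi, Derivation.leibniz, dX_aeval_of_ne h]
  simp [dX_two]

theorem dhat_comm (a : Fin (g + 3) ↪ ℂ) (α β : Fin g) :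
    dhat a α * dhat a β = dhat a β * dhat a α := by
  by_cases h : α = β
  · rw [h]
  have key : ∀ α β : Fin g, α ≠ β →
      dhat a α * dhat a β = ofX a ((twoPi a α)⁻¹ * (twoPi a β)⁻¹) * (yv a α * yv a β) := by
    intro α β h
    rw [dhat, dhat, mul_assoc, ← mul_assoc (yv a α), yv_mul_ofX, dX_twoPi_inv h, mul_zero, map_zero,
      add_zero, map_mul]
    simp only [mul_assoc]
  rw [key α β h, key β α (Ne.symm h), mul_comm (twoPi a α)⁻¹, Weyl.y_comm]

theorem permD_dhat (a : Fin (g + 3) ↪ ℂ) (s : Equiv.Perm (Fin g)) (α : Fin g) :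
    permD a s (dhat a α) = dhat a (s α) := by
  rw [dhat, map_mul, permD_of, permD_y, map_inv₀, permK_twoPi, dhat]

/-- `∂/∂e_{k+1}`. -/
def Dhat (a : Fin (g + 3) ↪ ℂ) (k : Fin g) : DX a := ∑ α, ofX a (lagN xv α k) * dhat a α

theorem Dhat_mul_ofX (a : Fin (g + 3) ↪ ℂ) (k : Fin g) (r : KX g) :
    Dhat a k * ofX a r = ofX a r * Dhat a k + ofX a (dE k r) := by
  rw [Dhat, Finset.sum_mul, Finset.mul_sum, dE_apply, map_sum, ← Finset.sum_add_distrib]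
  refine Finset.sum_congr rfl fun α _ => ?_
  rw [mul_assoc, dhat_mul_ofX, mul_add, ← mul_assoc, ← mul_assoc, ← map_mul, ← map_mul, ← map_mul,
    mul_comm r]

/-- The product splits into a second-order part, symmetric because the `dhat` commute, and a
first-order part whose coefficients are symmetric by `dE_comm`. -/
theorem Dhat_comm (a : Fin (g + 3) ↪ ℂ) (j k : Fin g) :
    Dhat a j * Dhat a k = Dhat a k * Dhat a j := by
  have key : ∀ j k : Fin g, Dhat a j * Dhat a k =
      ∑ α, ∑ β, ofX a (lagN xv α j * lagN xv β k) * (dhat a α * dhat a β)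
        + ∑ β, ofX a (dE j (dE k (xv β))) * dhat a β := by
    intro j k
    have h : ∀ β, Dhat a j * (ofX a (lagN xv β k) * dhat a β) =
        ∑ α, ofX a (lagN xv α j * lagN xv β k) * (dhat a α * dhat a β)
          + ofX a (dE j (dE k (xv β))) * dhat a β := by
      intro β
      rw [← mul_assoc, Dhat_mul_ofX, dE_xv, add_mul, Dhat, Finset.mul_sum, Finset.sum_mul]
      congr 1
      refine Finset.sum_congr rfl fun α _ => ?_
      rw [← mul_assoc, ← map_mul, mul_comm (lagN xv β k), mul_assoc]
    conv_lhs => rw [Dhat.eq_1 a k, Finset.mul_sum]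
    simp_rw [h]
    rw [Finset.sum_add_distrib, Finset.sum_comm]
  rw [key, key]
  congr 1
  · rw [Finset.sum_comm]
    refine Finset.sum_congr rfl fun α _ => Finset.sum_congr rfl fun β _ => ?_
    rw [mul_comm (lagN xv β j), dhat_comm]
  · simp_rw [dE_comm j k]

theorem permK_lagN (s : Equiv.Perm (Fin g)) (α : Fin g) (m : ℕ) :
    permK s (lagN xv α m) = lagN xv (s α) m := by
  have he : (Finset.univ.erase (s α)) = (Finset.univ.erase α).map s.toEmbedding := by
    rw [Finset.map_erase, Finset.map_univ_equiv]
    rfl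
  rw [lagN, lagN, he, Finset.prod_map]
  simp [permK_xv, map_prod]

theorem permD_Dhat (a : Fin (g + 3) ↪ ℂ) (s : Equiv.Perm (Fin g)) (k : Fin g) :
    permD a s (Dhat a k) = Dhat a k := by
  refine sum_mem_AX a _ (fun s α => ?_) s
  rw [map_mul, permD_of, permK_lagN, permD_dhat]

/-- The chain rule, obtained by inverting the matrix that defines `Dhat`. -/
theorem dhat_eq (a : Fin (g + 3) ↪ ℂ) (α : Fin g) :
    dhat a α = ∑ k : Fin g, ofX a (dX α (eX g (k + 1))) * Dhat a k := by
  simp_rw [Dhat, Finset.mul_sum]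
  rw [Finset.sum_comm]
  calc dhat a α = ∑ β, ofX a (if β = α then 1 else 0) * dhat a β := by
        rw [Finset.sum_eq_single α]
        · simp
        · intro β _ h
          simp [h]
        · simp
    _ = _ := by
        refine Finset.sum_congr rfl fun β _ => ?_
        rw [← sum_lagN_mul_esymOn xv_injective, map_sum, Finset.sum_mul]
        refine Finset.sum_congr rfl fun k _ => ?_
        rw [dX_eX, ← mul_assoc, ← map_mul, mul_comm (lagN _ _ _)]

theorem crossSpan_DX (a : Fin (g + 3) ↪ ℂ) (u : DX a) : u ∈ crossSpan (ofX a) (Dhat a) := by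
  refine Weyl.mem_of_left_stable _ (by simpa using of_mem_crossSpan (ofX a) (Dhat a) 1)
    (fun r _ ht => of_mul_mem_crossSpan (ofX a) (Dhat a) r ht) (fun α t ht => ?_) u
  rw [show Weyl.y xv (twoPi a) α = _ from yv_eq a α, mul_assoc, dhat_eq, Finset.sum_mul]
  refine of_mul_mem_crossSpan _ _ _ (Submodule.sum_mem _ fun k _ => ?_)
  rw [mul_assoc]
  exact of_mul_mem_crossSpan _ _ _ (D_mul_mem_crossSpan (ofX a) (Dhat a) (Dhat_comm a)
      (fun k r => ⟨_, Dhat_mul_ofX a k r⟩) k ht)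

/-- The embedding of `ℂ(e₁, …, e_g)[∂/∂e₁, …, ∂/∂e_g]` in `ℂ(x₁, …, x_g)[y₁, …, y_g]`. -/
def tauX (a : Fin (g + 3) ↪ ℂ) : W0 g →ₐ[ℂ] DX a :=
  Weyl.lift ((ofX a).comp (iotaX g)) (Dhat a) (Dhat_comm a) (fun i j => by
    simp only [AlgHom.comp_apply]
    rw [Dhat_mul_ofX, iotaX_xv, dE_eX]
    split_ifs <;> simp_all)

theorem tauX_ofW (a : Fin (g + 3) ↪ ℂ) (r : KX g) : tauX a (ofW r) = ofX a (iotaX g r) :=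
  Weyl.lift_of _ _ _ _ r

theorem tauX_yW (a : Fin (g + 3) ↪ ℂ) (k : Fin g) : tauX a (yW k) = Dhat a k :=
  Weyl.lift_y _ _ _ _ k

theorem tauX_mem (a : Fin (g + 3) ↪ ℂ) (w : W0 g) : tauX a w ∈ AX a := by
  have h : (AX a).comap (tauX a) = ⊤ := Weyl.eq_top_of_generators _
    (fun r s => by rw [AlgHom.coe_toRingHom, tauX_ofW, permD_of, permK_iotaX])
    (fun k s => by rw [AlgHom.coe_toRingHom, tauX_yW, permD_Dhat])
  exact (h ▸ Algebra.mem_top : w ∈ (AX a).comap (tauX a))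

/-- The action of `ℂ(x₁, …, x_g)[y₁, …, y_g]` on `ℂ(x₁, …, x_g)`. -/
def actX (a : Fin (g + 3) ↪ ℂ) : DX a →ₐ[ℂ] Module.End ℂ (KX g) :=
  Weyl.lift (Algebra.lmul ℂ (KX g)) (fun α => ((twoPi a α • dX α : Derivation ℂ (KX g) (KX g)) :
      Module.End ℂ (KX g)))
    (fun α β => by
      have h2 : ∀ α β : Fin g, α ≠ β → dX α (twoPi a β) = 0 := by
        intro α β h
        rw [twoPi, Derivation.leibniz, dX_aeval_of_ne h]
        simp [dX_two]
      by_cases h : α = β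
      · rw [h]
      ext r
      simp only [Module.End.mul_apply, Derivation.coeFn_coe, Derivation.smul_apply, smul_eq_mul,
        Derivation.leibniz, h2 α β h, h2 β α (Ne.symm h), dX_comm α β r]
      ring)
    (fun α β => by
      ext r
      simp only [Module.End.mul_apply, LinearMap.add_apply, Algebra.coe_lmul_eq_mul,
        LinearMap.mul_apply', Derivation.coeFn_coe, Derivation.leibniz, Derivation.smul_apply,
        smul_eq_mul, dX_xv]
      split_ifs <;> ring)

theorem actX_ofX (a : Fin (g + 3) ↪ ℂ) (r s : KX g) : actX a (ofX a r) s = r * s := by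
  rw [actX, Weyl.lift_of]
  simp

theorem actX_dhat (a : Fin (g + 3) ↪ ℂ) (α : Fin g) (s : KX g) :
    actX a (dhat a α) s = dX α s := by
  rw [dhat, map_mul, Module.End.mul_apply, actX_ofX, actX, Weyl.lift_y, Derivation.coeFn_coe,
    Derivation.smul_apply, smul_eq_mul, ← mul_assoc, inv_mul_cancel₀ (twoPi_ne_zero a α), one_mul]

theorem actX_Dhat (a : Fin (g + 3) ↪ ℂ) (k : Fin g) (s : KX g) :
    actX a (Dhat a k) s = dE k s := by
  simp [Dhat, dE_apply, LinearMap.sum_apply, actX_ofX, actX_dhat]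

instance (a : Fin (g + 3) ↪ ℂ) : Nontrivial (DX a) := (actX a).toRingHom.domain_nontrivial

/-- The isomorphism of `ℂ(e₁, …, e_g)[∂/∂e₁, …, ∂/∂e_g]` with `A_X`. -/
def psiX (a : Fin (g + 3) ↪ ℂ) : W0 g →ₐ[ℂ] AX a := (tauX a).codRestrict (AX a) (tauX_mem a)

theorem psiX_coe (a : Fin (g + 3) ↪ ℂ) (w : W0 g) : (psiX a w : DX a) = tauX a w := rfl

theorem psiX_injective (a : Fin (g + 3) ↪ ℂ) : Function.Injective (psiX a) := fun _ _ h =>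
  W0_injective (tauX a) (congrArg Subtype.val h)

/-- The map `Ω : u ↦ (s u - u)_s` intertwines right multiplication by the `Dhat k` and commutation
with the `e_k`, because both are invariant. Hence an invariant operator has invariant coefficients,
and these come from `iotaX`. -/
theorem psiX_surjective (a : Fin (g + 3) ↪ ℂ) : Function.Surjective (psiX a) := by
  rintro ⟨u, hu⟩
  let Ω : DX a →ₗ[ℂ] (Equiv.Perm (Fin g) → DX a) :=
    LinearMap.pi fun s => (permD a s).toLinearMap - LinearMap.id
  have hccr : CCR (fun j : Fin g => adOp (ofX a (eX g (j + 1))))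
      (fun k => LinearMap.mulRight ℂ (Dhat a k)) :=
    ccr_adOp _ _ fun j k => by
      rw [Dhat_mul_ofX, dE_eX]
      split_ifs <;> simp_all
  have hccr' : CCR (V := Equiv.Perm (Fin g) → DX a)
      (fun j : Fin g => LinearMap.pi fun s => adOp (ofX a (eX g (j + 1))) ∘ₗ LinearMap.proj s)
      (fun k => LinearMap.pi fun s => LinearMap.mulRight ℂ (Dhat a k) ∘ₗ LinearMap.proj s) := by
    intro j k
    refine LinearMap.ext fun v => funext fun s => ?_
    have := congrArg (fun f : Module.End ℂ (DX a) => f (v s)) (hccr j k)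
    by_cases hjk : j = k
    · simpa [hjk] using this
    · simpa [hjk] using this
  have heX : ∀ (s : Equiv.Perm (Fin g)) (j : Fin g),
      permD a s (ofX a (eX g (j + 1))) = ofX a (eX g (j + 1)) := by
    intro s j
    rw [permD_of, ← iotaX_xv, permK_iotaX]
  have h := mem_opSpan_ker hccr hccr' Ω
    (fun k v => by
      ext s
      simp [Ω, permD_Dhat, sub_mul])
    (fun k v => by
      ext s
      simp [Ω, heX, sub_mul, mul_sub]
      abel)
    (S := LinearMap.range (ofX a).toLinearMap)
    (fun k => by
      rintro _ ⟨r, rfl⟩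
      simp only [AlgHom.toLinearMap_apply, adOp_apply]
      rw [← map_mul, ← map_mul, mul_comm, sub_self])
    (List.nodup_finRange g) (crossSpan_DX a u) (by
      ext s
      simp [Ω, hu s])
  have hle : LinearMap.range (ofX a).toLinearMap ⊓ LinearMap.ker Ω ≤
      LinearMap.range (tauX a).toLinearMap := by
    rintro _ ⟨⟨r, rfl⟩, hr⟩
    have hr' : ∀ s, permK s r = r := by
      intro s
      have := congrFun (LinearMap.mem_ker.mp hr) s
      have h2 : ofX a (permK s r) = ofX a r := by
        simpa [Ω, permD_of, sub_eq_zero] using this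
      have h3 := congrArg (fun v => actX a v 1) h2
      simpa [actX_ofX] using h3
    obtain ⟨r', rfl⟩ := exists_iotaX_eq hr'
    exact ⟨ofW r', tauX_ofW a r'⟩
  obtain ⟨w, hw⟩ := opSpan_le hle (by
    rintro k _ ⟨w, rfl⟩
    exact ⟨w * yW k, by simp [tauX_yW]⟩) _ h
  exact ⟨w, Subtype.ext hw⟩

/-- The isomorphism of `ℂ(e₁, …, e_g)[∂/∂e₁, …, ∂/∂e_g]` with `A_X`. -/
def equivX (a : Fin (g + 3) ↪ ℂ) : W0 g ≃ₐ[ℂ] AX a :=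
  AlgEquiv.ofBijective (psiX a) ⟨psiX_injective a, psiX_surjective a⟩

/-! ### Logarithmic derivatives of rational functions in one variable -/

section Poly

open Polynomial

variable {K : Type*} [Field K]

theorem natDegree_X_mul_derivative_le (p : K[X]) : (X * derivative p).natDegree ≤ p.natDegree := by
  refine natDegree_le_iff_coeff_eq_zero.mpr fun n hn => ?_
  cases n with
  | zero => simp
  | succ n => rw [coeff_X_mul, coeff_derivative, coeff_eq_zero_of_natDegree_lt hn, zero_mul]

theorem coeff_X_mul_derivative (p : K[X]) (n : ℕ) : (X * derivative p).coeff n = n * p.coeff n := by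
  cases n with
  | zero => simp
  | succ n => rw [coeff_X_mul, coeff_derivative]; push_cast; ring

/-- In degree `deg p + deg q` the left side has coefficient `deg p - deg q` times the leading
coefficients. If `deg p < deg q`, the coefficient in degree `2 deg q` forces `t = 0`; if `deg q <
deg p`, the right side has too small a degree. Either way `deg p = deg q`, a contradiction. -/
theorem natDegree_not_lt_of_euler [CharZero K] {p q : K[X]} {t : K} (hp : p ≠ 0) (hq : q ≠ 0)
    (h : X * derivative p * q - p * (X * derivative q) = C t * q ^ 2) :
    ¬ p.natDegree < q.natDegree ∧ ¬ q.natDegree < p.natDegree := by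
  have hc := congrArg (fun r => r.coeff (p.natDegree + q.natDegree)) h
  simp only [coeff_sub] at hc
  rw [coeff_mul_add_eq_of_natDegree_le (natDegree_X_mul_derivative_le p) le_rfl,
    coeff_mul_add_eq_of_natDegree_le le_rfl (natDegree_X_mul_derivative_le q), coeff_X_mul_derivative,
    coeff_X_mul_derivative] at hc
  have hpq : p.coeff p.natDegree * q.coeff q.natDegree ≠ 0 :=
    mul_ne_zero (leadingCoeff_ne_zero.mpr hp) (leadingCoeff_ne_zero.mpr hq)
  have hne : p.natDegree ≠ q.natDegree → (C t * q ^ 2).coeff (p.natDegree + q.natDegree) ≠ 0 := by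
    intro hd h0
    rw [h0] at hc
    have : ((p.natDegree : K) - q.natDegree) * (p.coeff p.natDegree * q.coeff q.natDegree) = 0 := by
      linear_combination hc
    rcases mul_eq_zero.mp this with h1 | h1
    · exact hd (Nat.cast_injective (sub_eq_zero.mp h1))
    · exact hpq h1
  constructor
  · intro hlt
    apply hne hlt.ne
    have h1 := congrArg (fun r => r.coeff (q.natDegree + q.natDegree)) h
    have h2 : (X * derivative p * q - p * (X * derivative q)).coeff (q.natDegree + q.natDegree)
        = 0 := by
      refine coeff_eq_zero_of_natDegree_lt (lt_of_le_of_lt (b := p.natDegree + q.natDegree) ?_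
        (by omega))
      refine (natDegree_sub_le _ _).trans (max_le ?_ ?_)
      · exact natDegree_mul_le.trans (add_le_add_left (natDegree_X_mul_derivative_le p) _)
      · exact natDegree_mul_le.trans (add_le_add_right (natDegree_X_mul_derivative_le q) _)
    simp only [h2] at h1
    rw [coeff_C_mul, sq, coeff_mul_add_eq_of_natDegree_le le_rfl le_rfl] at h1
    have hq' : q.coeff q.natDegree ≠ 0 := leadingCoeff_ne_zero.mpr hq
    have ht : t = 0 := by
      rcases mul_eq_zero.mp h1.symm with h3 | h3
      · exact h3
      · exact absurd h3 (mul_ne_zero hq' hq')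
    simp [ht]
  · intro hlt
    apply hne hlt.ne'
    refine coeff_eq_zero_of_natDegree_lt (lt_of_le_of_lt (natDegree_C_mul_le _ _) ?_)
    refine lt_of_le_of_lt natDegree_pow_le ?_
    omega

/-- A rational function `p / q` such that `s d/ds (p / q)` is constant is constant. -/
theorem eq_C_mul_of_euler [CharZero K] {p q : K[X]} {t : K} (hq : q ≠ 0)
    (h : X * derivative p * q - p * (X * derivative q) = C t * q ^ 2) :
    t = 0 ∧ ∃ r, p = C r * q := by
  have key : ∀ r, p = C r * q → t = 0 ∧ ∃ r, p = C r * q := by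
    intro r hr
    refine ⟨?_, r, hr⟩
    have h0 : C t * q ^ 2 = 0 := by
      rw [← h, hr]
      simp only [derivative_mul, derivative_C]
      ring
    exact C_eq_zero.mp ((mul_eq_zero.mp h0).resolve_right (pow_ne_zero 2 hq))
  by_cases hp : p = 0
  · exact key 0 (by simp [hp])
  have hd := natDegree_not_lt_of_euler hp hq h
  have hdeg : p.natDegree = q.natDegree := by omega
  refine key (p.leadingCoeff / q.leadingCoeff) ?_
  by_contra hne
  set r := p.leadingCoeff / q.leadingCoeff with hr
  have hq' : q.leadingCoeff ≠ 0 := leadingCoeff_ne_zero.mpr hq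
  have hp1 : p - C r * q ≠ 0 := sub_ne_zero.mpr hne
  have h1 : X * derivative (p - C r * q) * q - (p - C r * q) * (X * derivative q) = C t * q ^ 2 := by
    rw [← h]
    simp only [derivative_sub, derivative_mul, derivative_C]
    ring
  -- Subtracting `r * q` preserves the equation and cancels the leading term, so a nonzero
  -- difference would have degree smaller than `q`, which has just been excluded.
  have hd1 := natDegree_not_lt_of_euler hp1 hq h1
  have hcoeff : (p - C r * q).coeff q.natDegree = 0 := by
    rw [coeff_sub, coeff_C_mul, ← hdeg, coeff_natDegree, hdeg, coeff_natDegree, hr,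
      div_mul_cancel₀ _ hq', sub_self]
  have hle : (p - C r * q).natDegree ≤ q.natDegree :=
    (natDegree_sub_le _ _).trans (max_le hdeg.le (natDegree_C_mul_le _ _))
  have heq : (p - C r * q).natDegree = q.natDegree := by omega
  rw [← heq, coeff_natDegree] at hcoeff
  exact hp1 (leadingCoeff_eq_zero.mp hcoeff)

end Poly

/-! ### Linear coordinates adapted to the subspace `ℓ₀ = ℓ₁ = 0` -/

theorem sum_fin_three {M : Type*} [AddCommMonoid M] (f : Fin (g + 3) → M) :
    ∑ m, f m = f 0 + f 1 + f 2 + ∑ k : Fin g, f k.succ.succ.succ := by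
  rw [Fin.sum_univ_succ, Fin.sum_univ_succ, Fin.sum_univ_succ]
  simp only [← add_assoc]
  rfl

theorem esymA_eq (a : Fin (g + 3) ↪ ℂ) (m : ℕ) (i : Fin (g + 3)) :
    esymA a m i = esymOn (Finset.univ.erase i) a m := rfl

theorem esymA_zero (a : Fin (g + 3) ↪ ℂ) (i : Fin (g + 3)) : esymA a 0 i = 1 := esymOn_zero _ _

theorem esymA_one (a : Fin (g + 3) ↪ ℂ) (i : Fin (g + 3)) :
    esymA a 1 i = esymOn Finset.univ a 1 - a i := by
  have := esymOn_erase (Finset.mem_univ i) (a : Fin (g + 3) → ℂ) 0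
  rw [esymOn_zero] at this
  rw [esymA_eq]
  linear_combination -this

theorem esymA_two (a : Fin (g + 3) ↪ ℂ) (i : Fin (g + 3)) :
    esymA a 2 i = esymOn Finset.univ a 2 - a i * esymOn Finset.univ a 1 + a i ^ 2 := by
  have := esymOn_erase (Finset.mem_univ i) (a : Fin (g + 3) → ℂ) 1
  rw [← esymA_eq a 1, esymA_one] at this
  rw [esymA_eq]
  linear_combination -this

/-- The coefficients of `fᵢ` in the linear coordinates `ε_m = ∑ᵢ esymA m i • fᵢ`. -/
abbrev cN (a : Fin (g + 3) ↪ ℂ) (i : Fin (g + 3)) (m : Fin (g + 3)) : ℂ := lagN a i m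

theorem sum_cN_mul_esymA (a : Fin (g + 3) ↪ ℂ) (i j : Fin (g + 3)) :
    ∑ m : Fin (g + 3), cN a i m * esymA a m j = if i = j then 1 else 0 :=
  sum_lagN_mul_esymOn a.injective i j

theorem sum_esymA_mul_cN (a : Fin (g + 3) ↪ ℂ) (m k : Fin (g + 3)) :
    ∑ i, esymA a m i * cN a i k = if m = k then 1 else 0 :=
  sum_esymOn_mul_lagN a.injective m k

/-- The elements `fᵢ / ε₂` modulo `(ℓ₀, ℓ₁)`, as functions of `e₁, …, e_g`. -/
def phiP (a : Fin (g + 3) ↪ ℂ) (i : Fin (g + 3)) : MvPolynomial (Fin g) ℂ :=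
  MvPolynomial.C (cN a i 2) +
    ∑ k : Fin g, MvPolynomial.C (cN a i k.succ.succ.succ) * MvPolynomial.X k

/-- The elements `fᵢ / ε₂` modulo `(ℓ₀, ℓ₁)`, as functions of `e₁, …, e_g`. -/
def phiE (a : Fin (g + 3) ↪ ℂ) (i : Fin (g + 3)) : KX g :=
  algebraMap ℂ (KX g) (cN a i 2) + ∑ k : Fin g, algebraMap ℂ (KX g) (cN a i k.succ.succ.succ) * xv k

theorem algebraMap_phiP (a : Fin (g + 3) ↪ ℂ) (i : Fin (g + 3)) :
    algebraMap _ (KX g) (phiP a i) = phiE a i := by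
  simp only [phiP, phiE, map_add, map_sum, map_mul, ← MvPolynomial.algebraMap_eq,
    ← IsScalarTower.algebraMap_apply]
  rfl

/-- The `φᵢ` are the point of the subspace where `ε₂ = 1` and `ε_{k+2} = e_k`, because `cN` is the
inverse of `esymA`. -/
theorem sum_esymA_mul_phiE (a : Fin (g + 3) ↪ ℂ) (m : Fin (g + 3)) :
    ∑ i, algebraMap ℂ (KX g) (esymA a m i) * phiE a i =
      (if m = 2 then 1 else 0) + ∑ k : Fin g, (if m = k.succ.succ.succ then 1 else 0) * xv k := by
  have h : ∀ m', ∑ i, algebraMap ℂ (KX g) (esymA a m i) * algebraMap ℂ (KX g) (cN a i m') =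
      if m = m' then 1 else 0 := by
    intro m'
    simp_rw [← map_mul]
    rw [← map_sum, sum_esymA_mul_cN]
    split_ifs <;> simp
  simp_rw [phiE, mul_add, Finset.mul_sum, Finset.sum_add_distrib, h]
  rw [Finset.sum_comm]
  congr 1
  refine Finset.sum_congr rfl fun k _ => ?_
  rw [← h, Finset.sum_mul]
  simp_rw [mul_assoc]

theorem two_mod_add_three (g : ℕ) : 2 % (g + 3) = 2 := Nat.mod_eq_of_lt (by omega)

theorem fin_two_ne_succ (k : Fin g) : (2 : Fin (g + 3)) ≠ k.succ.succ.succ := by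
  intro h
  have := congrArg Fin.val h
  simp [two_mod_add_three] at this

theorem sum_esymA_zero_phiE (a : Fin (g + 3) ↪ ℂ) : ∑ i, phiE a i = 0 := by
  have h := sum_esymA_mul_phiE a 0
  have h2 : (0 : Fin (g + 3)) ≠ 2 := by simp [Fin.ext_iff, two_mod_add_three]
  have h3 : ∀ k : Fin g, (0 : Fin (g + 3)) ≠ k.succ.succ.succ := fun k => (Fin.succ_ne_zero _).symm
  simp only [Fin.val_zero, esymA_zero, map_one, one_mul, h2, h3, if_false, zero_mul,
    Finset.sum_const_zero, add_zero] at h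
  exact h

theorem sum_esymA_one_phiE (a : Fin (g + 3) ↪ ℂ) :
    ∑ i, algebraMap ℂ (KX g) (esymA a 1 i) * phiE a i = 0 := by
  have h := sum_esymA_mul_phiE a 1
  have h2 : (1 : Fin (g + 3)) ≠ 2 := by simp [Fin.ext_iff, two_mod_add_three]
  have h3 : ∀ k : Fin g, (1 : Fin (g + 3)) ≠ k.succ.succ.succ := fun k h => by
    have := congrArg Fin.val h
    simp at this
  simpa [h2, h3] using h

theorem sum_esymA_two_phiE (a : Fin (g + 3) ↪ ℂ) :
    ∑ i, algebraMap ℂ (KX g) (esymA a 2 i) * phiE a i = 1 := by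
  have h := sum_esymA_mul_phiE a 2
  simpa [fin_two_ne_succ, two_mod_add_three] using h

theorem sum_esymA_succ_phiE (a : Fin (g + 3) ↪ ℂ) (k : Fin g) :
    ∑ i, algebraMap ℂ (KX g) (esymA a (k + 3) i) * phiE a i = xv k := by
  have h := sum_esymA_mul_phiE a k.succ.succ.succ
  have h2 : k.succ.succ.succ ≠ (2 : Fin (g + 3)) := (fin_two_ne_succ k).symm
  simpa [h2] using h

theorem sum_a_mul_phiE (a : Fin (g + 3) ↪ ℂ) :
    ∑ i, algebraMap ℂ (KX g) (a i) * phiE a i = 0 := by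
  have h := sum_esymA_one_phiE a
  simp_rw [esymA_one, map_sub, sub_mul, Finset.sum_sub_distrib, ← Finset.mul_sum] at h
  rw [sum_esymA_zero_phiE] at h
  simpa using h

theorem sum_a_sq_mul_phiE (a : Fin (g + 3) ↪ ℂ) :
    ∑ i, algebraMap ℂ (KX g) (a i) ^ 2 * phiE a i = 1 := by
  have h := sum_esymA_two_phiE a
  simp_rw [esymA_two, map_add, map_sub, map_mul, map_pow, add_mul, sub_mul,
    Finset.sum_add_distrib, Finset.sum_sub_distrib, mul_right_comm _ _ (phiE a _),
    ← Finset.sum_mul, ← Finset.mul_sum] at h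
  rw [sum_esymA_zero_phiE, sum_a_mul_phiE] at h
  simpa using h

/-! ### The localization `𝒪` -/

/-- The linear forms `ε_m = ∑ᵢ esymA m i • fᵢ`. -/
def epsP (a : Fin (g + 3) ↪ ℂ) (m : ℕ) : MvPolynomial (Fin (g + 3)) ℂ :=
  ∑ i, MvPolynomial.C (esymA a m i) * MvPolynomial.X i

theorem epsP_zero (a : Fin (g + 3) ↪ ℂ) : epsP a 0 = ell0 g := by
  simp [epsP, esymA_zero, ell0]

theorem epsP_one (a : Fin (g + 3) ↪ ℂ) :
    epsP a 1 = MvPolynomial.C (esymOn Finset.univ a 1) * ell0 g - ell1 a := by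
  simp [epsP, esymA_one, ell0, ell1, sub_mul, Finset.mul_sum]

theorem X_eq_sum_epsP (a : Fin (g + 3) ↪ ℂ) (i : Fin (g + 3)) :
    MvPolynomial.X i = ∑ m : Fin (g + 3), MvPolynomial.C (cN a i m) * epsP a m := by
  simp_rw [epsP, Finset.mul_sum]
  rw [Finset.sum_comm]
  simp_rw [← mul_assoc, ← MvPolynomial.C_mul, ← Finset.sum_mul, ← map_sum, sum_cN_mul_esymA]
  simp

theorem epsP_mem (a : Fin (g + 3) ↪ ℂ) : epsP a 0 ∈ idealW a ∧ epsP a 1 ∈ idealW a := by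
  have h0 : ell0 g ∈ idealW a := Ideal.subset_span (by simp)
  have h1 : ell1 a ∈ idealW a := Ideal.subset_span (by simp)
  rw [epsP_zero, epsP_one]
  exact ⟨h0, Ideal.sub_mem _ (Ideal.mul_mem_left _ _ h0) h1⟩

/-- `fᵢ ↦ s φᵢ`. -/
def etaP (a : Fin (g + 3) ↪ ℂ) :
    MvPolynomial (Fin (g + 3)) ℂ →ₐ[ℂ] Polynomial (MvPolynomial (Fin g) ℂ) :=
  MvPolynomial.aeval fun i => Polynomial.C (phiP a i) * Polynomial.X

theorem epsP_two_ne_zero (a : Fin (g + 3) ↪ ℂ) : epsP a 2 ≠ 0 := by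
  intro h
  have h1 := congrArg (MvPolynomial.eval fun i => cN a i 2) h
  simp only [epsP, map_sum, map_mul, MvPolynomial.eval_C, MvPolynomial.eval_X, map_zero] at h1
  have h2 := sum_esymA_mul_cN a 2 2
  rw [if_pos rfl] at h2
  exact one_ne_zero (h2.symm.trans h1)

/-- Setting `ε₀ = ε₁ = 0`. -/
def dropP (a : Fin (g + 3) ↪ ℂ) :
    MvPolynomial (Fin (g + 3)) ℂ →ₐ[ℂ] MvPolynomial (Fin (g + 3)) ℂ :=
  MvPolynomial.aeval fun i => MvPolynomial.X i - MvPolynomial.C (cN a i 0) * epsP a 0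
    - MvPolynomial.C (cN a i 1) * epsP a 1

theorem mk_dropP (a : Fin (g + 3) ↪ ℂ) (q : MvPolynomial (Fin (g + 3)) ℂ) :
    Ideal.Quotient.mk (idealW a) (dropP a q) = Ideal.Quotient.mk (idealW a) q := by
  have : (Ideal.Quotient.mkₐ ℂ (idealW a)).comp (dropP a) = Ideal.Quotient.mkₐ ℂ (idealW a) := by
    refine MvPolynomial.algHom_ext fun i => ?_
    simp only [AlgHom.comp_apply, dropP, MvPolynomial.aeval_X, Ideal.Quotient.mkₐ_eq_mk]
    rw [Ideal.Quotient.mk_eq_mk_iff_sub_mem]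
    have : MvPolynomial.X i - MvPolynomial.C (cN a i 0) * epsP a 0
        - MvPolynomial.C (cN a i 1) * epsP a 1 - MvPolynomial.X i =
        -(MvPolynomial.C (cN a i 0) * epsP a 0 + MvPolynomial.C (cN a i 1) * epsP a 1) := by ring
    rw [this]
    exact (idealW a).neg_mem ((idealW a).add_mem (Ideal.mul_mem_left _ _ (epsP_mem a).1)
      (Ideal.mul_mem_left _ _ (epsP_mem a).2))
  exact congrArg (fun f : _ →ₐ[ℂ] _ => f q) this

theorem dropP_X (a : Fin (g + 3) ↪ ℂ) (i : Fin (g + 3)) :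
    dropP a (MvPolynomial.X i) = MvPolynomial.C (cN a i 2) * epsP a 2 +
      ∑ k : Fin g, MvPolynomial.C (cN a i k.succ.succ.succ) * epsP a (k + 3) := by
  rw [dropP, MvPolynomial.aeval_X, X_eq_sum_epsP a i, sum_fin_three]
  simp only [Fin.val_zero, Fin.val_one, Fin.val_two, Fin.val_succ]
  ring

/-- Evaluation at `e_k = ε_{k+2} / ε₂` and `s = ε₂`. -/
theorem exists_comp_etaP {Fr : Type*} [Field Fr] [Algebra ℂ Fr]
    (f : MvPolynomial (Fin (g + 3)) ℂ →ₐ[ℂ] Fr) (a : Fin (g + 3) ↪ ℂ) (h2 : f (epsP a 2) ≠ 0) :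
    ∃ κ : Polynomial (MvPolynomial (Fin g) ℂ) →+* Fr, ∀ q, κ (etaP a q) = f (dropP a q) := by
  let ev : MvPolynomial (Fin g) ℂ →ₐ[ℂ] Fr :=
    MvPolynomial.aeval fun k : Fin g => f (epsP a (k + 3)) / f (epsP a 2)
  let κ : Polynomial (MvPolynomial (Fin g) ℂ) →+* Fr :=
    Polynomial.eval₂RingHom ev.toRingHom (f (epsP a 2))
  have hκC : ∀ p, κ (Polynomial.C p) = ev p := fun p => Polynomial.eval₂_C _ _
  have hκX : κ Polynomial.X = f (epsP a 2) := Polynomial.eval₂_X _ _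
  have hκ : κ.comp (etaP a).toRingHom = (f.comp (dropP a)).toRingHom := by
    refine MvPolynomial.ringHom_ext (fun c => ?_) fun i => ?_
    · change κ (etaP a (MvPolynomial.C c)) = f (dropP a (MvPolynomial.C c))
      have e1 : etaP a (MvPolynomial.C c) = Polynomial.C (MvPolynomial.C c) := by
        rw [etaP, MvPolynomial.aeval_C]
        rfl
      have e2 : dropP a (MvPolynomial.C c) = MvPolynomial.C c := by
        rw [dropP, MvPolynomial.aeval_C]
        rfl
      rw [e1, e2, hκC, ← MvPolynomial.algebraMap_eq, ← MvPolynomial.algebraMap_eq, AlgHom.commutes,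
        AlgHom.commutes]
    · change κ (etaP a (MvPolynomial.X i)) = f (dropP a (MvPolynomial.X i))
      rw [dropP_X, etaP, MvPolynomial.aeval_X, map_mul, hκC, hκX, phiP, map_add, map_sum, map_add,
        map_sum, add_mul, Finset.sum_mul, map_mul f]
      have hC : ∀ c, ev (MvPolynomial.C c) = f (MvPolynomial.C c) := fun c => by
        rw [← MvPolynomial.algebraMap_eq, ← MvPolynomial.algebraMap_eq, AlgHom.commutes,
          AlgHom.commutes]
      rw [hC]
      congr 1
      refine Finset.sum_congr rfl fun k _ => ?_
      rw [map_mul, map_mul, hC, mul_assoc]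
      congr 1
      rw [show ev (MvPolynomial.X k) = f (epsP a (k + 3)) / f (epsP a 2) from
        MvPolynomial.aeval_X _ _, div_mul_cancel₀ _ h2]
  exact ⟨κ, fun q => congrArg (fun f : _ →+* Fr => f q) hκ⟩

/-- Substituting `e_k = ε_{k+2} / ε₂` and `s = ε₂` after `etaP` gives back `dropP a q`, which equals
`q` modulo the ideal. -/
theorem mem_idealW_of_etaP (a : Fin (g + 3) ↪ ℂ) {q : MvPolynomial (Fin (g + 3)) ℂ}
    (h : etaP a q = 0) : q ∈ idealW a := by
  have hinj := IsFractionRing.injective (MvPolynomial (Fin (g + 3)) ℂ)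
    (FractionRing (MvPolynomial (Fin (g + 3)) ℂ))
  obtain ⟨κ, hκ⟩ := exists_comp_etaP (Algebra.algHom ℂ (MvPolynomial (Fin (g + 3)) ℂ)
    (FractionRing (MvPolynomial (Fin (g + 3)) ℂ))) a
    ((map_ne_zero_iff _ hinj).mpr (epsP_two_ne_zero a))
  have h0 := hκ q
  rw [h, map_zero] at h0
  have hb : dropP a q = 0 := hinj (h0.symm.trans (map_zero _).symm)
  have hβ := mk_dropP a q
  rw [hb, map_zero] at hβ
  exact Ideal.Quotient.eq_zero_iff_mem.mp hβ.symm

/-- `fᵢ ↦ s φᵢ`. -/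
def etaK (a : Fin (g + 3) ↪ ℂ) : MvPolynomial (Fin (g + 3)) ℂ →ₐ[ℂ] Polynomial (KX g) :=
  MvPolynomial.aeval fun i => Polynomial.C (phiE a i) * Polynomial.X

theorem etaK_eq (a : Fin (g + 3) ↪ ℂ) (q : MvPolynomial (Fin (g + 3)) ℂ) :
    etaK a q = (etaP a q).map (algebraMap _ (KX g)) := by
  have : (etaK a).toRingHom = (Polynomial.mapRingHom (algebraMap _ (KX g))).comp
      (etaP a).toRingHom := by
    refine MvPolynomial.ringHom_ext (fun c => ?_) fun i => ?_
    · simp only [RingHom.comp_apply, AlgHom.toRingHom_eq_coe, AlgHom.coe_toRingHom,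
        ← MvPolynomial.algebraMap_eq, AlgHom.commutes,
        IsScalarTower.algebraMap_apply ℂ (MvPolynomial (Fin g) ℂ)
          (Polynomial (MvPolynomial (Fin g) ℂ)),
        IsScalarTower.algebraMap_apply ℂ (KX g) (Polynomial (KX g)),
        Polynomial.algebraMap_eq, Polynomial.coe_mapRingHom, Polynomial.map_C]
      rw [IsScalarTower.algebraMap_apply ℂ (MvPolynomial (Fin g) ℂ) (KX g)]
    · simp [etaK, etaP, algebraMap_phiP]
  exact congrArg (fun f : _ →+* Polynomial (KX g) => f q) this

theorem mem_idealW_of_etaK (a : Fin (g + 3) ↪ ℂ) {q : MvPolynomial (Fin (g + 3)) ℂ}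
    (h : etaK a q = 0) : q ∈ idealW a := by
  rw [etaK_eq] at h
  exact mem_idealW_of_etaP a (Polynomial.map_injective _ (IsFractionRing.injective _ (KX g))
    (h.trans (Polynomial.map_zero _).symm))

/-- The field `ℂ(e₁, …, e_g)(s)`. -/
abbrev KS (g : ℕ) : Type := FractionRing (Polynomial (KX g))

/-- The restriction of functions to the subspace `ℓ₀ = ℓ₁ = 0`. -/
def eta (a : Fin (g + 3) ↪ ℂ) : OU a →ₐ[ℂ] KS g :=
  IsLocalization.liftAlgHom (M := (idealW a).primeCompl)
    (f := (Algebra.algHom ℂ (Polynomial (KX g)) (KS g)).comp (etaK a)) fun q => by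
      refine IsUnit.mk0 _ ?_
      change algebraMap (Polynomial (KX g)) (KS g) (etaK a q) ≠ 0
      rw [map_ne_zero_iff _ (IsFractionRing.injective _ (KS g))]
      exact fun h => q.2 (mem_idealW_of_etaK a h)

theorem eta_algebraMap (a : Fin (g + 3) ↪ ℂ) (q : MvPolynomial (Fin (g + 3)) ℂ) :
    eta a (algebraMap _ (OU a) q) = algebraMap (Polynomial (KX g)) (KS g) (etaK a q) := by
  rw [eta, IsLocalization.liftAlgHom_apply, IsLocalization.lift_eq]
  rfl

theorem locGen_fv (a : Fin (g + 3) ↪ ℂ) : LocGen (fv a) :=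
  locGen_of_isLocalization (idealW a).primeCompl

/-- The linear forms `ε_m`, in `𝒪`. -/
def eps (a : Fin (g + 3) ↪ ℂ) (m : ℕ) : OU a := ∑ i, esymA a m i • fv a i

theorem algebraMap_epsP (a : Fin (g + 3) ↪ ℂ) (m : ℕ) :
    algebraMap _ (OU a) (epsP a m) = eps a m := by
  rw [epsP, eps, map_sum]
  refine Finset.sum_congr rfl fun i _ => ?_
  rw [map_mul, ← MvPolynomial.algebraMap_eq, ← IsScalarTower.algebraMap_apply, Algebra.smul_def, fv]

theorem eps_zero (a : Fin (g + 3) ↪ ℂ) : eps a 0 = ∑ i, fv a i := by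
  simp [eps, esymA_zero]

theorem eps_one (a : Fin (g + 3) ↪ ℂ) :
    eps a 1 = esymOn Finset.univ a 1 • ∑ i, fv a i - ∑ i, a i • fv a i := by
  rw [eps, Finset.smul_sum, ← Finset.sum_sub_distrib]
  exact Finset.sum_congr rfl fun i _ => by rw [esymA_one]; exact sub_smul (R := ℂ) (M := OU a) _ _ _

theorem eps_two (a : Fin (g + 3) ↪ ℂ) :
    eps a 2 = esymOn Finset.univ a 2 • (∑ i, fv a i)
      - esymOn Finset.univ a 1 • (∑ i, a i • fv a i) + sv a := by
  simp only [eps, esymA_two, sub_smul, add_smul, Finset.sum_sub_distrib, Finset.sum_add_distrib, sv,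
    Finset.smul_sum, smul_smul, mul_comm]

/-! ### Restriction to the subspace -/

theorem algebraMap_KS (c : ℂ) : algebraMap ℂ (KS g) c =
    algebraMap (Polynomial (KX g)) (KS g) (Polynomial.C (algebraMap ℂ (KX g) c)) := by
  rw [IsScalarTower.algebraMap_apply ℂ (Polynomial (KX g)) (KS g),
    IsScalarTower.algebraMap_apply ℂ (KX g) (Polynomial (KX g))]
  rfl

/-- The inclusion of `ℂ(e₁, …, e_g)` in `ℂ(e₁, …, e_g)(s)`. -/
def constS (g : ℕ) : KX g →ₐ[ℂ] KS g :=
  { (algebraMap (Polynomial (KX g)) (KS g)).comp Polynomial.C with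
    commutes' := fun c => (algebraMap_KS c).symm }

theorem constS_apply (r : KX g) :
    constS g r = algebraMap (Polynomial (KX g)) (KS g) (Polynomial.C r) := rfl

theorem constS_injective : Function.Injective (constS g) := (constS g).toRingHom.injective

/-- The variable `s`. -/
def sS (g : ℕ) : KS g := algebraMap (Polynomial (KX g)) (KS g) Polynomial.X

theorem sS_ne_zero : sS g ≠ 0 :=
  (map_ne_zero_iff _ (IsFractionRing.injective _ (KS g))).mpr Polynomial.X_ne_zero

theorem eta_fv (a : Fin (g + 3) ↪ ℂ) (i : Fin (g + 3)) :
    eta a (fv a i) = constS g (phiE a i) * sS g := by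
  rw [fv, eta_algebraMap, etaK, MvPolynomial.aeval_X, map_mul]
  rfl

theorem eta_eps (a : Fin (g + 3) ↪ ℂ) (m : ℕ) :
    eta a (eps a m) = constS g (∑ i, algebraMap ℂ (KX g) (esymA a m i) * phiE a i) * sS g := by
  simp only [eps, map_sum, eta_fv, map_mul, Finset.sum_mul, Algebra.smul_def,
    AlgHom.commutes, mul_assoc]

theorem eta_eps_zero (a : Fin (g + 3) ↪ ℂ) : eta a (eps a 0) = 0 := by
  rw [eta_eps]
  simp [esymA_zero, sum_esymA_zero_phiE]

theorem eta_eps_one (a : Fin (g + 3) ↪ ℂ) : eta a (eps a 1) = 0 := by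
  rw [eta_eps, sum_esymA_one_phiE, map_zero, zero_mul]

theorem eta_eps_two (a : Fin (g + 3) ↪ ℂ) : eta a (eps a 2) = sS g := by
  rw [eta_eps, sum_esymA_two_phiE, map_one, one_mul]

theorem eta_eps_succ (a : Fin (g + 3) ↪ ℂ) (k : Fin g) :
    eta a (eps a (k + 3)) = constS g (xv k) * sS g := by
  rw [eta_eps, sum_esymA_succ_phiE]

/-- The nonunits form the maximal ideal of `𝒪`, generated by `ε₀` and `ε₁` since these span the same
space as `ℓ₀` and `ℓ₁`. -/
theorem exists_of_not_isUnit {a : Fin (g + 3) ↪ ℂ} {r : OU a} (h : ¬ IsUnit r) :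
    ∃ u v, r = u * eps a 0 + v * eps a 1 := by
  obtain ⟨q, m, rfl⟩ := IsLocalization.exists_mk'_eq (idealW a).primeCompl r
  have hq : q ∈ idealW a := by
    by_contra hq
    exact h ((IsLocalization.AtPrime.isUnit_mk'_iff (OU a) (idealW a) q m).mpr hq)
  obtain ⟨c, d, hcd⟩ := Ideal.mem_span_pair.mp hq
  have h0 : ell0 g = epsP a 0 := (epsP_zero a).symm
  have h1 : ell1 a = MvPolynomial.C (esymOn Finset.univ a 1) * epsP a 0 - epsP a 1 := by
    rw [epsP_one, epsP_zero]
    ring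
  have hq' : q = (c + d * MvPolynomial.C (esymOn Finset.univ a 1)) * epsP a 0 - d * epsP a 1 := by
    rw [← hcd, h1, h0]
    ring
  refine ⟨IsLocalization.mk' (OU a) (c + d * MvPolynomial.C (esymOn Finset.univ a 1)) m,
    - IsLocalization.mk' (OU a) d m, ?_⟩
  rw [IsLocalization.mk'_eq_iff_eq_mul, hq', map_sub, map_mul, map_mul, algebraMap_epsP,
    algebraMap_epsP, ← IsLocalization.mk'_spec (OU a) (c + _) m, ← IsLocalization.mk'_spec (OU a) d m]
  ring

theorem exists_of_eta_eq_zero {a : Fin (g + 3) ↪ ℂ} {r : OU a} (h : eta a r = 0) :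
    ∃ u v, r = u * eps a 0 + v * eps a 1 :=
  exists_of_not_isUnit fun hu => (hu.map (eta a)).ne_zero h

theorem isUnit_of_eta_ne_zero {a : Fin (g + 3) ↪ ℂ} {r : OU a} (h : eta a r ≠ 0) : IsUnit r := by
  by_contra hu
  obtain ⟨u, v, rfl⟩ := exists_of_not_isUnit hu
  exact h (by simp [eta_eps_zero, eta_eps_one])

/-- Thanks to this, identities in the residue field can be tested in the explicit field `ℂ(e₁, …,
e_g)(s)`. -/
theorem residue_eq_iff_eta {a : Fin (g + 3) ↪ ℂ} (r s : OU a) :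
    IsLocalRing.residue (OU a) r = IsLocalRing.residue (OU a) s ↔ eta a r = eta a s := by
  rw [← sub_eq_zero, ← map_sub, IsLocalRing.residue_eq_zero_iff, IsLocalRing.mem_maximalIdeal,
    mem_nonunits_iff, ← sub_eq_zero (a := eta a r), ← map_sub]
  refine ⟨fun h => ?_, fun h hu => (hu.map (eta a)).ne_zero h⟩
  by_contra h'
  exact h (isUnit_of_eta_ne_zero h')

theorem isUnit_eps_two (a : Fin (g + 3) ↪ ℂ) : IsUnit (eps a 2) :=
  isUnit_of_eta_ne_zero (by rw [eta_eps_two]; exact sS_ne_zero)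

/-- `ε₂⁻¹`. -/
def eps2Inv (a : Fin (g + 3) ↪ ℂ) : OU a := ((isUnit_eps_two a).unit⁻¹ : (OU a)ˣ)

theorem eps2Inv_mul (a : Fin (g + 3) ↪ ℂ) : eps2Inv a * eps a 2 = 1 :=
  (isUnit_eps_two a).val_inv_mul

theorem eta_eps2Inv (a : Fin (g + 3) ↪ ℂ) : eta a (eps2Inv a) = (sS g)⁻¹ := by
  have := congrArg (eta a) (eps2Inv_mul a)
  rw [map_mul, eta_eps_two, map_one] at this
  exact eq_inv_of_mul_eq_one_left this

/-- `e_{k+1} ↦ ε_{k+3} / ε₂`, on polynomials. -/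
def rhoP (a : Fin (g + 3) ↪ ℂ) : MvPolynomial (Fin g) ℂ →ₐ[ℂ] OU a :=
  MvPolynomial.aeval fun k : Fin g => eps a (k + 3) * eps2Inv a

theorem eta_rhoP (a : Fin (g + 3) ↪ ℂ) (p : MvPolynomial (Fin g) ℂ) :
    eta a (rhoP a p) = constS g (algebraMap _ (KX g) p) := by
  have : (eta a).comp (rhoP a) =
      (constS g).comp (Algebra.algHom ℂ (MvPolynomial (Fin g) ℂ) (KX g)) := by
    refine MvPolynomial.algHom_ext fun k => ?_
    rw [AlgHom.comp_apply, rhoP, MvPolynomial.aeval_X, map_mul, eta_eps_succ, eta_eps2Inv, mul_assoc,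
      mul_inv_cancel₀ sS_ne_zero, mul_one]
    rfl
  exact congrArg (fun f : _ →ₐ[ℂ] _ => f p) this

/-- The embedding `e_{k+1} ↦ ε_{k+3} / ε₂` of `ℂ(e₁, …, e_g)` in `𝒪`. -/
def rho (a : Fin (g + 3) ↪ ℂ) : KX g →ₐ[ℂ] OU a :=
  IsLocalization.liftAlgHom (M := nonZeroDivisors (MvPolynomial (Fin g) ℂ)) (f := rhoP a) fun p => by
    refine isUnit_of_eta_ne_zero ?_
    rw [eta_rhoP, map_ne_zero_iff _ constS_injective,
      map_ne_zero_iff _ (IsFractionRing.injective _ (KX g))]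
    exact nonZeroDivisors.coe_ne_zero p

theorem rho_xv (a : Fin (g + 3) ↪ ℂ) (k : Fin g) : rho a (xv k) = eps a (k + 3) * eps2Inv a := by
  rw [rho, xv, IsLocalization.liftAlgHom_apply, IsLocalization.lift_eq]
  exact MvPolynomial.aeval_X _ _

theorem eta_rho (a : Fin (g + 3) ↪ ℂ) (r : KX g) : eta a (rho a r) = constS g r := by
  have : (eta a).comp (rho a) = constS g := locGen_xv.algHom_ext fun k => by
    rw [AlgHom.comp_apply, rho_xv, map_mul, eta_eps_succ, eta_eps2Inv, mul_assoc,
      mul_inv_cancel₀ sS_ne_zero, mul_one]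
  exact congrArg (fun f : _ →ₐ[ℂ] _ => f r) this

/-! ### Derivations of `𝒪` -/

/-- The derivation `∂/∂fᵢ`. -/
def dU (a : Fin (g + 3) ↪ ℂ) (i : Fin (g + 3)) : Derivation ℂ (OU a) (OU a) :=
  locDer (idealW a).primeCompl (MvPolynomial.mkDerivation ℂ (Pi.single i (1 : OU a)))

theorem dU_fv (a : Fin (g + 3) ↪ ℂ) (i j : Fin (g + 3)) :
    dU a i (fv a j) = if i = j then 1 else 0 := by
  rw [dU, fv, locDer_algebraMap, MvPolynomial.mkDerivation_X, Pi.single_apply]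
  simp [eq_comm]

theorem dU_comm (a : Fin (g + 3) ↪ ℂ) (i j : Fin (g + 3)) (r : OU a) :
    dU a i (dU a j r) = dU a j (dU a i r) := by
  have : ∀ r, (⁅dU a i, dU a j⁆ : Derivation ℂ (OU a) (OU a)) r =
      (0 : Derivation ℂ (OU a) (OU a)) r :=
    (locGen_fv a).derivation_ext fun l => by
      rw [Derivation.commutator_apply, dU_fv, dU_fv]
      split_ifs <;> simp
  have h := this r
  rwa [Derivation.commutator_apply, Derivation.zero_apply, sub_eq_zero] at h

/-- The Euler derivation of `𝒪`. -/
def dEul (a : Fin (g + 3) ↪ ℂ) : Derivation ℂ (OU a) (OU a) := ∑ i, fv a i • dU a i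

theorem dEul_apply (a : Fin (g + 3) ↪ ℂ) (r : OU a) : dEul a r = ∑ i, fv a i * dU a i r := by
  simp [dEul, derivation_sum_apply]

theorem dEul_fv (a : Fin (g + 3) ↪ ℂ) (i : Fin (g + 3)) : dEul a (fv a i) = fv a i := by
  simp [dEul_apply, dU_fv]

theorem dEul_eps (a : Fin (g + 3) ↪ ℂ) (m : ℕ) : dEul a (eps a m) = eps a m := by
  simp [eps, dEul_fv]

/-- Each `fᵢ` restricts to `φᵢ s`, of degree one in `s`; the Euler derivation therefore restricts to
`s d/ds`. -/
theorem eta_dEul_algebraMap (a : Fin (g + 3) ↪ ℂ) (q : MvPolynomial (Fin (g + 3)) ℂ) :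
    eta a (dEul a (algebraMap _ (OU a) q)) = algebraMap (Polynomial (KX g)) (KS g)
      (Polynomial.X * Polynomial.derivative (etaK a q)) := by
  induction q using MvPolynomial.induction_on with
  | C c =>
    have h1 : etaK a (MvPolynomial.C c) = Polynomial.C (algebraMap ℂ (KX g) c) := by
      rw [etaK, MvPolynomial.aeval_C]
      rfl
    rw [h1, ← MvPolynomial.algebraMap_eq, ← IsScalarTower.algebraMap_apply,
      Derivation.map_algebraMap]
    simp
  | add p q hp hq => rw [map_add, map_add, map_add, hp, hq, map_add, Polynomial.derivative_add,
      mul_add, map_add]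
  | mul_X p i hp =>
    rw [map_mul (algebraMap _ (OU a)), Derivation.leibniz, map_add, smul_eq_mul, smul_eq_mul,
      map_mul, map_mul, hp, eta_algebraMap, eta_algebraMap]
    have h1 : dEul a (algebraMap _ (OU a) (MvPolynomial.X i)) =
      algebraMap _ (OU a) (MvPolynomial.X i) := dEul_fv a i
    rw [h1, eta_algebraMap, ← map_mul (algebraMap _ (KS g)), ← map_mul (algebraMap _ (KS g)),
      ← map_add, map_mul (etaK a)]
    congr 1
    have h2 : etaK a (MvPolynomial.X i) = Polynomial.C (phiE a i) * Polynomial.X :=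
      MvPolynomial.aeval_X _ _
    rw [h2]
    simp only [Polynomial.derivative_mul, Polynomial.derivative_C, Polynomial.derivative_X]
    ring

/-- A function on the subspace whose Euler derivative is constant is homogeneous of degree zero. -/
theorem exists_rho_of_dEul (a : Fin (g + 3) ↪ ℂ) {c : OU a} {t : KX g}
    (h : eta a (dEul a c) = constS g t) : t = 0 ∧ ∃ r, eta a c = eta a (rho a r) := by
  obtain ⟨q, m, rfl⟩ := IsLocalization.exists_mk'_eq (idealW a).primeCompl c
  set c := IsLocalization.mk' (OU a) q m with hc
  have hinj := IsFractionRing.injective (Polynomial (KX g)) (KS g)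
  have hcm : c * algebraMap _ (OU a) (m : MvPolynomial (Fin (g + 3)) ℂ) = algebraMap _ (OU a) q :=
    IsLocalization.mk'_spec _ _ _
  have hm0 : etaK a m ≠ 0 := fun h => m.2 (mem_idealW_of_etaK a h)
  have h1 := congrArg (eta a) hcm
  rw [map_mul, eta_algebraMap, eta_algebraMap] at h1
  have h2 := congrArg (fun r => eta a (dEul a r)) hcm
  simp only [Derivation.leibniz, smul_eq_mul, map_add, map_mul, h, eta_dEul_algebraMap] at h2
  rw [eta_algebraMap] at h2
  -- The equation `s d/ds (q / m) = t` with denominators cleared.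
  have h3 : algebraMap (Polynomial (KX g)) (KS g) (Polynomial.X * Polynomial.derivative (etaK a q)
      * etaK a m - etaK a q * (Polynomial.X * Polynomial.derivative (etaK a m))) =
      algebraMap (Polynomial (KX g)) (KS g) (Polynomial.C t * etaK a m ^ 2) := by
    simp only [map_sub, map_mul, map_pow, ← constS_apply, ← h1]
    linear_combination -(algebraMap (Polynomial (KX g)) (KS g) (etaK a m)) * h2
  obtain ⟨ht, r, hr⟩ := eq_C_mul_of_euler hm0 (hinj h3)
  refine ⟨ht, r, ?_⟩
  rw [eta_rho]
  rw [hr, map_mul, ← constS_apply] at h1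
  exact mul_right_cancel₀ ((map_ne_zero_iff _ hinj).mpr hm0) h1

/-! ### Differential operators on `ℂ^{g+3}` -/

/-- The generator `fᵢ*`. -/
abbrev yU (a : Fin (g + 3) ↪ ℂ) (i : Fin (g + 3)) : DU a := Weyl.y (fv a) (fun _ => 1) i

theorem yU_mul_ofU (a : Fin (g + 3) ↪ ℂ) (i : Fin (g + 3)) (r : OU a) :
    yU a i * ofU a r = ofU a r * yU a i + ofU a (dU a i r) :=
  (locGen_fv a).commutator (ofU a) (dU a i) (yU a i) (fun j => by rw [Weyl.y_mul_of, dU_fv]) r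

/-- The derivation `∂/∂ε_m` of `𝒪`. -/
def dTh (a : Fin (g + 3) ↪ ℂ) (m : Fin (g + 3)) : Derivation ℂ (OU a) (OU a) :=
  ∑ i, cN a i m • dU a i

theorem dTh_apply (a : Fin (g + 3) ↪ ℂ) (m : Fin (g + 3)) (r : OU a) :
    dTh a m r = ∑ i, cN a i m • dU a i r := by
  simp [dTh, derivation_sum_apply]

theorem dTh_fv (a : Fin (g + 3) ↪ ℂ) (m i : Fin (g + 3)) :
    dTh a m (fv a i) = algebraMap ℂ (OU a) (cN a i m) := by
  simp [dTh_apply, dU_fv, Algebra.smul_def]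

theorem dTh_eps (a : Fin (g + 3) ↪ ℂ) (m m' : Fin (g + 3)) :
    dTh a m (eps a m') = if m' = m then 1 else 0 := by
  rw [eps, map_sum]
  simp_rw [Derivation.map_smul, dTh_fv, Algebra.smul_def, ← map_mul]
  rw [← map_sum, sum_esymA_mul_cN]
  split_ifs <;> simp

/-- The operator `∂/∂ε_m`. -/
def theta (a : Fin (g + 3) ↪ ℂ) (m : Fin (g + 3)) : DU a := ∑ i, cN a i m • yU a i

theorem theta_mul_ofU (a : Fin (g + 3) ↪ ℂ) (m : Fin (g + 3)) (r : OU a) :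
    theta a m * ofU a r = ofU a r * theta a m + ofU a (dTh a m r) := by
  rw [theta, Finset.sum_mul, Finset.mul_sum, dTh_apply, map_sum, ← Finset.sum_add_distrib]
  refine Finset.sum_congr rfl fun i _ => ?_
  rw [smul_mul_assoc, yU_mul_ofU, smul_add, mul_smul_comm, map_smul]

theorem theta_comm (a : Fin (g + 3) ↪ ℂ) (m m' : Fin (g + 3)) :
    theta a m * theta a m' = theta a m' * theta a m := by
  simp_rw [theta, Finset.sum_mul, Finset.mul_sum, smul_mul_assoc, mul_smul_comm]
  rw [Finset.sum_comm]
  refine Finset.sum_congr rfl fun i _ => Finset.sum_congr rfl fun j _ => ?_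
  rw [smul_comm, Weyl.y_comm]

theorem theta_mul_eps_of_ne (a : Fin (g + 3) ↪ ℂ) {m m' : Fin (g + 3)} (h : m' ≠ m) :
    theta a m * ofU a (eps a m') = ofU a (eps a m') * theta a m := by
  rw [theta_mul_ofU, dTh_eps, if_neg h, map_zero, add_zero]

theorem theta_mul_eps_self (a : Fin (g + 3) ↪ ℂ) (m : Fin (g + 3)) :
    theta a m * ofU a (eps a m) = ofU a (eps a m) * theta a m + 1 := by
  rw [theta_mul_ofU, dTh_eps, if_pos rfl, map_one]

theorem yU_eq_sum_theta (a : Fin (g + 3) ↪ ℂ) (i : Fin (g + 3)) :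
    yU a i = ∑ m : Fin (g + 3), esymA a m i • theta a m := by
  simp_rw [theta, Finset.smul_sum, smul_smul]
  rw [Finset.sum_comm]
  simp_rw [← Finset.sum_smul, mul_comm (esymA a _ i), sum_cN_mul_esymA]
  simp

/-- The Euler operator. -/
def EU (a : Fin (g + 3) ↪ ℂ) : DU a := ∑ i, ofU a (fv a i) * yU a i

theorem EU_eq (a : Fin (g + 3) ↪ ℂ) :
    EU a = ∑ m : Fin (g + 3), ofU a (eps a m) * theta a m := by
  simp_rw [EU, yU_eq_sum_theta, Finset.mul_sum, eps, map_sum, Finset.sum_mul]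
  rw [Finset.sum_comm]
  refine Finset.sum_congr rfl fun i _ => Finset.sum_congr rfl fun m _ => ?_
  rw [map_smul, smul_mul_assoc, mul_smul_comm]

theorem EU_mul_ofU (a : Fin (g + 3) ↪ ℂ) (r : OU a) :
    EU a * ofU a r = ofU a r * EU a + ofU a (dEul a r) := by
  rw [EU, Finset.sum_mul, Finset.mul_sum, dEul_apply, map_sum, ← Finset.sum_add_distrib]
  refine Finset.sum_congr rfl fun i _ => ?_
  rw [mul_assoc, yU_mul_ofU, mul_add, ← mul_assoc, ← mul_assoc, ← map_mul, ← map_mul, ← map_mul,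
    mul_comm r]

/-- The operators `∂/∂ε_m` have degree `-1`. -/
theorem EU_mul_theta (a : Fin (g + 3) ↪ ℂ) (m : Fin (g + 3)) :
    EU a * theta a m = theta a m * EU a - theta a m := by
  rw [EU_eq, Finset.sum_mul, Finset.mul_sum, eq_sub_iff_add_eq]
  have h : ∀ m' : Fin (g + 3), theta a m * (ofU a (eps a m') * theta a m') =
      ofU a (eps a m') * theta a m' * theta a m + if m' = m then theta a m else 0 := by
    intro m'
    rw [← mul_assoc, theta_mul_ofU, dTh_eps, add_mul, mul_assoc, theta_comm, ← mul_assoc]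
    split_ifs with h
    · rw [map_one, one_mul, h]
    · rw [map_zero, zero_mul]
  simp_rw [h, Finset.sum_add_distrib]
  simp

/-- Up to a scalar, the first generator of `Î` is the Euler operator plus one. -/
theorem sum_hv (a : Fin (g + 3) ↪ ℂ) : ∑ i, hv a i - 2 = (-2 : ℂ) • (EU a + 1) := by
  simp only [hv, ← Finset.smul_sum]
  rw [smul_add, sub_eq_add_neg, EU]
  congr 1
  rw [neg_smul, ofNat_smul_eq_nsmul ℂ 2 (1 : DU a)]
  norm_num

/-! ### The left ideal and its normalizer -/

theorem EU_add_one_mem (a : Fin (g + 3) ↪ ℂ) : EU a + 1 ∈ IHat a := by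
  have h : ∑ i, hv a i - 2 ∈ IHat a := Ideal.subset_span (by simp)
  rw [sum_hv] at h
  have h2 := Ideal.mul_mem_left (IHat a) (algebraMap ℂ (DU a) (-2)⁻¹) h
  rw [← Algebra.smul_def, smul_smul] at h2
  simpa using h2

theorem ofU_eps_zero_mem (a : Fin (g + 3) ↪ ℂ) : ofU a (eps a 0) ∈ IHat a := by
  rw [eps_zero]
  exact Ideal.subset_span (by simp)

theorem smul_mem_IHat {a : Fin (g + 3) ↪ ℂ} (c : ℂ) {u : DU a} (h : u ∈ IHat a) :
    c • u ∈ IHat a := by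
  rw [Algebra.smul_def]
  exact Ideal.mul_mem_left _ _ h

theorem ofU_eps_one_mem (a : Fin (g + 3) ↪ ℂ) : ofU a (eps a 1) ∈ IHat a := by
  rw [eps_one, map_sub, map_smul]
  exact Ideal.sub_mem _ (smul_mem_IHat _ (Ideal.subset_span (by simp)))
    (Ideal.subset_span (by simp))

theorem IHat_eq (a : Fin (g + 3) ↪ ℂ) :
    IHat a = Ideal.span {EU a + 1, ofU a (eps a 0), ofU a (eps a 1)} := by
  apply le_antisymm
  · have hE : EU a + 1 ∈ Ideal.span {EU a + 1, ofU a (eps a 0), ofU a (eps a 1)} :=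
      Ideal.subset_span (by simp)
    have h0 : ofU a (eps a 0) ∈ Ideal.span {EU a + 1, ofU a (eps a 0), ofU a (eps a 1)} :=
      Ideal.subset_span (by simp)
    have h1 : ofU a (eps a 1) ∈ Ideal.span {EU a + 1, ofU a (eps a 0), ofU a (eps a 1)} :=
      Ideal.subset_span (by simp)
    rw [IHat, Ideal.span_le]
    rintro _ (rfl | rfl | rfl)
    · rw [sum_hv, Algebra.smul_def]
      exact Ideal.mul_mem_left _ _ hE
    · rw [← eps_zero]
      exact h0
    · have : ∑ i, a i • fv a i = esymOn Finset.univ a 1 • eps a 0 - eps a 1 := by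
        rw [eps_one, eps_zero, sub_sub_cancel]
      rw [this, map_sub, map_smul, Algebra.smul_def]
      exact Ideal.sub_mem _ (Ideal.mul_mem_left _ _ h0) h1
  · rw [Ideal.span_le]
    rintro _ (rfl | rfl | rfl)
    · exact EU_add_one_mem a
    · exact ofU_eps_zero_mem a
    · exact ofU_eps_one_mem a

theorem ofU_mem_IHat {a : Fin (g + 3) ↪ ℂ} {r : OU a} (h : eta a r = 0) : ofU a r ∈ IHat a := by
  obtain ⟨u, v, rfl⟩ := exists_of_eta_eq_zero h
  rw [map_add, map_mul, map_mul]
  exact Ideal.add_mem _ (Ideal.mul_mem_left _ _ (ofU_eps_zero_mem a))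
    (Ideal.mul_mem_left _ _ (ofU_eps_one_mem a))

theorem mem_NHat {a : Fin (g + 3) ↪ ℂ} {u : DU a} (hE : (EU a + 1) * u ∈ IHat a)
    (h0 : ofU a (eps a 0) * u ∈ IHat a) (h1 : ofU a (eps a 1) * u ∈ IHat a) : u ∈ NHat a := by
  intro v hv
  rw [IHat_eq] at hv
  induction hv using Submodule.span_induction with
  | mem x hx =>
    rcases hx with rfl | rfl | rfl
    · exact hE
    · exact h0
    · exact h1
  | zero => rw [zero_mul]; exact Ideal.zero_mem _
  | add x y _ _ hx hy => rw [add_mul]; exact Ideal.add_mem _ hx hy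
  | smul b x _ hx => rw [smul_eq_mul, mul_assoc]; exact Ideal.mul_mem_left _ _ hx

theorem mem_NHat_of_commute {a : Fin (g + 3) ↪ ℂ} {u : DU a} (hE : EU a * u = u * EU a)
    (h0 : ofU a (eps a 0) * u = u * ofU a (eps a 0))
    (h1 : ofU a (eps a 1) * u = u * ofU a (eps a 1)) : u ∈ NHat a := by
  refine mem_NHat ?_ ?_ ?_
  · rw [add_mul, one_mul, hE, show u * EU a + u = u * (EU a + 1) by rw [mul_add, mul_one]]
    exact Ideal.mul_mem_left _ _ (EU_add_one_mem a)
  · rw [h0]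
    exact Ideal.mul_mem_left _ _ (ofU_eps_zero_mem a)
  · rw [h1]
    exact Ideal.mul_mem_left _ _ (ofU_eps_one_mem a)

theorem IHat_le_NHat {a : Fin (g + 3) ↪ ℂ} {u : DU a} (h : u ∈ IHat a) : u ∈ NHat a :=
  fun v _ => Ideal.mul_mem_left _ v h

/-- The right action of `A` on `𝒪`. -/
def actU (a : Fin (g + 3) ↪ ℂ) : DU a →ₐ[ℂ] (Module.End ℂ (OU a))ᵐᵒᵖ :=
  Weyl.lift
    (AlgHom.ofLinearMap ((MulOpposite.opLinearEquiv ℂ).toLinearMap ∘ₗ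
        (Algebra.lmul ℂ (OU a)).toLinearMap) (by
          change MulOpposite.op (Algebra.lmul ℂ (OU a) 1) = 1
          rw [map_one, MulOpposite.op_one])
        (fun r s => by
          change MulOpposite.op (Algebra.lmul ℂ (OU a) (r * s)) =
            MulOpposite.op (Algebra.lmul ℂ (OU a) r) * MulOpposite.op (Algebra.lmul ℂ (OU a) s)
          rw [← MulOpposite.op_mul, mul_comm r s, map_mul]))
    (fun i => MulOpposite.op (-(dU a i : Module.End ℂ (OU a))))
    (fun i j => by
      rw [← MulOpposite.op_mul, ← MulOpposite.op_mul]
      congr 1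
      ext r
      simp [dU_comm a i j])
    (fun i j => by
      simp only [AlgHom.ofLinearMap_apply, LinearMap.comp_apply, LinearEquiv.coe_coe,
        AlgHom.toLinearMap_apply, MulOpposite.coe_opLinearEquiv]
      rw [← MulOpposite.op_mul, ← MulOpposite.op_mul, ← MulOpposite.op_add]
      congr 1
      ext r
      simp [dU_fv]
      split_ifs <;> simp <;> ring)

/-- `φ · u`, for `φ ∈ 𝒪` and `u ∈ A`. -/
def rightU (a : Fin (g + 3) ↪ ℂ) (φ : OU a) (u : DU a) : OU a := (actU a u).unop φ

theorem rightU_mul (a : Fin (g + 3) ↪ ℂ) (φ : OU a) (u v : DU a) :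
    rightU a φ (u * v) = rightU a (rightU a φ u) v := by
  simp [rightU]

theorem rightU_add (a : Fin (g + 3) ↪ ℂ) (φ : OU a) (u v : DU a) :
    rightU a φ (u + v) = rightU a φ u + rightU a φ v := by
  simp [rightU]

theorem rightU_one (a : Fin (g + 3) ↪ ℂ) (φ : OU a) : rightU a φ 1 = φ := by
  simp [rightU]

theorem rightU_ofU (a : Fin (g + 3) ↪ ℂ) (φ r : OU a) : rightU a φ (ofU a r) = r * φ := by
  simp [rightU, actU, Weyl.lift_of]

theorem rightU_yU (a : Fin (g + 3) ↪ ℂ) (φ : OU a) (i : Fin (g + 3)) :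
    rightU a φ (yU a i) = - dU a i φ := by
  simp [rightU, actU, Weyl.lift_y]

theorem rightU_EU (a : Fin (g + 3) ↪ ℂ) (φ : OU a) :
    rightU a φ (EU a) = - (dEul a φ + ((g + 3 : ℕ) : ℂ) • φ) := by
  have h : rightU a φ (EU a) = ∑ i, rightU a φ (ofU a (fv a i) * yU a i) := by
    simp [rightU, EU, LinearMap.sum_apply]
  rw [h]
  simp_rw [rightU_mul, rightU_ofU, rightU_yU, Derivation.leibniz, dU_fv]
  simp only [smul_eq_mul, mul_one, if_true, neg_add_rev, Finset.sum_add_distrib,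
    Finset.sum_neg_distrib, dEul_apply, Algebra.smul_def, map_natCast]
  simp

/-- In the right action on `𝒪`, the element `φ · (EU + 1)` is `-(Eul + g + 2) φ`, and `φ · ε₀`, `φ ·
ε₁` vanish on the subspace. If `1` were in `Î`, every function would thus agree on the subspace with
some `(Eul + g + 2) χ`. A suitable choice then produces a function with Euler derivative `1`, that
is, a logarithm, and there is none. -/
theorem one_notMem_IHat (a : Fin (g + 3) ↪ ℂ) : (1 : DU a) ∉ IHat a := by
  intro h1
  have key : ∀ u ∈ IHat a, ∀ φ, ∃ χ : OU a,
      eta a (rightU a φ u) = eta a (dEul a χ + ((g + 2 : ℕ) : ℂ) • χ) := by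
    intro u hu
    rw [IHat_eq] at hu
    induction hu using Submodule.span_induction with
    | mem x hx =>
      intro φ
      rcases hx with rfl | rfl | rfl
      · refine ⟨-φ, ?_⟩
        rw [rightU_add, rightU_EU, rightU_one, map_neg (dEul a)]
        congr 1
        rw [show ((g + 3 : ℕ) : ℂ) = ((g + 2 : ℕ) : ℂ) + 1 by push_cast; ring]
        simp only [Algebra.smul_def, map_add, map_one]
        ring
      · exact ⟨0, by simp [rightU_ofU, eta_eps_zero]⟩
      · exact ⟨0, by simp [rightU_ofU, eta_eps_one]⟩
    | zero => intro φ; exact ⟨0, by simp [rightU]⟩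
    | add x y _ _ hx hy =>
      intro φ
      obtain ⟨χ, hχ⟩ := hx φ
      obtain ⟨χ', hχ'⟩ := hy φ
      refine ⟨χ + χ', ?_⟩
      rw [rightU_add, map_add, hχ, hχ', ← map_add]
      congr 1
      simp only [map_add, smul_add]
      abel
    | smul b x _ hx =>
      intro φ
      rw [smul_eq_mul, rightU_mul]
      exact hx _
  -- Multiplication by `ε₂^(g+2)` conjugates `Eul + g + 2` to `Eul`, so for `φ = ε₂^{-(g+2)}` the
  -- function `ε₂^(g+2) χ` has Euler derivative `1` on the subspace.
  obtain ⟨χ, hχ⟩ := key 1 h1 (eps2Inv a ^ (g + 2))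
  rw [rightU_one] at hχ
  have h2 : eta a (dEul a (eps a 2 ^ (g + 2) * χ)) = constS g 1 := by
    have e : dEul a (eps a 2 ^ (g + 2) * χ) =
        eps a 2 ^ (g + 2) * (dEul a χ + ((g + 2 : ℕ) : ℂ) • χ) := by
      rw [Derivation.leibniz, Derivation.leibniz_pow, dEul_eps]
      simp only [smul_eq_mul, nsmul_eq_mul, Algebra.smul_def, map_natCast]
      rw [show g + 2 - 1 = g + 1 by omega, pow_succ (eps a 2) (g + 1)]
      ring
    rw [e, map_mul, ← hχ, ← map_mul, ← mul_pow, mul_comm (eps a 2), eps2Inv_mul, one_pow, map_one,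
      map_one]
  exact one_ne_zero (exists_rho_of_dEul a h2).1

/-- A function not vanishing on the subspace is a unit of `𝒪`, and a proper left ideal contains no
unit. -/
theorem eta_eq_zero_of_mem_IHat {a : Fin (g + 3) ↪ ℂ} {r : OU a} (h : ofU a r ∈ IHat a) :
    eta a r = 0 := by
  by_contra h0
  obtain ⟨u, hu⟩ := isUnit_of_eta_ne_zero h0
  apply one_notMem_IHat a
  have := Ideal.mul_mem_left (IHat a) (ofU a (u⁻¹ : (OU a)ˣ)) h
  rwa [← hu, ← map_mul, Units.inv_mul, map_one] at this

/-! ### The algebra `A_U` as an algebra of differential operators -/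

theorem theta_mul_eps_zero (a : Fin (g + 3) ↪ ℂ) {m : Fin (g + 3)} (h : (0 : Fin (g + 3)) ≠ m) :
    theta a m * ofU a (eps a 0) = ofU a (eps a 0) * theta a m := by
  have h' := theta_mul_eps_of_ne a h
  rwa [Fin.val_zero] at h'

theorem theta_mul_eps_one (a : Fin (g + 3) ↪ ℂ) {m : Fin (g + 3)} (h : (1 : Fin (g + 3)) ≠ m) :
    theta a m * ofU a (eps a 1) = ofU a (eps a 1) * theta a m := by
  have h' := theta_mul_eps_of_ne a h
  rwa [Fin.val_one] at h'

theorem theta_mul_eps_two (a : Fin (g + 3) ↪ ℂ) {m : Fin (g + 3)} (h : (2 : Fin (g + 3)) ≠ m) :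
    theta a m * ofU a (eps a 2) = ofU a (eps a 2) * theta a m := by
  have h' := theta_mul_eps_of_ne a h
  rwa [Fin.val_two] at h'

theorem fin_zero_ne_succ (k : Fin g) : (0 : Fin (g + 3)) ≠ k.succ.succ.succ :=
  (Fin.succ_ne_zero _).symm

theorem fin_one_ne_succ (k : Fin g) : (1 : Fin (g + 3)) ≠ k.succ.succ.succ := fun h => by
  have := congrArg Fin.val h
  simp at this

theorem fin_zero_ne_two : (0 : Fin (g + 3)) ≠ 2 := by simp [Fin.ext_iff, two_mod_add_three]

theorem fin_one_ne_two : (1 : Fin (g + 3)) ≠ 2 := by simp [Fin.ext_iff, two_mod_add_three]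

theorem ofU_comm (a : Fin (g + 3) ↪ ℂ) (r s : OU a) : ofU a r * ofU a s = ofU a s * ofU a r := by
  rw [← map_mul, mul_comm, map_mul]

/-- `∂/∂e_{k+1} = ε₂ ∂/∂ε_{k+3}`. -/
def DkU (a : Fin (g + 3) ↪ ℂ) (k : Fin g) : DU a := ofU a (eps a 2) * theta a k.succ.succ.succ

theorem DkU_mul_ofU (a : Fin (g + 3) ↪ ℂ) (k : Fin g) (r : OU a) :
    DkU a k * ofU a r = ofU a r * DkU a k + ofU a (eps a 2 * dTh a k.succ.succ.succ r) := by
  rw [DkU, mul_assoc, theta_mul_ofU, mul_add, ← mul_assoc, ofU_comm, mul_assoc, map_mul]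

theorem DkU_comm (a : Fin (g + 3) ↪ ℂ) (j k : Fin g) : DkU a j * DkU a k = DkU a k * DkU a j := by
  have key : ∀ j k : Fin g, DkU a j * DkU a k = ofU a (eps a 2) * ofU a (eps a 2) *
      (theta a j.succ.succ.succ * theta a k.succ.succ.succ) := by
    intro j k
    rw [DkU, DkU, mul_assoc, ← mul_assoc (theta _ _), theta_mul_eps_two a (fin_two_ne_succ j)]
    simp only [mul_assoc]
  rw [key, key, theta_comm]

theorem dTh_eps2Inv (a : Fin (g + 3) ↪ ℂ) {m : Fin (g + 3)} (h : (2 : Fin (g + 3)) ≠ m) :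
    dTh a m (eps2Inv a) = 0 := by
  have h1 := congrArg (dTh a m) (eps2Inv_mul a)
  have h2 : dTh a m (eps a 2) = 0 := (dTh_eps a m 2).trans (if_neg h)
  rw [Derivation.leibniz, h2, Derivation.map_one_eq_zero, smul_zero, zero_add, smul_eq_mul] at h1
  exact (isUnit_eps_two a).mul_right_eq_zero.mp h1

theorem dTh_rho_xv (a : Fin (g + 3) ↪ ℂ) (j k : Fin g) :
    eps a 2 * dTh a k.succ.succ.succ (rho a (xv j)) = if k = j then 1 else 0 := by
  have h : dTh a k.succ.succ.succ (eps a (j + 3)) = if k = j then 1 else 0 := by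
    refine (dTh_eps a k.succ.succ.succ j.succ.succ.succ).trans ?_
    simp [eq_comm]
  rw [rho_xv, Derivation.leibniz, dTh_eps2Inv a (fin_two_ne_succ k), h, smul_zero, zero_add,
    smul_eq_mul]
  split_ifs
  · rw [mul_one, mul_comm, eps2Inv_mul]
  · rw [mul_zero, mul_zero]

/-- The embedding of `ℂ(e₁, …, e_g)[∂/∂e₁, …, ∂/∂e_g]` in `A`. -/
def tauU (a : Fin (g + 3) ↪ ℂ) : W0 g →ₐ[ℂ] DU a :=
  Weyl.lift ((ofU a).comp (rho a)) (DkU a) (DkU_comm a) (fun i j => by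
    simp only [AlgHom.comp_apply]
    rw [DkU_mul_ofU, dTh_rho_xv]
    split_ifs <;> simp)

theorem tauU_ofW (a : Fin (g + 3) ↪ ℂ) (r : KX g) : tauU a (ofW r) = ofU a (rho a r) :=
  Weyl.lift_of _ _ _ _ r

theorem tauU_yW (a : Fin (g + 3) ↪ ℂ) (k : Fin g) : tauU a (yW k) = DkU a k :=
  Weyl.lift_y _ _ _ _ k

theorem dEul_eps2Inv (a : Fin (g + 3) ↪ ℂ) : dEul a (eps2Inv a) = - eps2Inv a := by
  have h1 := congrArg (dEul a) (eps2Inv_mul a)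
  rw [Derivation.leibniz, dEul_eps, Derivation.map_one_eq_zero, smul_eq_mul, smul_eq_mul] at h1
  have h2 := eps2Inv_mul a
  linear_combination eps2Inv a * h1 - (eps2Inv a + dEul a (eps2Inv a)) * h2

theorem EU_mul_rho (a : Fin (g + 3) ↪ ℂ) (r : KX g) :
    EU a * ofU a (rho a r) = ofU a (rho a r) * EU a := by
  have := locGen_xv.commutator ((ofU a).comp (rho a)) 0 (EU a) (fun k => by
    simp only [AlgHom.comp_apply]
    rw [EU_mul_ofU, rho_xv, Derivation.leibniz, dEul_eps2Inv, dEul_eps]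
    congr 2
    simp only [Derivation.zero_apply, smul_eq_mul, map_zero]
    ring) r
  simpa using this

theorem EU_mul_DkU (a : Fin (g + 3) ↪ ℂ) (k : Fin g) : EU a * DkU a k = DkU a k * EU a := by
  rw [DkU, ← mul_assoc, EU_mul_ofU, dEul_eps, add_mul, mul_assoc, EU_mul_theta, mul_sub, mul_assoc]
  abel

theorem EU_mul_tauU (a : Fin (g + 3) ↪ ℂ) (w : W0 g) : EU a * tauU a w = tauU a w * EU a := by
  have h : (Subalgebra.centralizer ℂ {EU a}).comap (tauU a) = ⊤ := by
    refine Weyl.eq_top_of_generators _ (fun r => ?_) fun k => ?_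
    · rw [Subalgebra.mem_comap, Subalgebra.mem_centralizer_iff]
      rintro _ rfl
      rw [tauU_ofW, EU_mul_rho]
    · rw [Subalgebra.mem_comap, Subalgebra.mem_centralizer_iff]
      rintro _ rfl
      rw [tauU_yW, EU_mul_DkU]
  have h1 : w ∈ (Subalgebra.centralizer ℂ {EU a}).comap (tauU a) := h ▸ Algebra.mem_top
  rw [Subalgebra.mem_comap, Subalgebra.mem_centralizer_iff] at h1
  exact h1 _ rfl

/-- The image has degree zero and involves only derivatives in the `ε_m` with `m ≥ 3`, so it
commutes with the three generators of `Î`. -/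
theorem tauU_mem (a : Fin (g + 3) ↪ ℂ) (w : W0 g) : tauU a w ∈ NHat a := by
  have h : (NHat a).comap (tauU a) = ⊤ := by
    refine Weyl.eq_top_of_generators _ (fun r => ?_) fun k => ?_
    · change tauU a (ofW r) ∈ NHat a
      refine mem_NHat_of_commute (EU_mul_tauU a _) ?_ ?_ <;> rw [tauU_ofW, ofU_comm]
    · change tauU a (yW k) ∈ NHat a
      refine mem_NHat_of_commute (EU_mul_tauU a _) ?_ ?_
      · rw [tauU_yW, DkU, ← mul_assoc, ofU_comm, mul_assoc,
          ← theta_mul_eps_zero a (fin_zero_ne_succ k), mul_assoc]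
      · rw [tauU_yW, DkU, ← mul_assoc, ofU_comm, mul_assoc,
          ← theta_mul_eps_one a (fin_one_ne_succ k), mul_assoc]
  exact (h ▸ Algebra.mem_top : w ∈ (NHat a).comap (tauU a))

theorem cls_eq_cls_iff {a : Fin (g + 3) ↪ ℂ} {u v : DU a} (hu : u ∈ NHat a) (hv : v ∈ NHat a) :
    cls a u hu = cls a v hv ↔ u - v ∈ IHat a := by
  rw [cls, cls, Ideal.Quotient.mk_eq_mk_iff_sub_mem]
  rfl

instance (a : Fin (g + 3) ↪ ℂ) : Nontrivial (AU a) :=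
  Ideal.Quotient.nontrivial_iff.mpr fun h => one_notMem_IHat a
    (show ((1 : NHat a) : DU a) ∈ IHat a from
      (h ▸ Submodule.mem_top : (1 : NHat a) ∈ INHat a))

/-- The homomorphism from `ℂ(e₁, …, e_g)[∂/∂e₁, …, ∂/∂e_g]` to `A_U`. -/
def psiU (a : Fin (g + 3) ↪ ℂ) : W0 g →ₐ[ℂ] AU a :=
  (Ideal.Quotient.mkₐ ℂ (INHat a)).comp ((tauU a).codRestrict (NHat a) (tauU_mem a))

theorem psiU_apply (a : Fin (g + 3) ↪ ℂ) (w : W0 g) :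
    psiU a w = cls a (tauU a w) (tauU_mem a w) := rfl

/-- `W0` is simple, and `A_U` is nonzero by `one_notMem_IHat`. -/
theorem psiU_injective (a : Fin (g + 3) ↪ ℂ) : Function.Injective (psiU a) :=
  W0_injective (psiU a)

/-! ### Surjectivity onto `A_U`: normal forms in `A / Î`. -/

section Surjective

variable (a : Fin (g + 3) ↪ ℂ)

/-- The left module `A / Î`. -/
abbrev VU : Type := DU a ⧸ IHat a

/-- The class of an operator in `A / Î`. -/
abbrev mkV (u : DU a) : VU a := Submodule.Quotient.mk u

/-- Left multiplication on `A / Î`. -/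
def lQ : DU a →ₐ[ℂ] Module.End ℂ (VU a) := Algebra.lsmul ℂ ℂ (VU a)

theorem lQ_mkV (u v : DU a) : lQ a u (mkV a v) = mkV a (u * v) := rfl

/-- Right multiplication by an element of the normalizer on `A / Î`. -/
def rQ (n : NHat a) : VU a →ₗ[DU a] VU a :=
  Submodule.mapQ (IHat a) (IHat a) (LinearMap.toSpanSingleton (DU a) (DU a) n) fun u hu => n.2 u hu

/-- Right multiplication by an element of the normalizer on `A / Î`. -/
def rQC (n : NHat a) : Module.End ℂ (VU a) := (rQ a n).restrictScalars ℂ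

theorem rQC_mkV (n : NHat a) (v : DU a) : rQC a n (mkV a v) = mkV a (v * n) := rfl

theorem mkV_surjective (v : VU a) : ∃ u, mkV a u = v := Submodule.Quotient.mk_surjective _ v

theorem rQC_lQ (n : NHat a) (u : DU a) (v : VU a) : rQC a n (lQ a u v) = lQ a u (rQC a n v) := by
  obtain ⟨w, rfl⟩ := mkV_surjective a v
  rw [lQ_mkV, rQC_mkV, rQC_mkV, lQ_mkV, mul_assoc]

/-- The operators `∂/∂e_{k+1}` acting on the right on `A / Î`. -/
def opD (k : Fin g) : Module.End ℂ (VU a) := rQC a ⟨_, tauU_mem a (yW k)⟩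

/-- The commutators with `e_{k+1}`, on `A / Î`. -/
def opAd (k : Fin g) : Module.End ℂ (VU a) :=
  rQC a ⟨_, tauU_mem a (ofW (xv k))⟩ - lQ a (tauU a (ofW (xv k)))

theorem opD_mkV (k : Fin g) (u : DU a) : opD a k (mkV a u) = mkV a (u * DkU a k) := by
  change mkV a (u * tauU a (yW k)) = _
  rw [tauU_yW]

theorem opAd_mkV (k : Fin g) (u : DU a) :
    opAd a k (mkV a u) = mkV a (u * ofU a (rho a (xv k)) - ofU a (rho a (xv k)) * u) := by
  change mkV a (u * tauU a (ofW (xv k))) - mkV a (tauU a (ofW (xv k)) * u) = _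
  rw [tauU_ofW]
  rfl

/-- The operator `opAd` is the commutator with `e_{k+1}`. It descends to `A / Î` because `e_{k+1}`
lies in the normalizer, and so does right multiplication by `DkU`. -/
theorem ccr_opD : CCR (opAd a) (opD a) := by
  intro j k
  refine LinearMap.ext fun v => ?_
  obtain ⟨u, rfl⟩ := mkV_surjective a v
  have h : DkU a k * ofU a (rho a (xv j)) = ofU a (rho a (xv j)) * DkU a k
      + if j = k then 1 else 0 := by
    rw [DkU_mul_ofU, dTh_rho_xv]
    split_ifs <;> simp_all
  simp only [Module.End.mul_apply, LinearMap.add_apply, opD_mkV, opAd_mkV]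
  rw [mul_assoc, h]
  by_cases hjk : j = k
  · simp only [hjk, if_true, Module.End.one_apply]
    rw [← Submodule.Quotient.mk_add]
    congr 1
    noncomm_ring
  · simp only [hjk, if_false, LinearMap.zero_apply, add_zero]
    congr 1
    noncomm_ring

/-- The classes of the functions in `A / Î`. -/
def spanO : Submodule ℂ (VU a) :=
  LinearMap.range (((IHat a).mkQ.restrictScalars ℂ) ∘ₗ (ofU a).toLinearMap)

theorem mkV_ofU_mem (r : OU a) : mkV a (ofU a r) ∈ spanO a := ⟨r, rfl⟩

/-- The span of the `r D^m`, in `A / Î`. -/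
def spanD : Submodule ℂ (VU a) := opSpan (opD a) (spanO a) (List.finRange g)

theorem lQ_ofU_mem_spanD (r : OU a) {v : VU a} (hv : v ∈ spanD a) :
    lQ a (ofU a r) v ∈ spanD a := by
  refine apply_mem_opSpan (fun k v => (rQC_lQ a _ _ v).symm) ?_ _ hv
  rintro _ ⟨s, rfl⟩
  exact ⟨r * s, by
    change mkV a (ofU a (r * s)) = lQ a _ (mkV a (ofU a s))
    rw [lQ_mkV, map_mul]⟩

theorem opD_comm (j k : Fin g) (v : VU a) : opD a j (opD a k v) = opD a k (opD a j v) := by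
  obtain ⟨u, rfl⟩ := mkV_surjective a v
  simp only [opD_mkV, mul_assoc, DkU_comm a j k]

/-- Left multiplication is right multiplication plus a commutator, and the commutator differentiates
the coefficients. -/
theorem lQ_DkU_mem_spanD (k : Fin g) {v : VU a} (hv : v ∈ spanD a) :
    lQ a (DkU a k) v ∈ spanD a := by
  have h1 : (lQ a (DkU a k) - opD a k) v ∈ spanD a := by
    refine apply_mem_opSpan (fun j v => ?_) ?_ _ hv
    · rw [LinearMap.sub_apply, LinearMap.sub_apply, map_sub, opD_comm]
      congr 1
      exact (rQC_lQ a _ _ v).symm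
    · rintro _ ⟨s, rfl⟩
      refine ⟨eps a 2 * dTh a k.succ.succ.succ s, ?_⟩
      change mkV a _ = lQ a (DkU a k) (mkV a (ofU a s)) - opD a k (mkV a (ofU a s))
      rw [lQ_mkV, opD_mkV, DkU_mul_ofU, ← Submodule.Quotient.mk_sub, add_sub_cancel_left]
      rfl
  have h2 : opD a k v ∈ spanD a := op_mem_opSpan (opD_comm a) (List.mem_finRange k) hv
  simpa using Submodule.add_mem _ h1 h2

theorem mkV_eq_zero {u : DU a} : mkV a u = 0 ↔ u ∈ IHat a := Submodule.Quotient.mk_eq_zero _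

theorem lQ_EU_ofU (c : OU a) : lQ a (EU a + 1) (mkV a (ofU a c)) = mkV a (ofU a (dEul a c)) := by
  rw [lQ_mkV, ← sub_eq_zero, ← Submodule.Quotient.mk_sub, mkV_eq_zero]
  have : (EU a + 1) * ofU a c - ofU a (dEul a c) = ofU a c * (EU a + 1) := by
    rw [add_mul, EU_mul_ofU]
    noncomm_ring
  rw [this]
  exact Ideal.mul_mem_left _ _ (EU_add_one_mem a)

theorem lQ_EU_mem_spanD {v : VU a} (hv : v ∈ spanD a) : lQ a (EU a + 1) v ∈ spanD a := by
  refine apply_mem_opSpan (fun k v => (rQC_lQ a _ _ v).symm) ?_ _ hv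
  rintro _ ⟨s, rfl⟩
  exact ⟨dEul a s, (lQ_EU_ofU a s).symm⟩

/-- The indices `0, 1`. -/
def ix (j : Fin 2) : Fin (g + 3) := j.castLE (by omega)

theorem ix_injective : Function.Injective (ix (g := g)) := Fin.castLE_injective (by omega)

/-- The operators `∂/∂ε₀`, `∂/∂ε₁` acting on the left on `A / Î`. -/
def opTh (j : Fin 2) : Module.End ℂ (VU a) := lQ a (theta a (ix j))

/-- The operators `-ε₀`, `-ε₁` acting on the left on `A / Î`. -/
def opEps (j : Fin 2) : Module.End ℂ (VU a) := lQ a (-ofU a (eps a (ix j : Fin (g + 3))))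

theorem opTh_mkV (j : Fin 2) (u : DU a) : opTh a j (mkV a u) = mkV a (theta a (ix j) * u) := rfl

theorem opEps_mkV (j : Fin 2) (u : DU a) :
    opEps a j (mkV a u) = mkV a (-ofU a (eps a (ix j : Fin (g + 3))) * u) := rfl

/-- The sign in `opEps` is needed because here `θ` is the raising operator and `ε` the lowering one:
`[-ε, θ] = 1`. -/
theorem ccr_opTh : CCR (opEps a) (opTh a) := by
  intro j k
  refine LinearMap.ext fun v => ?_
  obtain ⟨u, rfl⟩ := mkV_surjective a v
  simp only [Module.End.mul_apply, LinearMap.add_apply, opTh_mkV, opEps_mkV]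
  by_cases hjk : j = k
  · subst hjk
    have h := theta_mul_eps_self a (ix j)
    simp only [if_true, Module.End.one_apply]
    rw [← Submodule.Quotient.mk_add]
    congr 1
    rw [neg_mul, neg_mul, mul_neg, ← mul_assoc, ← mul_assoc, h]
    noncomm_ring
  · have h := theta_mul_eps_of_ne a (m := ix k) (m' := ix j) fun h => hjk (ix_injective h)
    simp only [hjk, if_false, LinearMap.zero_apply, add_zero]
    congr 1
    rw [neg_mul, neg_mul, mul_neg, ← mul_assoc, ← mul_assoc, h]

/-- The span of the `θ₀^p θ₁^q r D^m`, in `A / Î`. -/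
def spanTh : Submodule ℂ (VU a) := opSpan (opTh a) (spanD a) (List.finRange 2)

theorem opTh_comm (j k : Fin 2) (v : VU a) : opTh a j (opTh a k v) = opTh a k (opTh a j v) := by
  rw [opTh, opTh, ← Module.End.mul_apply, ← map_mul, theta_comm, map_mul, Module.End.mul_apply]

theorem opTh_mem_spanTh (j : Fin 2) {v : VU a} (hv : v ∈ spanTh a) : opTh a j v ∈ spanTh a :=
  op_mem_opSpan (opTh_comm a) (List.mem_finRange j) hv

theorem lQ_ofU_mem_spanTh (r : OU a) {v : VU a} (hv : v ∈ spanTh a) :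
    lQ a (ofU a r) v ∈ spanTh a := by
  -- All `r` are treated at once, because moving `r` past `θ` produces its derivative.
  let T : Submodule ℂ (VU a) :=
    { carrier := {v | v ∈ spanTh a ∧ ∀ r, lQ a (ofU a r) v ∈ spanTh a}
      add_mem' := fun {v w} hv hw => ⟨Submodule.add_mem _ hv.1 hw.1, fun r => by
        rw [map_add]; exact Submodule.add_mem _ (hv.2 r) (hw.2 r)⟩
      zero_mem' := ⟨Submodule.zero_mem _, fun r => by rw [map_zero]; exact Submodule.zero_mem _⟩
      smul_mem' := fun c v hv => ⟨Submodule.smul_mem _ _ hv.1, fun r => by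
        rw [map_smul]; exact Submodule.smul_mem _ _ (hv.2 r)⟩ }
  have h : spanTh a ≤ T := by
    refine opSpan_le (T := T) (fun v hv => And.intro (le_opSpan _ _ _ hv) fun r =>
      le_opSpan _ _ _ (lQ_ofU_mem_spanD a r hv)) (fun j v hv => And.intro
        (opTh_mem_spanTh a j hv.1) fun r => ?_) _
    have e : lQ a (ofU a r) (opTh a j v) =
        opTh a j (lQ a (ofU a r) v) - lQ a (ofU a (dTh a (ix j) r)) v := by
      rw [opTh, ← Module.End.mul_apply, ← Module.End.mul_apply, ← map_mul, ← map_mul,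
        theta_mul_ofU, map_add, LinearMap.add_apply, add_sub_cancel_right]
    rw [e]
    exact Submodule.sub_mem _ (opTh_mem_spanTh a j (hv.2 r)) (hv.2 _)
  exact (h hv).2 r

theorem lQ_DkU_mem_spanTh (k : Fin g) {v : VU a} (hv : v ∈ spanTh a) :
    lQ a (DkU a k) v ∈ spanTh a := by
  refine apply_mem_opSpan (fun j v => ?_) (fun s hs => lQ_DkU_mem_spanD a k hs) _ hv
  rw [opTh, ← Module.End.mul_apply, ← Module.End.mul_apply, ← map_mul, ← map_mul]
  congr 2
  have h2 : (2 : Fin (g + 3)) ≠ ix j := by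
    intro h
    have h' : 2 = (j : ℕ) := congrArg Fin.val h
    have := j.isLt
    omega
  rw [DkU, mul_assoc, theta_comm, ← mul_assoc, ← theta_mul_eps_two a h2, mul_assoc]

theorem lQ_EU_mem_spanTh {v : VU a} (hv : v ∈ spanTh a) : lQ a (EU a + 1) v ∈ spanTh a := by
  let T : Submodule ℂ (VU a) := spanTh a ⊓ (spanTh a).comap (lQ a (EU a + 1))
  have h : spanTh a ≤ T := by
    refine opSpan_le (T := T) (fun v hv => And.intro (le_opSpan _ _ _ hv)
      (show lQ a (EU a + 1) v ∈ spanTh a from le_opSpan _ _ _ (lQ_EU_mem_spanD a hv))) (fun j v hv => And.intro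
        (opTh_mem_spanTh a j hv.1) ?_) _
    have e : lQ a (EU a + 1) (opTh a j v) = opTh a j (lQ a (EU a + 1) v) - opTh a j v := by
      rw [opTh, ← Module.End.mul_apply, ← Module.End.mul_apply, ← map_mul, ← map_mul, add_mul,
        EU_mul_theta, ← LinearMap.sub_apply, ← map_sub]
      congr 2
      noncomm_ring
    change lQ a (EU a + 1) (opTh a j v) ∈ spanTh a
    rw [e]
    exact Submodule.sub_mem _ (opTh_mem_spanTh a j hv.2) (opTh_mem_spanTh a j hv.1)
  exact (h hv).2

/-- The span contains the class of `1` and is stable under left multiplication by generators of `A`.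
-/
theorem mem_spanTh (v : VU a) : v ∈ spanTh a := by
  let P : Subalgebra ℂ (DU a) :=
    { carrier := {b | ∀ v ∈ spanTh a, lQ a b v ∈ spanTh a}
      mul_mem' := fun {b c} hb hc v hv => by
        rw [map_mul, Module.End.mul_apply]; exact hb _ (hc v hv)
      add_mem' := fun {b c} hb hc v hv => by
        rw [map_add, LinearMap.add_apply]; exact Submodule.add_mem _ (hb v hv) (hc v hv)
      algebraMap_mem' := fun c v hv => by
        rw [AlgHom.commutes, Module.algebraMap_end_apply]; exact Submodule.smul_mem _ _ hv }
  have ho : ∀ r, ofU a r ∈ P := fun r v hv => lQ_ofU_mem_spanTh a r hv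
  have hE : EU a ∈ P := by
    have h1 : EU a + 1 ∈ P := fun v hv => lQ_EU_mem_spanTh a hv
    simpa using P.sub_mem h1 P.one_mem
  have h0 : theta a 0 ∈ P := fun v hv => opTh_mem_spanTh a 0 hv
  have h1 : theta a 1 ∈ P := fun v hv => opTh_mem_spanTh a 1 hv
  have hinv : ofU a (eps2Inv a) * ofU a (eps a 2) = 1 := by rw [← map_mul, eps2Inv_mul, map_one]
  have hk : ∀ k : Fin g, theta a k.succ.succ.succ ∈ P := by
    intro k
    have hD : DkU a k ∈ P := fun v hv => lQ_DkU_mem_spanTh a k hv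
    have := P.mul_mem (ho (eps2Inv a)) hD
    rwa [DkU, ← mul_assoc, hinv, one_mul] at this
  -- `θ₂` is the only derivative not yet treated; it is obtained from the Euler operator, since `ε₂`
  -- is invertible.
  have h2 : theta a 2 ∈ P := by
    have e : ofU a (eps a 2) * theta a 2 = EU a - ofU a (eps a 0) * theta a 0
        - ofU a (eps a 1) * theta a 1
        - ∑ k : Fin g, ofU a (eps a (k + 3)) * theta a k.succ.succ.succ := by
      rw [EU_eq, sum_fin_three]
      simp only [Fin.val_zero, Fin.val_one, Fin.val_two, Fin.val_succ]
      abel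
    have h3 : ofU a (eps a 2) * theta a 2 ∈ P := by
      rw [e]
      exact P.sub_mem (P.sub_mem (P.sub_mem hE (P.mul_mem (ho _) h0)) (P.mul_mem (ho _) h1))
        (P.sum_mem fun k _ => P.mul_mem (ho _) (hk k))
    have := P.mul_mem (ho (eps2Inv a)) h3
    rwa [← mul_assoc, hinv, one_mul] at this
  have hP : P = ⊤ := Weyl.eq_top_of_generators P ho fun i => by
    change yU a i ∈ P
    rw [yU_eq_sum_theta, sum_fin_three]
    exact P.add_mem (P.add_mem (P.add_mem (P.smul_mem h0 _) (P.smul_mem h1 _)) (P.smul_mem h2 _))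
      (P.sum_mem fun k _ => P.smul_mem (hk k) _)
  obtain ⟨u, rfl⟩ := mkV_surjective a v
  have hu : u ∈ P := hP ▸ Algebra.mem_top
  have h1 : mkV a 1 ∈ spanTh a :=
    le_opSpan _ _ _ (le_opSpan _ _ _ (by simpa using mkV_ofU_mem a 1))
  simpa [lQ_mkV] using hu _ h1

theorem opEps_spanD (j : Fin 2) : ∀ v ∈ spanD a, opEps a j v = 0 := by
  have h : spanD a ≤ LinearMap.ker (opEps a j) := by
    refine opSpan_le (D := opD a) (T := LinearMap.ker (opEps a j)) ?_ (fun k v hv => ?_) _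
    · rintro _ ⟨s, rfl⟩
      change lQ a _ (mkV a (ofU a s)) = 0
      rw [lQ_mkV, mkV_eq_zero, neg_mul, ofU_comm]
      refine Submodule.neg_mem _ (Ideal.mul_mem_left _ _ ?_)
      fin_cases j
      · exact ofU_eps_zero_mem a
      · exact ofU_eps_one_mem a
    · rw [LinearMap.mem_ker, opEps, opD, ← rQC_lQ]
      have hv' : opEps a j v = 0 := hv
      rw [opEps] at hv'
      rw [hv', map_zero]
  exact fun v hv => h hv

theorem psiU_surjective : Function.Surjective (psiU a) := by
  intro c
  obtain ⟨⟨u, hu⟩, rfl⟩ := Ideal.Quotient.mk_surjective c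
  -- As `u` is in the normalizer, `ε₀ u` and `ε₁ u` are in `Î`. The class of `u` is therefore killed
  -- by the lowering operators and contains no `θ₀`, `θ₁`.
  have h1 : mkV a u ∈ spanD a := by
    refine mem_of_killed (ccr_opTh a) (opEps_spanD a) (List.nodup_finRange 2)
      (mem_spanTh a (mkV a u)) fun j _ => ?_
    rw [opEps, lQ_mkV, mkV_eq_zero, neg_mul]
    refine Submodule.neg_mem _ (hu _ ?_)
    fin_cases j
    · exact ofU_eps_zero_mem a
    · exact ofU_eps_one_mem a
  have hcomm : ∀ k v, lQ a (EU a + 1) (opAd a k v) = opAd a k (lQ a (EU a + 1) v) := by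
    intro k v
    rw [opAd, LinearMap.sub_apply, LinearMap.sub_apply, map_sub, rQC_lQ]
    congr 1
    rw [← Module.End.mul_apply, ← Module.End.mul_apply, ← map_mul, ← map_mul, add_mul, mul_add,
      EU_mul_tauU, one_mul, mul_one]
  have hO : ∀ k, ∀ s ∈ spanO a, opAd a k s = 0 := by
    rintro k _ ⟨s, rfl⟩
    change opAd a k (mkV a (ofU a s)) = 0
    rw [opAd_mkV, ofU_comm, sub_self]
    rfl
  -- Left multiplication by `EU + 1` commutes with `opD` and `opAd`, so it kills each coefficient.
  -- On functions it is the Euler derivation, whence degree zero on the subspace.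
  have h2 := mem_opSpan_ker (ccr_opD a) (ccr_opD a) (lQ a (EU a + 1))
    (fun k v => (rQC_lQ a _ _ v).symm) hcomm hO (List.nodup_finRange g) h1 (by
      rw [lQ_mkV, mkV_eq_zero]
      exact hu _ (EU_add_one_mem a))
  have hle : spanO a ⊓ LinearMap.ker (lQ a (EU a + 1)) ≤
      LinearMap.range (((IHat a).mkQ.restrictScalars ℂ) ∘ₗ (tauU a).toLinearMap) := by
    rintro _ ⟨⟨s, rfl⟩, hs⟩
    have hs' : lQ a (EU a + 1) (mkV a (ofU a s)) = 0 := hs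
    rw [lQ_EU_ofU, mkV_eq_zero] at hs'
    obtain ⟨-, r, hr⟩ := exists_rho_of_dEul a (c := s) (t := 0)
      (by rw [eta_eq_zero_of_mem_IHat hs', map_zero])
    refine ⟨ofW r, ?_⟩
    change mkV a (tauU a (ofW r)) = mkV a (ofU a s)
    rw [tauU_ofW, ← sub_eq_zero, ← Submodule.Quotient.mk_sub, mkV_eq_zero, ← map_sub]
    exact ofU_mem_IHat (by rw [map_sub, hr, sub_self])
  obtain ⟨w, hw⟩ := opSpan_le hle (by
    rintro k _ ⟨w, rfl⟩
    refine ⟨w * yW k, ?_⟩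
    change mkV a (tauU a (w * yW k)) = opD a k (mkV a (tauU a w))
    rw [opD_mkV, map_mul, tauU_yW]) _ h2
  refine ⟨w, ?_⟩
  rw [psiU_apply]
  change cls a _ _ = cls a u hu
  rw [cls_eq_cls_iff]
  exact (Submodule.Quotient.eq (IHat a)).mp hw

end Surjective

/-- The isomorphism of `ℂ(e₁, …, e_g)[∂/∂e₁, …, ∂/∂e_g]` with `A_U`. -/
def equivU (a : Fin (g + 3) ↪ ℂ) : W0 g ≃ₐ[ℂ] AU a :=
  AlgEquiv.ofBijective (psiU a) ⟨psiU_injective a, psiU_surjective a⟩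

/-! ### The Hitchin Hamiltonians modulo the left ideal -/

theorem fv_mul_fInv (a : Fin (g + 3) ↪ ℂ) (i : Fin (g + 3)) : fv a i * fInv a i = 1 :=
  (isUnit_fv a i).mul_val_inv

theorem phiE_ne_zero (a : Fin (g + 3) ↪ ℂ) (i : Fin (g + 3)) : phiE a i ≠ 0 := by
  intro h
  have h1 := ((isUnit_fv a i).map (eta a)).ne_zero
  rw [eta_fv, h, map_zero, zero_mul] at h1
  exact h1 rfl

theorem eta_fInv (a : Fin (g + 3) ↪ ℂ) (i : Fin (g + 3)) :
    eta a (fInv a i) = (constS g (phiE a i) * sS g)⁻¹ := by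
  have := congrArg (eta a) (fv_mul_fInv a i)
  rw [map_mul, eta_fv, map_one] at this
  exact eq_inv_of_mul_eq_one_right this

/-- The first-order terms cancel when `hᵢ²` is written with the functions on the left; this is the
purpose of the term `-½ fᵢ⁻¹ hᵢ` of `eᵢ`. -/
theorem ev_eq (a : Fin (g + 3) ↪ ℂ) (C : Fin (g + 3) → ℂ) (i : Fin (g + 3)) :
    ev a C i = (C i / 2) • ofU a (fInv a i) - ofU a (fv a i) * (yU a i * yU a i) := by
  have h1 : yU a i * ofU a (fv a i) = ofU a (fv a i) * yU a i + 1 := by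
    rw [yU_mul_ofU, dU_fv, if_pos rfl, map_one]
  have h2 : ofU a (fInv a i) * ofU a (fv a i) = 1 := by
    rw [← map_mul, mul_comm, fv_mul_fInv, map_one]
  have h3 : ofU a (fInv a i) * hv a i = (-2 : ℂ) • yU a i := by
    rw [hv, mul_smul_comm, ← mul_assoc, h2, one_mul]
  have h4 : ofU a (fInv a i) * hv a i ^ 2 =
      (4 : ℂ) • (ofU a (fv a i) * (yU a i * yU a i) + yU a i) := by
    rw [pow_two, ← mul_assoc, h3, hv, smul_mul_assoc, mul_smul_comm, smul_smul, ← mul_assoc, h1,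
      add_mul, mul_assoc, one_mul]
    norm_num
  rw [ev, h3, h4]
  module

/-- The potential `½ (Cᵢ fⱼ/fᵢ + Cⱼ fᵢ/fⱼ)`. -/
def potU (a : Fin (g + 3) ↪ ℂ) (C : Fin (g + 3) → ℂ) (i j : Fin (g + 3)) : OU a :=
  (C i / 2) • (fInv a i * fv a j) + (C j / 2) • (fv a i * fInv a j)

/-- The three second-order terms combine into a perfect square, and only the difference `fᵢ* - fⱼ*`
occurs. -/
theorem hitch_pair (a : Fin (g + 3) ↪ ℂ) (C : Fin (g + 3) → ℂ) {i j : Fin (g + 3)} (h : i ≠ j) :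
    ev a C i * ofU a (fv a j) + ofU a (fv a i) * ev a C j + (1 / 2 : ℂ) • (hv a i * hv a j) =
      ofU a (potU a C i j) - ofU a (fv a i * fv a j) * ((yU a i - yU a j) * (yU a i - yU a j)) := by
  have h1 : yU a i * ofU a (fv a j) = ofU a (fv a j) * yU a i := by
    rw [yU_mul_ofU, dU_fv, if_neg h, map_zero, add_zero]
  have h2 : yU a i * yU a j = yU a j * yU a i := Weyl.y_comm _ _ i j
  have h3 : ofU a (fv a i) * (yU a i * yU a i) * ofU a (fv a j) =
      ofU a (fv a i) * ofU a (fv a j) * (yU a i * yU a i) := by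
    rw [mul_assoc, mul_assoc (yU a i), h1, ← mul_assoc (yU a i), h1, mul_assoc, mul_assoc]
  have h4 : hv a i * hv a j =
      (4 : ℂ) • (ofU a (fv a i) * ofU a (fv a j) * (yU a i * yU a j)) := by
    rw [hv, hv, smul_mul_assoc, mul_smul_comm, smul_smul, mul_assoc, ← mul_assoc (Weyl.y _ _ i)]
    change _ • (_ * (yU a i * ofU a (fv a j) * yU a j)) = _
    rw [h1]
    simp only [mul_assoc]
    norm_num
  rw [ev_eq, ev_eq, sub_mul, h3, h4, potU, mul_sub, sub_mul (yU a i), mul_sub (yU a i),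
    mul_sub (yU a j), ← h2]
  simp only [map_add, map_smul, map_mul, mul_sub, smul_mul_assoc, mul_smul_comm, mul_assoc]
  module

/-- `∑_{m ≥ 2} ε_m ∂/∂ε_m`. -/
def EW (a : Fin (g + 3) ↪ ℂ) : DU a :=
  ofU a (eps a 2) * theta a 2 + ∑ k : Fin g, ofU a (eps a (k + 3)) * theta a k.succ.succ.succ

theorem EU_eq_EW (a : Fin (g + 3) ↪ ℂ) :
    EU a = ofU a (eps a 0) * theta a 0 + ofU a (eps a 1) * theta a 1 + EW a := by
  rw [EU_eq, sum_fin_three, EW, ← add_assoc]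
  simp only [Fin.val_zero, Fin.val_one, Fin.val_two, Fin.val_succ]

theorem theta_zero_mul_eps (a : Fin (g + 3) ↪ ℂ) :
    theta a 0 * ofU a (eps a 0) = ofU a (eps a 0) * theta a 0 + 1 := by
  have h := theta_mul_eps_self a 0
  rwa [Fin.val_zero] at h

theorem theta_one_mul_eps (a : Fin (g + 3) ↪ ℂ) :
    theta a 1 * ofU a (eps a 1) = ofU a (eps a 1) * theta a 1 + 1 := by
  have h := theta_mul_eps_self a 1
  rwa [Fin.val_one] at h

theorem theta_two_mul_eps (a : Fin (g + 3) ↪ ℂ) :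
    theta a 2 * ofU a (eps a 2) = ofU a (eps a 2) * theta a 2 + 1 := by
  have h := theta_mul_eps_self a 2
  rwa [Fin.val_two] at h

/-- Moving `ε₀` and `ε₁` to the right in the Euler operator costs `-2`: hence `EU + 1 ∈ Î` becomes
`EW - 1 ∈ Î`. -/
theorem EW_sub_one_mem (a : Fin (g + 3) ↪ ℂ) : EW a - 1 ∈ IHat a := by
  have e : EW a - 1 = (EU a + 1) - theta a 0 * ofU a (eps a 0) - theta a 1 * ofU a (eps a 1) := by
    rw [EU_eq_EW, theta_zero_mul_eps, theta_one_mul_eps]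
    abel
  rw [e]
  exact Ideal.sub_mem _ (Ideal.sub_mem _ (EU_add_one_mem a)
    (Ideal.mul_mem_left _ _ (ofU_eps_zero_mem a))) (Ideal.mul_mem_left _ _ (ofU_eps_one_mem a))

/-- The part of `fᵢ*` tangent to the subspace `ε₀ = ε₁ = 0`. -/
def omU (a : Fin (g + 3) ↪ ℂ) (i : Fin (g + 3)) : DU a :=
  esymA a 2 i • theta a 2 + ∑ k : Fin g, esymA a (k + 3) i • theta a k.succ.succ.succ

/-- In a difference `fᵢ* - fⱼ*` the transverse part reduces to `-(aᵢ - aⱼ) θ₁`, since `θ₀` has the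
same coefficient for all indices. -/
theorem yU_eq_omU (a : Fin (g + 3) ↪ ℂ) (i : Fin (g + 3)) :
    yU a i = theta a 0 + (esymOn Finset.univ a 1 - a i) • theta a 1 + omU a i := by
  rw [yU_eq_sum_theta, sum_fin_three, omU]
  simp only [Fin.val_zero, Fin.val_one, Fin.val_two, Fin.val_succ, esymA_zero, esymA_one, one_smul]
  abel

theorem sum_fv_omU (a : Fin (g + 3) ↪ ℂ) : ∑ j, ofU a (fv a j) * omU a j = EW a := by
  simp only [omU, EW, mul_add, Finset.sum_add_distrib, Finset.mul_sum, mul_smul_comm]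
  rw [Finset.sum_comm]
  simp only [eps, map_sum, map_smul, Finset.sum_mul, smul_mul_assoc]

theorem theta_mul_theta_omU (a : Fin (g + 3) ↪ ℂ) (m i : Fin (g + 3)) :
    theta a m * omU a i = omU a i * theta a m := by
  simp only [omU, mul_add, add_mul, Finset.mul_sum, Finset.sum_mul, mul_smul_comm, smul_mul_assoc,
    theta_comm a m]

theorem omU_mul_eps_zero (a : Fin (g + 3) ↪ ℂ) (i : Fin (g + 3)) :
    omU a i * ofU a (eps a 0) = ofU a (eps a 0) * omU a i := by
  simp only [omU, mul_add, add_mul, Finset.mul_sum, Finset.sum_mul, mul_smul_comm, smul_mul_assoc,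
    theta_mul_eps_zero a fin_zero_ne_two, theta_mul_eps_zero a (fin_zero_ne_succ _)]

theorem omU_mul_eps_one (a : Fin (g + 3) ↪ ℂ) (i : Fin (g + 3)) :
    omU a i * ofU a (eps a 1) = ofU a (eps a 1) * omU a i := by
  simp only [omU, mul_add, add_mul, Finset.mul_sum, Finset.sum_mul, mul_smul_comm, smul_mul_assoc,
    theta_mul_eps_one a fin_one_ne_two, theta_mul_eps_one a (fin_one_ne_succ _)]

theorem omU_mul_eps_two (a : Fin (g + 3) ↪ ℂ) (i : Fin (g + 3)) :
    omU a i * ofU a (eps a 2) = ofU a (eps a 2) * omU a i + esymA a 2 i • 1 := by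
  simp only [omU, mul_add, add_mul, Finset.mul_sum, Finset.sum_mul, mul_smul_comm, smul_mul_assoc,
    theta_two_mul_eps, theta_mul_eps_two a (fin_two_ne_succ _), smul_add]
  abel

/-- The difference of the vector fields `ω`. -/
def omD (a : Fin (g + 3) ↪ ℂ) (i j : Fin (g + 3)) : DU a := omU a i - omU a j

/-- The difference of two coefficients `esymA`. -/
def mD (a : Fin (g + 3) ↪ ℂ) (m : ℕ) (i j : Fin (g + 3)) : ℂ := esymA a m i - esymA a m j

/-- The vector field of the plane of the indices `i`, `j` in the coordinates `e₁, …, e_g`. -/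
def vW (a : Fin (g + 3) ↪ ℂ) (i j : Fin (g + 3)) : W0 g :=
  ∑ k : Fin g, ofW (algebraMap ℂ (KX g) (mD a (k + 3) i j)
    - algebraMap ℂ (KX g) (mD a 2 i j) * xv k) * yW k

theorem eps_mul_theta (a : Fin (g + 3) ↪ ℂ) (k : Fin g) :
    ofU a (rho a (xv k)) * DkU a k = ofU a (eps a (k + 3)) * theta a k.succ.succ.succ := by
  rw [rho_xv, DkU, ← mul_assoc, ← map_mul, mul_assoc, eps2Inv_mul, mul_one]

theorem eps_mul_omU (a : Fin (g + 3) ↪ ℂ) (i : Fin (g + 3)) :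
    ofU a (eps a 2) * omU a i = esymA a 2 i • EW a
      + ∑ k : Fin g, (esymA a (k + 3) i • DkU a k
          - esymA a 2 i • (ofU a (rho a (xv k)) * DkU a k)) := by
  simp only [eps_mul_theta, Finset.sum_sub_distrib, ← Finset.smul_sum]
  rw [omU, EW, mul_add, Finset.mul_sum, mul_smul_comm]
  simp only [mul_smul_comm, DkU, smul_add]
  abel

/-- The tangent field `ε₂ ω`, of degree zero, splits into a radial part and a part in the
coordinates `e_k`. -/
theorem eps_mul_omD (a : Fin (g + 3) ↪ ℂ) (i j : Fin (g + 3)) :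
    ofU a (eps a 2) * omD a i j = mD a 2 i j • EW a + tauU a (vW a i j) := by
  rw [omD, mul_sub, eps_mul_omU, eps_mul_omU, vW, map_sum, mD, sub_smul, add_sub_add_comm,
    ← Finset.sum_sub_distrib]
  congr 1
  refine Finset.sum_congr rfl fun k _ => ?_
  rw [map_mul, tauU_ofW, tauU_yW, map_sub (rho a), map_mul (rho a), AlgHom.commutes,
    AlgHom.commutes, map_sub (ofU a), map_mul (ofU a), AlgHom.commutes, AlgHom.commutes,
    ← Algebra.smul_def, sub_mul, ← Algebra.smul_def, smul_mul_assoc]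
  simp only [mD]
  module

theorem omD_mul_eps_two (a : Fin (g + 3) ↪ ℂ) (i j : Fin (g + 3)) :
    omD a i j * ofU a (eps a 2) = ofU a (eps a 2) * omD a i j + mD a 2 i j • 1 := by
  rw [omD, sub_mul, omU_mul_eps_two, omU_mul_eps_two, mul_sub, mD, sub_smul]
  abel

theorem omD_mul_eps_zero (a : Fin (g + 3) ↪ ℂ) (i j : Fin (g + 3)) :
    omD a i j * ofU a (eps a 0) = ofU a (eps a 0) * omD a i j := by
  rw [omD, sub_mul, omU_mul_eps_zero, omU_mul_eps_zero, mul_sub]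

theorem omD_mul_eps_one (a : Fin (g + 3) ↪ ℂ) (i j : Fin (g + 3)) :
    omD a i j * ofU a (eps a 1) = ofU a (eps a 1) * omD a i j := by
  rw [omD, sub_mul, omU_mul_eps_one, omU_mul_eps_one, mul_sub]

/-- A function vanishing on the subspace is a combination of `ε₀` and `ε₁`, which can be moved to
the right of `u`. -/
theorem ofU_mul_mem_of_eta {a : Fin (g + 3) ↪ ℂ} {r : OU a} (h : eta a r = 0) {u : DU a}
    (h0 : u * ofU a (eps a 0) = ofU a (eps a 0) * u)
    (h1 : u * ofU a (eps a 1) = ofU a (eps a 1) * u) : ofU a r * u ∈ IHat a := by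
  obtain ⟨s, t, rfl⟩ := exists_of_eta_eq_zero h
  rw [map_add, map_mul, map_mul, add_mul, mul_assoc, mul_assoc, ← h0, ← h1, ← mul_assoc,
    ← mul_assoc]
  exact Ideal.add_mem _ (Ideal.mul_mem_left _ _ (ofU_eps_zero_mem a))
    (Ideal.mul_mem_left _ _ (ofU_eps_one_mem a))

/-- With `c = mD a 2 i j`, commuting `ε₂` past `ω` gives `ε₂² ω² = (ε₂ ω - c) (ε₂ ω)`, and `ε₂ ω` is
`V + c` up to `c (EW - 1) ∈ Î`. The result is `V (V + c)` modulo `Î`; the error term on the left of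
`V + c` is harmless because `V + c` is in the normalizer. -/
theorem eps_sq_omD_sq (a : Fin (g + 3) ↪ ℂ) (i j : Fin (g + 3)) :
    ofU a (eps a 2) * ofU a (eps a 2) * (omD a i j * omD a i j)
      - tauU a (vW a i j * vW a i j + mD a 2 i j • vW a i j) ∈ IHat a := by
  set c := mD a 2 i j
  set V := tauU a (vW a i j) with hV
  have hG : ofU a (eps a 2) * omD a i j = c • (EW a - 1) + (V + c • 1) := by
    rw [eps_mul_omD, smul_sub]
    abel
  have h1 : ofU a (eps a 2) * ofU a (eps a 2) * (omD a i j * omD a i j) =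
      (c • (EW a - 1) + V) * (c • (EW a - 1) + (V + c • 1)) := by
    have : ofU a (eps a 2) * ofU a (eps a 2) * (omD a i j * omD a i j) =
        (ofU a (eps a 2) * omD a i j - c • 1) * (ofU a (eps a 2) * omD a i j) := by
      have h2 : ofU a (eps a 2) * omD a i j * (ofU a (eps a 2) * omD a i j) =
          ofU a (eps a 2) * (omD a i j * ofU a (eps a 2)) * omD a i j := by
        simp only [mul_assoc]
      rw [sub_mul, h2, omD_mul_eps_two]
      simp only [mul_add, add_mul, mul_assoc, mul_smul_comm, smul_mul_assoc, one_mul, mul_one]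
      rw [add_sub_cancel_right]
    rw [this, hG]
    congr 1
    abel
  have hH : c • (EW a - 1) ∈ IHat a := smul_mem_IHat _ (EW_sub_one_mem a)
  have hX : V + c • 1 ∈ NHat a :=
    (NHat a).add_mem (tauU_mem a _) ((NHat a).smul_mem (NHat a).one_mem c)
  have h3 : ofU a (eps a 2) * ofU a (eps a 2) * (omD a i j * omD a i j)
      - tauU a (vW a i j * vW a i j + c • vW a i j) =
      (c • (EW a - 1) + V) * (c • (EW a - 1)) + c • (EW a - 1) * (V + c • 1) := by
    rw [h1, map_add, map_mul, map_smul, ← hV]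
    generalize c • (EW a - 1) = H
    simp only [mul_add, add_mul, mul_smul_comm, mul_one, smul_add]
    abel
  rw [h3]
  exact Ideal.add_mem _ (Ideal.mul_mem_left _ _ hH) (hX _ hH)

/-- The potential `½ (Cᵢ φⱼ/φᵢ + Cⱼ φᵢ/φⱼ)`. -/
def potE (a : Fin (g + 3) ↪ ℂ) (C : Fin (g + 3) → ℂ) (i j : Fin (g + 3)) : KX g :=
  algebraMap ℂ (KX g) (C i / 2) * (phiE a j / phiE a i)
    + algebraMap ℂ (KX g) (C j / 2) * (phiE a i / phiE a j)

theorem eta_potU (a : Fin (g + 3) ↪ ℂ) (C : Fin (g + 3) → ℂ) (i j : Fin (g + 3)) :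
    eta a (potU a C i j) = constS g (potE a C i j) := by
  have hi : constS g (phiE a i) ≠ 0 := (map_ne_zero_iff _ constS_injective).mpr (phiE_ne_zero a i)
  have hj : constS g (phiE a j) ≠ 0 := (map_ne_zero_iff _ constS_injective).mpr (phiE_ne_zero a j)
  have hs := sS_ne_zero (g := g)
  simp only [potU, potE, map_add, map_mul, map_div₀, eta_fv, eta_fInv, Algebra.smul_def,
    AlgHom.commutes]
  field_simp

/-- The contribution of the indices `i`, `j` to the Hitchin Hamiltonians. -/
def pairW (a : Fin (g + 3) ↪ ℂ) (C : Fin (g + 3) → ℂ) (i j : Fin (g + 3)) : W0 g :=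
  ofW (potE a C i j)
    - ofW (phiE a i * phiE a j) * (vW a i j * vW a i j + mD a 2 i j • vW a i j)

/-- The Hitchin Hamiltonians in the coordinates `e₁, …, e_g`. -/
def hitchW (a : Fin (g + 3) ↪ ℂ) (C : Fin (g + 3) → ℂ) (i : Fin (g + 3)) : W0 g :=
  ∑ j ∈ Finset.univ.erase i, (a i - a j)⁻¹ • pairW a C i j

/-- On the subspace the potential has degree zero and `fᵢ fⱼ = φᵢ φⱼ ε₂²`; the factor `ε₂²` is
absorbed by `ω²`. -/
theorem pair_sub_mem (a : Fin (g + 3) ↪ ℂ) (C : Fin (g + 3) → ℂ) (i j : Fin (g + 3)) :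
    ofU a (potU a C i j) - ofU a (fv a i * fv a j) * (omD a i j * omD a i j)
      - tauU a (pairW a C i j) ∈ IHat a := by
  have h1 : ofU a (potU a C i j - rho a (potE a C i j)) ∈ IHat a :=
    ofU_mem_IHat (by rw [map_sub, eta_potU, eta_rho, sub_self])
  have h2 : ofU a (fv a i * fv a j - rho a (phiE a i * phiE a j) * (eps a 2 * eps a 2)) *
      (omD a i j * omD a i j) ∈ IHat a := by
    refine ofU_mul_mem_of_eta ?_ ?_ ?_
    · simp only [map_sub, map_mul, eta_fv, eta_rho, eta_eps_two]
      ring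
    · rw [mul_assoc, omD_mul_eps_zero, ← mul_assoc, omD_mul_eps_zero, mul_assoc]
    · rw [mul_assoc, omD_mul_eps_one, ← mul_assoc, omD_mul_eps_one, mul_assoc]
  have h3 := Ideal.mul_mem_left (IHat a) (ofU a (rho a (phiE a i * phiE a j)))
    (eps_sq_omD_sq a i j)
  have e : ofU a (potU a C i j) - ofU a (fv a i * fv a j) * (omD a i j * omD a i j)
      - tauU a (pairW a C i j) =
      ofU a (potU a C i j - rho a (potE a C i j))
      - ofU a (fv a i * fv a j - rho a (phiE a i * phiE a j) * (eps a 2 * eps a 2)) *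
        (omD a i j * omD a i j)
      - ofU a (rho a (phiE a i * phiE a j)) * (ofU a (eps a 2) * ofU a (eps a 2) *
        (omD a i j * omD a i j) - tauU a (vW a i j * vW a i j + mD a 2 i j • vW a i j)) := by
    rw [pairW, map_sub (tauU a), map_mul (tauU a), tauU_ofW, tauU_ofW, map_sub (ofU a),
      map_sub (ofU a), map_mul (ofU a) (rho a _), map_mul (ofU a) (eps a 2), sub_mul, mul_sub,
      mul_assoc (ofU a (rho a (phiE a i * phiE a j)))]
    abel
  rw [e]
  exact Ideal.sub_mem _ (Ideal.sub_mem _ h1 h2) h3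

/-- The sums `∑ⱼ (aᵢ - aⱼ) fⱼ` and `∑ⱼ fⱼ ω_{ij}` are `ε₁` and `-EW` up to multiples of `ε₀`. Moving
`ε₁` past `θ₁²` leaves `-2 θ₁`, which combines with `2 θ₁ EW` into `2 θ₁ (EW - 1) ∈ Î`. -/
theorem sum_transverse_mem (a : Fin (g + 3) ↪ ℂ) (i : Fin (g + 3)) :
    ∑ j, ofU a (fv a i * fv a j) *
      ((a i - a j) • (theta a 1 * theta a 1) - (2 : ℂ) • (omD a i j * theta a 1)) ∈ IHat a := by
  have e1 : ∑ j, (a i - a j) • ofU a (fv a j) =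
      ofU a (eps a 1) + (a i - esymOn Finset.univ a 1) • ofU a (eps a 0) := by
    simp only [eps_one, eps_zero, map_sub, map_smul, map_sum, sub_smul, Finset.sum_sub_distrib,
      ← Finset.smul_sum]
    abel
  have e2 : ∑ j, ofU a (fv a j) * omD a i j = ofU a (eps a 0) * omU a i - EW a := by
    simp only [omD, mul_sub, Finset.sum_sub_distrib, sum_fv_omU, eps_zero, map_sum, Finset.sum_mul]
  have e3 : ∑ j, ofU a (fv a i * fv a j) *
      ((a i - a j) • (theta a 1 * theta a 1) - (2 : ℂ) • (omD a i j * theta a 1)) =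
      ofU a (fv a i) * ((∑ j, (a i - a j) • ofU a (fv a j)) * (theta a 1 * theta a 1)
        - (2 : ℂ) • ((∑ j, ofU a (fv a j) * omD a i j) * theta a 1)) := by
    simp only [Finset.sum_mul, Finset.smul_sum, ← Finset.sum_sub_distrib, Finset.mul_sum, map_mul]
    refine Finset.sum_congr rfl fun j _ => ?_
    simp only [mul_sub, mul_smul_comm, smul_mul_assoc, mul_assoc]
  have h01 : (0 : Fin (g + 3)) ≠ 1 := by simp
  have t0 : ofU a (eps a 0) * (theta a 1 * theta a 1) =
      theta a 1 * theta a 1 * ofU a (eps a 0) := by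
    rw [← mul_assoc, ← theta_mul_eps_zero a h01, mul_assoc, ← theta_mul_eps_zero a h01, mul_assoc]
  have t1 : ofU a (eps a 1) * (theta a 1 * theta a 1) =
      theta a 1 * theta a 1 * ofU a (eps a 1) - (2 : ℂ) • theta a 1 := by
    have h : ofU a (eps a 1) * theta a 1 = theta a 1 * ofU a (eps a 1) - 1 := by
      rw [theta_one_mul_eps]; abel
    rw [← mul_assoc, h, sub_mul, mul_assoc, h, mul_sub, mul_one, one_mul, mul_assoc, two_smul]
    abel
  have t2 : ofU a (eps a 0) * omU a i * theta a 1 = omU a i * theta a 1 * ofU a (eps a 0) := by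
    rw [← omU_mul_eps_zero, mul_assoc, ← theta_mul_eps_zero a h01, mul_assoc]
  have t3 : EW a * theta a 1 = theta a 1 * EW a := by
    rw [EW, add_mul, mul_add, Finset.sum_mul, Finset.mul_sum, mul_assoc, theta_comm, ← mul_assoc,
      ← mul_assoc, theta_mul_eps_two a fin_one_ne_two.symm]
    congr 1
    refine Finset.sum_congr rfl fun k _ => ?_
    have h := theta_mul_eps_of_ne a (m := 1) (m' := k.succ.succ.succ) (fin_one_ne_succ k).symm
    simp only [Fin.val_succ] at h
    rw [mul_assoc, theta_comm, ← mul_assoc, ← mul_assoc, h]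
  rw [e3, e1, e2]
  refine Ideal.mul_mem_left _ _ ?_
  have e4 : (ofU a (eps a 1) + (a i - esymOn Finset.univ a 1) • ofU a (eps a 0)) *
      (theta a 1 * theta a 1) - (2 : ℂ) • ((ofU a (eps a 0) * omU a i - EW a) * theta a 1) =
      theta a 1 * theta a 1 * ofU a (eps a 1)
      + (a i - esymOn Finset.univ a 1) • (theta a 1 * theta a 1 * ofU a (eps a 0))
      - (2 : ℂ) • (omU a i * theta a 1 * ofU a (eps a 0))
      + (2 : ℂ) • (theta a 1 * (EW a - 1)) := by
    rw [add_mul, smul_mul_assoc, sub_mul, t0, t1, t2, t3, mul_sub, mul_one]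
    module
  rw [e4]
  refine Ideal.add_mem _ (Ideal.sub_mem _ (Ideal.add_mem _ ?_ ?_) ?_) ?_
  · exact Ideal.mul_mem_left _ _ (ofU_eps_one_mem a)
  · exact smul_mem_IHat _ (Ideal.mul_mem_left _ _ (ofU_eps_zero_mem a))
  · exact smul_mem_IHat _ (Ideal.mul_mem_left _ _ (ofU_eps_zero_mem a))
  · exact smul_mem_IHat _ (Ideal.mul_mem_left _ _ (EW_sub_one_mem a))

theorem HHitch_sub_mem (a : Fin (g + 3) ↪ ℂ) (C : Fin (g + 3) → ℂ) (i : Fin (g + 3)) :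
    HHitch a C i - tauU a (hitchW a C i) ∈ IHat a := by
  have hsq : ∀ j, (yU a i - yU a j) * (yU a i - yU a j) = (a i - a j) •
      ((a i - a j) • (theta a 1 * theta a 1) - (2 : ℂ) • (omD a i j * theta a 1))
      + omD a i j * omD a i j := by
    intro j
    have h : yU a i - yU a j = omD a i j - (a i - a j) • theta a 1 := by
      rw [yU_eq_omU, yU_eq_omU, omD]
      module
    have hc : theta a 1 * omD a i j = omD a i j * theta a 1 := by
      rw [omD, mul_sub, sub_mul, theta_mul_theta_omU, theta_mul_theta_omU]
    rw [h]
    simp only [mul_sub, sub_mul, mul_smul_comm, smul_mul_assoc, hc]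
    module
  have key : HHitch a C i - tauU a (hitchW a C i) =
      ∑ j ∈ Finset.univ.erase i, (a i - a j)⁻¹ •
        (ofU a (potU a C i j) - ofU a (fv a i * fv a j) * (omD a i j * omD a i j)
          - tauU a (pairW a C i j))
      - ∑ j, ofU a (fv a i * fv a j) *
        ((a i - a j) • (theta a 1 * theta a 1) - (2 : ℂ) • (omD a i j * theta a 1)) := by
    -- The term `j = i` of the transverse sum is zero, so both sums can be taken over `j ≠ i`.
    have hii : ofU a (fv a i * fv a i) *
        ((a i - a i) • (theta a 1 * theta a 1) - (2 : ℂ) • (omD a i i * theta a 1)) = 0 := by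
      rw [sub_self, zero_smul, omD, sub_self, zero_mul, smul_zero, sub_zero, mul_zero]
    rw [← Finset.sum_erase_add _ _ (Finset.mem_univ i), hii, add_zero, HHitch, hitchW, map_sum,
      ← Finset.sum_sub_distrib, ← Finset.sum_sub_distrib]
    refine Finset.sum_congr rfl fun j hj => ?_
    have hij : i ≠ j := (Finset.ne_of_mem_erase hj).symm
    rw [hitch_pair a C hij, hsq, map_smul, mul_add, mul_smul_comm]
    generalize ofU a (fv a i * fv a j) *
        ((a i - a j) • (theta a 1 * theta a 1) - (2 : ℂ) • (omD a i j * theta a 1)) = Z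
    have hz : Z = (a i - a j)⁻¹ • (a i - a j) • Z := by
      rw [smul_smul, inv_mul_cancel₀ (a_sub_ne a hij), one_smul]
    conv_rhs => rw [hz]
    module
  rw [key]
  refine Ideal.sub_mem _ (Submodule.sum_mem _ fun j _ => smul_mem_IHat _ (pair_sub_mem a C i j))
    (sum_transverse_mem a i)

theorem HHitch_mem (a : Fin (g + 3) ↪ ℂ) (C : Fin (g + 3) → ℂ) (i : Fin (g + 3)) :
    HHitch a C i ∈ NHat a := by
  have := (NHat a).add_mem (IHat_le_NHat (HHitch_sub_mem a C i)) (tauU_mem a (hitchW a C i))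
  rwa [sub_add_cancel] at this

theorem cls_HHitch (a : Fin (g + 3) ↪ ℂ) (C : Fin (g + 3) → ℂ) (i : Fin (g + 3))
    (h : HHitch a C i ∈ NHat a) : cls a (HHitch a C i) h = psiU a (hitchW a C i) := by
  rw [psiU_apply, cls_eq_cls_iff]
  exact HHitch_sub_mem a C i

/-! ### Interpolation -/

section Interpolation

open Finset

variable {F : Type*} [Field F] {g : ℕ}

theorem esymOn_erase_one (b : Fin (g + 3) → F) (i : Fin (g + 3)) :
    esymOn (univ.erase i) b 1 = esymOn univ b 1 - b i := by
  have := esymOn_erase (mem_univ i) b 0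
  rw [esymOn_zero] at this
  linear_combination -this

theorem esymOn_erase_two (b : Fin (g + 3) → F) (i : Fin (g + 3)) :
    esymOn (univ.erase i) b 2 = esymOn univ b 2 - b i * esymOn univ b 1 + b i ^ 2 := by
  have := esymOn_erase (mem_univ i) b 1
  rw [esymOn_erase_one] at this
  linear_combination -this

/-- These are, up to sign, the three leading coefficients of `∑ᵢ tᵢ ∏_{j ≠ i} (X - bⱼ)`; they are
combinations of the moments of `t` of order at most two. -/
theorem sum_mul_esymOn_erase_eq_zero (b : Fin (g + 3) → F) (t : Fin (g + 3) → F)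
    (h0 : ∑ i, t i = 0) (h1 : ∑ i, b i * t i = 0) (h2 : ∑ i, b i ^ 2 * t i = 0) {m : ℕ}
    (hm : m < 3) : ∑ i, t i * esymOn (univ.erase i) b m = 0 := by
  interval_cases m
  · simpa [esymOn_zero] using h0
  · simp only [esymOn_erase_one, mul_sub, sum_sub_distrib, ← sum_mul, h0, mul_comm (t _) (b _), h1]
    ring
  · simp only [esymOn_erase_two, mul_sub, mul_add, sum_sub_distrib, sum_add_distrib, ← mul_assoc,
      ← sum_mul, h0, mul_comm (t _) (b _), mul_comm (t _) (b _ ^ 2), h1, h2]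
    ring

/-- Lagrange interpolation of `∑ᵢ tᵢ ∏_{j ≠ i} (X - bⱼ)` at the points `x_α`. -/
theorem interp_residues {b : Fin (g + 3) → F} {x : Fin g → F} (hx : Function.Injective x)
    {t : Fin (g + 3) → F} (h0 : ∑ i, t i = 0) (h1 : ∑ i, b i * t i = 0)
    (h2 : ∑ i, b i ^ 2 * t i = 0) (i : Fin (g + 3)) :
    t i * ∏ j ∈ univ.erase i, (b i - b j) =
      ∑ α, (∏ β ∈ univ.erase α, (x β - b i) / (x β - x α)) *
        ∑ j, t j * ∏ l ∈ univ.erase j, (x α - b l) := by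
  let R : Polynomial F := ∑ j, Polynomial.C (t j) *
    ∏ l ∈ univ.erase j, (Polynomial.X - Polynomial.C (b l))
  have hR : ∀ y, R.eval y = ∑ j, t j * ∏ l ∈ univ.erase j, (y - b l) := by
    intro y
    simp [R, Polynomial.eval_finsetSum, Polynomial.eval_prod]
  have hR' : R = ∑ m : Fin (g + 3), Polynomial.C ((-1) ^ (m : ℕ) *
      ∑ j, t j * esymOn (univ.erase j) b m) * Polynomial.X ^ (g + 3 - 1 - m) := by
    have hp : ∀ j, ∏ l ∈ univ.erase j, (Polynomial.X - Polynomial.C (b l)) = _ := fun j =>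
      prod_erase_sub_eq_sum (fun l => Polynomial.C (b l)) j Polynomial.X
    simp only [R, hp, mul_sum, map_sum, sum_mul]
    rw [sum_comm]
    refine sum_congr rfl fun m _ => sum_congr rfl fun j _ => ?_
    rw [← map_esymOn Polynomial.C]
    simp only [map_mul, map_pow, map_neg, map_one]
    ring
  have hdeg : R.degree < #(univ : Finset (Fin g)) := by
    rw [card_univ, Fintype.card_fin, hR', Polynomial.degree_lt_iff_coeff_zero]
    intro n hn
    simp only [Polynomial.finsetSum_coeff, Polynomial.coeff_C_mul, Polynomial.coeff_X_pow]
    refine sum_eq_zero fun m _ => ?_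
    by_cases hm : (m : ℕ) < 3
    · rw [sum_mul_esymOn_erase_eq_zero b t h0 h1 h2 hm, mul_zero, zero_mul]
    · rw [if_neg (by omega), mul_zero]
  have hL := congrArg (Polynomial.eval (b i))
    (Lagrange.eq_interpolate (s := univ) (v := x) (hx.injOn) hdeg)
  rw [hR] at hL
  have hself : ∑ j, t j * ∏ l ∈ univ.erase j, (b i - b l) =
      t i * ∏ j ∈ univ.erase i, (b i - b j) := by
    refine sum_eq_single i (fun j _ hj => ?_) (by simp)
    rw [prod_eq_zero (mem_erase.mpr ⟨hj.symm, mem_univ i⟩) (sub_self _), mul_zero]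
  rw [← hself, hL, Lagrange.interpolate_apply, Polynomial.eval_finsetSum]
  refine sum_congr rfl fun α _ => ?_
  rw [Polynomial.eval_mul, Polynomial.eval_C, hR, mul_comm, Lagrange.basis, Polynomial.eval_prod]
  congr 1
  refine prod_congr rfl fun β hβ => ?_
  rw [Lagrange.basisDivisor, Polynomial.eval_mul, Polynomial.eval_C, Polynomial.eval_sub,
    Polynomial.eval_X, Polynomial.eval_C, ← neg_sub (x β) (x α), ← neg_sub (x β) (b i), inv_neg,
    neg_mul_neg, div_eq_inv_mul]

/-- Symmetrize in `i, j`: the antisymmetry of `1 / (bᵢ - bⱼ)` turns `w` into its divided difference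
`κ`. The value `κ i i` is free, so its contribution is removed. -/
theorem two_mul_sum_pairs {n : ℕ} {b w : Fin n → F} {Ω κ : Fin n → Fin n → F}
    (hb : Function.Injective b) (hs : ∀ i j, Ω i j = Ω j i)
    (hκ : ∀ i j, w i - w j = κ i j * (b i - b j)) :
    2 * ∑ i, w i * ∑ j, Ω i j / (b i - b j) = ∑ i, ∑ j, κ i j * Ω i j - ∑ i, κ i i * Ω i i := by
  have e1 : ∑ i, w i * ∑ j, Ω i j / (b i - b j) = ∑ i, ∑ j, w i * (Ω i j / (b i - b j)) := by
    simp only [mul_sum]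
  have e2 : ∑ i, w i * ∑ j, Ω i j / (b i - b j) = ∑ i, ∑ j, -(w j * (Ω i j / (b i - b j))) := by
    rw [e1, sum_comm]
    refine sum_congr rfl fun i _ => sum_congr rfl fun j _ => ?_
    rw [hs j i, ← neg_sub (b i) (b j), div_neg, mul_neg]
  have e3 : ∑ i, κ i i * Ω i i = ∑ i, ∑ j, if i = j then κ i j * Ω i j else 0 := by simp
  rw [two_mul]
  nth_rewrite 1 [e1]
  rw [e2, e3, ← sum_add_distrib, ← sum_sub_distrib]
  refine sum_congr rfl fun i _ => ?_
  rw [← sum_add_distrib, ← sum_sub_distrib]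
  refine sum_congr rfl fun j _ => ?_
  by_cases hij : i = j
  · subst hij
    simp
  · have hne : b i - b j ≠ 0 := sub_ne_zero.mpr fun e => hij (hb e)
    rw [if_neg hij, sub_zero, ← sub_eq_add_neg, ← sub_mul, hκ]
    field_simp

/-- The conditions on `Ω` say that `tᵢ = ∑ⱼ Ω i j / (bᵢ - bⱼ)` has vanishing moments of order `0, 1,
2`, so `interp_residues` applies. Its values at `x_α` come from symmetrizing with `w = 1 / (x_α -
b)`. -/
theorem interp_pairs [CharZero F] {b : Fin (g + 3) → F} {x : Fin g → F}
    (hb : Function.Injective b) (hx : Function.Injective x) (hxb : ∀ α i, x α - b i ≠ 0)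
    {Ω : Fin (g + 3) → Fin (g + 3) → F} (hs : ∀ i j, Ω i j = Ω j i)
    (h0 : ∑ i, ∑ j, Ω i j = ∑ i, Ω i i) (h1 : ∑ i, ∑ j, b i * Ω i j = ∑ i, b i * Ω i i)
    (i : Fin (g + 3)) :
    (∏ j ∈ univ.erase i, (b i - b j)) * ∑ j ∈ univ.erase i, Ω i j / (b i - b j) =
      ∑ α, (∏ β ∈ univ.erase α, (x β - b i) / (x β - x α)) * ((∏ l, (x α - b l)) *
        ((∑ i, ∑ j, Ω i j / ((x α - b i) * (x α - b j)) - ∑ i, Ω i i / (x α - b i) ^ 2) / 2)) := by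
  set t : Fin (g + 3) → F := fun i => ∑ j, Ω i j / (b i - b j) with ht
  -- The diagonal term is a division by `0`, hence `0`, and may be included.
  have hti : ∑ j ∈ univ.erase i, Ω i j / (b i - b j) = t i := by
    rw [ht]
    simp only
    rw [← sum_erase_add _ _ (mem_univ i), sub_self, div_zero, add_zero]
  have t0 : ∑ i, t i = 0 := by
    have := two_mul_sum_pairs (w := fun _ => 1) (κ := fun _ _ => 0) hb hs (by simp)
    simpa [ht] using this
  have t1 : ∑ i, b i * t i = 0 := by
    have := two_mul_sum_pairs (w := b) (κ := fun _ _ => 1) hb hs (by simp)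
    simp only [one_mul, h0, sub_self] at this
    simpa [ht] using this
  have t2 : ∑ i, b i ^ 2 * t i = 0 := by
    have := two_mul_sum_pairs (w := fun i => b i ^ 2) (κ := fun i j => b i + b j) hb hs
      (fun i j => by ring)
    have h2 : ∑ i, ∑ j, (b i + b j) * Ω i j = 2 * ∑ i, ∑ j, b i * Ω i j := by
      simp only [add_mul, sum_add_distrib, two_mul]
      congr 1
      rw [sum_comm]
      exact sum_congr rfl fun i _ => sum_congr rfl fun j _ => by rw [hs]
    have h3 : ∑ i, (b i + b i) * Ω i i = 2 * ∑ i, b i * Ω i i := by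
      rw [mul_sum]
      exact sum_congr rfl fun i _ => by ring
    rw [h2, h3, h1, sub_self] at this
    simpa [ht] using this
  rw [hti, mul_comm, interp_residues hx t0 t1 t2 i]
  refine sum_congr rfl fun α _ => ?_
  congr 1
  have h3 := two_mul_sum_pairs (w := fun i => (x α - b i)⁻¹)
    (κ := fun i j => ((x α - b i) * (x α - b j))⁻¹) hb hs (fun i j => by
      have h1 := hxb α i
      have h2 := hxb α j
      field_simp
      ring)
  have h4 : ∑ i, ∑ j, Ω i j / ((x α - b i) * (x α - b j)) - ∑ i, Ω i i / (x α - b i) ^ 2 =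
      2 * ∑ i, (x α - b i)⁻¹ * t i := by
    rw [ht, h3]
    simp only [div_eq_inv_mul, pow_two]
  rw [h4, mul_div_cancel_left₀ _ (two_ne_zero), mul_sum]
  refine sum_congr rfl fun j _ => ?_
  rw [← mul_prod_erase _ _ (mem_univ j)]
  have := hxb α j
  field_simp

/-- The polarization of a variance. -/
theorem sum_pairs_mul {n : ℕ} (v w p q : Fin n → F) :
    ∑ i, ∑ j, v i * w j * ((p i - p j) * (q i - q j)) =
      (∑ i, v i * (p i * q i)) * ∑ i, w i - (∑ i, v i * p i) * (∑ i, w i * q i)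
        - (∑ i, v i * q i) * (∑ i, w i * p i) + (∑ i, v i) * ∑ i, w i * (p i * q i) := by
  simp only [sum_mul_sum, ← sum_sub_distrib, ← sum_add_distrib]
  exact sum_congr rfl fun i _ => sum_congr rfl fun j _ => by ring

end Interpolation

/-! ### The functions `φᵢ` of `x₁, …, x_g` -/

/-- The functions `φᵢ` of `x₁, …, x_g`. -/
def phiX (a : Fin (g + 3) ↪ ℂ) (i : Fin (g + 3)) : KX g := iotaX g (phiE a i)

/-- The numbers `aᵢ` in `ℂ(x₁, …, x_g)`. -/
abbrev aK (a : Fin (g + 3) ↪ ℂ) (i : Fin (g + 3)) : KX g := algebraMap ℂ (KX g) (a i)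

theorem aK_injective (a : Fin (g + 3) ↪ ℂ) : Function.Injective (aK a) :=
  (algebraMap ℂ (KX g)).injective.comp a.injective

theorem sum_phiX (a : Fin (g + 3) ↪ ℂ) : ∑ i, phiX a i = 0 := by
  have := congrArg (iotaX g) (sum_esymA_zero_phiE a)
  rwa [map_sum, map_zero] at this

theorem sum_a_mul_phiX (a : Fin (g + 3) ↪ ℂ) : ∑ i, aK a i * phiX a i = 0 := by
  have := congrArg (iotaX g) (sum_a_mul_phiE a)
  simp only [map_sum, map_zero, map_mul, AlgHom.commutes] at this
  exact this

theorem sum_a_sq_mul_phiX (a : Fin (g + 3) ↪ ℂ) : ∑ i, aK a i ^ 2 * phiX a i = 1 := by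
  have := congrArg (iotaX g) (sum_a_sq_mul_phiE a)
  simp only [map_sum, map_one, map_mul, map_pow, AlgHom.commutes] at this
  exact this

/-- Separation of variables: the coefficients of the left side are, up to sign, `0, 0, 1, e₁, …,
e_g`, so the `x_α` are the roots of the normalized `P_f`. -/
theorem sum_phiX_prod (a : Fin (g + 3) ↪ ℂ) (y : KX g) :
    ∑ i, phiX a i * ∏ j ∈ Finset.univ.erase i, (y - aK a j) = ∏ α, (y - xv α) := by
  have hm : ∀ m : ℕ, ∑ i, phiX a i * esymOn (Finset.univ.erase i) (aK a) m =
      iotaX g (∑ i, algebraMap ℂ (KX g) (esymA a m i) * phiE a i) := by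
    intro m
    rw [map_sum]
    refine Finset.sum_congr rfl fun i _ => ?_
    rw [map_mul, AlgHom.commutes, mul_comm, esymA_eq, map_esymOn]
    rfl
  have h1 : ∑ i, phiX a i * ∏ j ∈ Finset.univ.erase i, (y - aK a j) =
      ∑ m : Fin (g + 3), (-1) ^ (m : ℕ) *
        (∑ i, phiX a i * esymOn (Finset.univ.erase i) (aK a) m) * y ^ (g + 3 - 1 - m) := by
    simp only [prod_erase_sub_eq_sum, Finset.mul_sum, Finset.sum_mul]
    rw [Finset.sum_comm]
    exact Finset.sum_congr rfl fun m _ => Finset.sum_congr rfl fun j _ => by ring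
  rw [h1, sum_fin_three]
  simp only [hm, Fin.val_zero, Fin.val_one, Fin.val_two, Fin.val_succ]
  simp only [add_assoc, Nat.reduceAdd]
  have hz : ∑ i, algebraMap ℂ (KX g) (esymA a 0 i) * phiE a i = 0 := by
    simpa [esymA_zero] using sum_esymA_zero_phiE a
  rw [hz, sum_esymA_one_phiE, sum_esymA_two_phiE, prod_sub_eq_sum_esymOn, Finset.card_univ,
    Fintype.card_fin, Finset.sum_range_succ', Finset.sum_range]
  simp only [sum_esymA_succ_phiE, iotaX_xv, map_zero, map_one, esymOn_zero, pow_zero, mul_zero,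
    zero_mul, zero_add]
  rw [add_comm]
  congr 1
  · refine Finset.sum_congr rfl fun k _ => ?_
    rw [show g + 3 - 1 - (k + 3) = g - (k + 1) by omega, pow_succ, pow_succ, pow_succ]
    simp [eX]
  · rw [show g + 3 - 1 - 2 = g - 0 by omega]
    ring

/-- The equation of the root `x_α`. With the vanishing moments of `φ`, it makes the moments of order
`0, 1, 2` of `φᵢ / (x_α - aᵢ)` vanish. -/
theorem sum_phiX_div (a : Fin (g + 3) ↪ ℂ) (α : Fin g) :
    ∑ i, phiX a i / (xv α - aK a i) = 0 := by
  have h := sum_phiX_prod a (xv α)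
  rw [Finset.prod_eq_zero (Finset.mem_univ α) (sub_self _)] at h
  have h2 : (∏ i, (xv α - aK a i)) * ∑ i, phiX a i / (xv α - aK a i) = 0 := by
    rw [← h, Finset.mul_sum]
    refine Finset.sum_congr rfl fun i _ => ?_
    rw [← Finset.mul_prod_erase _ _ (Finset.mem_univ i)]
    have := xv_sub_ne α (a i)
    field_simp
  exact (mul_eq_zero.mp h2).resolve_left
    (Finset.prod_ne_zero_iff.mpr fun i _ => xv_sub_ne α (a i))

theorem sum_a_mul_phiX_div (a : Fin (g + 3) ↪ ℂ) (α : Fin g) :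
    ∑ i, phiX a i / (xv α - aK a i) * aK a i = 0 := by
  have h : ∀ i, phiX a i / (xv α - aK a i) * aK a i =
      xv α * (phiX a i / (xv α - aK a i)) - phiX a i := by
    intro i
    have := xv_sub_ne α (a i)
    field_simp
    ring
  simp only [h, Finset.sum_sub_distrib, ← Finset.mul_sum, sum_phiX_div, sum_phiX]
  ring

theorem sum_a_sq_mul_phiX_div (a : Fin (g + 3) ↪ ℂ) (α : Fin g) :
    ∑ i, phiX a i / (xv α - aK a i) * aK a i ^ 2 = 0 := by
  have h : ∀ i, phiX a i / (xv α - aK a i) * aK a i ^ 2 =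
      xv α * (phiX a i / (xv α - aK a i) * aK a i) - aK a i * phiX a i := by
    intro i
    have := xv_sub_ne α (a i)
    field_simp
    ring
  simp only [h, Finset.sum_sub_distrib, ← Finset.mul_sum, sum_a_mul_phiX_div, sum_a_mul_phiX]
  ring

theorem phiX_ne_zero (a : Fin (g + 3) ↪ ℂ) (i : Fin (g + 3)) : phiX a i ≠ 0 :=
  (map_ne_zero_iff _ (iotaX g).toRingHom.injective).mpr (phiE_ne_zero a i)

theorem phiX_eq (a : Fin (g + 3) ↪ ℂ) (i : Fin (g + 3)) :
    phiX a i = (∏ α, (aK a i - xv α)) *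
      algebraMap ℂ (KX g) (∏ j ∈ Finset.univ.erase i, (a i - a j))⁻¹ := by
  have h := sum_phiX_prod a (aK a i)
  rw [Finset.sum_eq_single i (fun j _ hj => by
    rw [Finset.prod_eq_zero (Finset.mem_erase.mpr ⟨hj.symm, Finset.mem_univ i⟩) (sub_self _),
      mul_zero]) (by simp)] at h
  have hne := prod_erase_ne_zero (aK_injective a) i
  rw [← h, map_inv₀, map_prod]
  simp only [map_sub]
  rw [mul_assoc, mul_inv_cancel₀ hne, mul_one]

theorem dX_prod_of_notMem {s : Finset (Fin g)} {α : Fin g} (h : α ∉ s) (c : ℂ) :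
    dX α (∏ β ∈ s, (algebraMap ℂ (KX g) c - xv β)) = 0 := by
  induction s using Finset.induction_on with
  | empty => simp
  | insert β s hβ ih =>
    rw [Finset.mem_insert, not_or] at h
    rw [Finset.prod_insert hβ, Derivation.leibniz, ih h.2, map_sub, dX_algebraMap, dX_xv,
      if_neg h.1]
    simp

theorem dX_phiX_eq (a : Fin (g + 3) ↪ ℂ) (i : Fin (g + 3)) (α : Fin g) :
    dX α (phiX a i) = - ((∏ β ∈ Finset.univ.erase α, (aK a i - xv β)) *
      algebraMap ℂ (KX g) (∏ j ∈ Finset.univ.erase i, (a i - a j))⁻¹) := by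
  rw [phiX_eq, ← Finset.mul_prod_erase _ _ (Finset.mem_univ α)]
  simp only [Derivation.leibniz, map_sub, dX_algebraMap, dX_xv,
    dX_prod_of_notMem (Finset.notMem_erase α _), smul_eq_mul, if_true]
  ring

theorem dX_phiX (a : Fin (g + 3) ↪ ℂ) (i : Fin (g + 3)) (α : Fin g) :
    dX α (phiX a i) = phiX a i / (xv α - aK a i) := by
  rw [eq_div_iff (xv_sub_ne α (a i)), dX_phiX_eq, phiX_eq,
    ← Finset.mul_prod_erase _ _ (Finset.mem_univ α)]
  ring

/-- `φᵢ` is affine in each `x_α`. -/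
theorem dX_dX_phiX (a : Fin (g + 3) ↪ ℂ) (i : Fin (g + 3)) (α : Fin g) :
    dX α (dX α (phiX a i)) = 0 := by
  rw [dX_phiX_eq, map_neg, Derivation.leibniz, dX_algebraMap,
    dX_prod_of_notMem (Finset.notMem_erase α _)]
  simp

/-! ### Comparison of the Hamiltonians -/

section Symbol

variable {R B : Type*} [CommRing R] [Algebra ℂ R] [Ring B] [Algebra ℂ B] (f : R →ₐ[ℂ] B)
  {u : B} {d : R → R}

theorem adOp_mul_of (q s : R) (v : B) : adOp (f s) (f q * v) = f q * adOp (f s) v := by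
  rw [adOp_apply, adOp_apply, mul_sub, ← mul_assoc (f s), ← map_mul, mul_comm s, map_mul, mul_assoc,
    mul_assoc]

theorem adOp_of (q s : R) : adOp (f s) (f q) = 0 := by
  rw [adOp_apply, ← map_mul, ← map_mul, mul_comm, sub_self]

theorem adOp_adOp_first (hu : ∀ r, u * f r = f r * u + f (d r)) (r s : R) :
    adOp (f s) (adOp (f r) u) = 0 := by
  rw [adOp_apply (f r), hu, add_sub_cancel_left, adOp_of]

/-- Two commutators with functions extract the polarized symbol of a second-order operator;
first-order terms drop out. -/
theorem adOp_adOp_second (hu : ∀ r, u * f r = f r * u + f (d r)) (r s : R) :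
    adOp (f s) (adOp (f r) (u * u)) = f (2 * (d r * d s)) := by
  have h : adOp (f r) (u * u) = f (2 * d r) * u + f (d (d r)) := by
    rw [adOp_apply, mul_assoc, hu, mul_add, ← mul_assoc, hu, hu, two_mul, map_add]
    noncomm_ring
  rw [h, map_add, adOp_of, add_zero, adOp_mul_of, adOp_apply, hu, add_sub_cancel_left, ← map_mul,
    mul_assoc]

end Symbol

/-- The derivation of `ℂ(e₁, …, e_g)` given by the vector field `vW`. -/
def dVW (a : Fin (g + 3) ↪ ℂ) (i j : Fin (g + 3)) : Derivation ℂ (KX g) (KX g) :=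
  ∑ k : Fin g, (algebraMap ℂ (KX g) (mD a (k + 3) i j)
    - algebraMap ℂ (KX g) (mD a 2 i j) * xv k) • dX k

theorem dVW_apply (a : Fin (g + 3) ↪ ℂ) (i j : Fin (g + 3)) (r : KX g) :
    dVW a i j r = ∑ k : Fin g, (algebraMap ℂ (KX g) (mD a (k + 3) i j)
      - algebraMap ℂ (KX g) (mD a 2 i j) * xv k) * dX k r := by
  simp [dVW, derivation_sum_apply]

theorem vW_mul_ofW (a : Fin (g + 3) ↪ ℂ) (i j : Fin (g + 3)) (r : KX g) :
    vW a i j * ofW r = ofW r * vW a i j + ofW (dVW a i j r) := by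
  rw [vW, Finset.sum_mul, Finset.mul_sum, dVW_apply, map_sum, ← Finset.sum_add_distrib]
  refine Finset.sum_congr rfl fun k _ => ?_
  rw [mul_assoc, yW_mul_ofW, mul_add, ← mul_assoc, ← mul_assoc, ← map_mul, ← map_mul, ← map_mul,
    mul_comm r]

/-- The coefficients of the derivative of `φ_l` along the coordinate vector fields. -/
def pE (a : Fin (g + 3) ↪ ℂ) (l i : Fin (g + 3)) : KX g :=
  algebraMap ℂ (KX g) ((if l = i then 1 else 0) + cN a l 1 * a i)
    - algebraMap ℂ (KX g) (esymA a 2 i) * phiE a l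

theorem dX_phiE (a : Fin (g + 3) ↪ ℂ) (l : Fin (g + 3)) (k : Fin g) :
    dX k (phiE a l) = algebraMap ℂ (KX g) (cN a l k.succ.succ.succ) := by
  rw [phiE, map_add, dX_algebraMap, zero_add, map_sum]
  simp [Derivation.leibniz, dX_xv]

/-- The sum over the coordinates `m ≥ 3` equals `δ_{li}` minus the terms `m = 0, 1, 2`. The
constants cancel between `i` and `j`, and the term `m = 2` completes `φ_l`. -/
theorem dVW_phiE (a : Fin (g + 3) ↪ ℂ) (i j l : Fin (g + 3)) :
    dVW a i j (phiE a l) = pE a l i - pE a l j := by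
  have h : ∀ i, ∑ k : Fin g, cN a l k.succ.succ.succ * esymA a (k + 3) i =
      (if l = i then 1 else 0) - cN a l 0 - cN a l 1 * (esymOn Finset.univ a 1 - a i)
        - cN a l 2 * esymA a 2 i := by
    intro i
    rw [← sum_cN_mul_esymA a l i, sum_fin_three]
    simp only [Fin.val_zero, Fin.val_one, Fin.val_two, Fin.val_succ, esymA_zero, esymA_one]
    ring
  have h1 : dVW a i j (phiE a l) =
      algebraMap ℂ (KX g) (∑ k : Fin g, cN a l k.succ.succ.succ * esymA a (k + 3) i)
      - algebraMap ℂ (KX g) (∑ k : Fin g, cN a l k.succ.succ.succ * esymA a (k + 3) j)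
      - algebraMap ℂ (KX g) (mD a 2 i j) *
        ∑ k : Fin g, algebraMap ℂ (KX g) (cN a l k.succ.succ.succ) * xv k := by
    rw [dVW_apply, map_sum, map_sum, Finset.mul_sum, ← Finset.sum_sub_distrib,
      ← Finset.sum_sub_distrib]
    refine Finset.sum_congr rfl fun k _ => ?_
    rw [dX_phiE, mD, map_sub, map_mul, map_mul]
    ring
  have h2 : ∑ k : Fin g, algebraMap ℂ (KX g) (cN a l k.succ.succ.succ) * xv k =
      phiE a l - algebraMap ℂ (KX g) (cN a l 2) := by
    rw [phiE, add_sub_cancel_left]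
  rw [h1, h2, h, h, pE, pE, mD]
  simp only [map_sub, map_add, map_mul]
  ring

/-- This makes `v² + c v`, the second-order part of `pairW`, kill every `φ_l`. -/
theorem dVW_dVW_phiE (a : Fin (g + 3) ↪ ℂ) (i j l : Fin (g + 3)) :
    dVW a i j (dVW a i j (phiE a l)) =
      - (algebraMap ℂ (KX g) (mD a 2 i j) * dVW a i j (phiE a l)) := by
  conv_lhs => rw [dVW_phiE, pE, pE]
  simp only [map_sub, Derivation.leibniz, Derivation.map_algebraMap, mD, smul_eq_mul]
  ring

theorem actX_tauX_ofW (a : Fin (g + 3) ↪ ℂ) (r s : KX g) :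
    actX a (tauX a (ofW r)) (iotaX g s) = iotaX g (r * s) := by
  rw [tauX_ofW, actX_ofX, map_mul]

theorem actX_tauX_vW (a : Fin (g + 3) ↪ ℂ) (i j : Fin (g + 3)) (r : KX g) :
    actX a (tauX a (vW a i j)) (iotaX g r) = iotaX g (dVW a i j r) := by
  rw [vW, map_sum, map_sum, LinearMap.sum_apply, dVW_apply, map_sum]
  refine Finset.sum_congr rfl fun k _ => ?_
  rw [map_mul, map_mul, Module.End.mul_apply, tauX_yW, actX_Dhat, dE_iotaX, actX_tauX_ofW]

theorem actX_pairW (a : Fin (g + 3) ↪ ℂ) (C : Fin (g + 3) → ℂ) (i j l : Fin (g + 3)) :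
    actX a (tauX a (pairW a C i j)) (phiX a l) = iotaX g (potE a C i j) * phiX a l := by
  have h : actX a (tauX a (vW a i j * vW a i j + mD a 2 i j • vW a i j)) (phiX a l) = 0 := by
    rw [map_add, map_add, map_mul, map_mul, map_smul, map_smul, LinearMap.add_apply,
      LinearMap.smul_apply, Module.End.mul_apply, phiX, actX_tauX_vW, actX_tauX_vW,
      dVW_dVW_phiE, Algebra.smul_def, map_neg, map_mul, AlgHom.commutes, neg_add_cancel]
  rw [pairW, map_sub, map_sub, LinearMap.sub_apply, map_mul (tauX a), map_mul (actX a),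
    Module.End.mul_apply, h, map_zero, sub_zero, phiX, actX_tauX_ofW, map_mul]

theorem adOp_adOp_pairW (a : Fin (g + 3) ↪ ℂ) (C : Fin (g + 3) → ℂ) (i j : Fin (g + 3))
    (r s : KX g) : adOp (ofW s) (adOp (ofW r) (pairW a C i j)) =
      ofW (- (phiE a i * phiE a j) * (2 * (dVW a i j r * dVW a i j s))) := by
  rw [pairW, map_sub, map_sub, adOp_of, map_zero, zero_sub, adOp_mul_of, adOp_mul_of, map_add,
    map_add, map_smul, map_smul, adOp_adOp_first ofW (vW_mul_ofW a i j), smul_zero, add_zero,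
    adOp_adOp_second ofW (vW_mul_ofW a i j), ← map_mul, ← map_neg, neg_mul]

/-- `∏_{β ≠ α} (x_β - aᵢ) / (x_β - x_α)`. -/
def lamX (a : Fin (g + 3) ↪ ℂ) (i : Fin (g + 3)) (α : Fin g) : KX g :=
  ∏ β ∈ Finset.univ.erase α, (xv β - aK a i) / (xv β - xv α)

/-- `∑ᵢ (Cᵢ/2) / (x_α - aᵢ)²`. -/
def potX (a : Fin (g + 3) ↪ ℂ) (C : Fin (g + 3) → ℂ) (α : Fin g) : KX g :=
  ∑ i, algebraMap ℂ (KX g) (C i / 2) / (xv α - aK a i) ^ 2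

theorem That_eq (a : Fin (g + 3) ↪ ℂ) (C : Fin (g + 3) → ℂ) (α : Fin g) :
    That a C α = ofX a (piX a α) * (dhat a α * dhat a α) - ofX a (piX a α * potX a C α) := by
  have h : ofX a (Polynomial.aeval (xv α) (PiPoly a))⁻¹ * yv a α = (2 : ℂ) • dhat a α := by
    rw [yv_eq, ← mul_assoc, ← map_mul, twoPi, mul_left_comm]
    change ofX a (2 * ((piX a α)⁻¹ * piX a α)) * dhat a α = _
    rw [inv_mul_cancel₀ (piX_ne_zero a α), mul_one, map_ofNat, ofNat_smul_eq_nsmul ℂ 2]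
    noncomm_ring
  rw [That, h, smul_pow, smul_smul, mul_sub, ← map_mul, pow_two, pow_two, show (1 / 4 : ℂ) * (2 * 2) = 1 by norm_num,
    one_smul]
  rfl

/-- The generating function at `X = aᵢ`: by Vieta, the coefficients of the Beauville–Mukai
Hamiltonians sum to a product over `β ≠ α`. -/
theorem sum_HBM (a : Fin (g + 3) ↪ ℂ) (C : Fin (g + 3) → ℂ) (i : Fin (g + 3)) :
    ((∑ k ∈ Finset.range g, ((-1) ^ k * a i ^ k : ℂ) • HBM a C (k + 1) : AX a) : DX a) =
      ∑ α, ofX a (lamX a i α) * That a C α := by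
  have h1 : ((∑ k ∈ Finset.range g, ((-1) ^ k * a i ^ k : ℂ) • HBM a C (k + 1) : AX a) : DX a) =
      ∑ k ∈ Finset.range g, ((-1) ^ k * a i ^ k : ℂ) •
        ∑ α, ofX a (bmCoeff (g - (k + 1)) α) * That a C α := by
    rw [AddSubmonoidClass.coe_finsetSum]
    rfl
  rw [h1]
  simp only [Finset.smul_sum]
  rw [Finset.sum_comm]
  refine Finset.sum_congr rfl fun α _ => ?_
  simp only [← smul_mul_assoc, ← map_smul]
  rw [← Finset.sum_mul, ← map_sum]
  congr 2
  have h2 : ∏ β ∈ Finset.univ.erase α, (aK a i - xv β) =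
      ∑ m ∈ Finset.range g, (-1) ^ m * esymOn (Finset.univ.erase α) xv m *
        aK a i ^ (g - 1 - m) := by
    rw [prod_erase_sub_eq_sum, Finset.sum_range]
  have h3 : ∏ β ∈ Finset.univ.erase α, (xv β - aK a i) =
      (-1) ^ (g - 1) * ∏ β ∈ Finset.univ.erase α, (aK a i - xv β) := by
    have : ∀ β ∈ Finset.univ.erase α, xv β - aK a i = -1 * (aK a i - xv β) := fun β _ => by ring
    rw [Finset.prod_congr rfl this, Finset.prod_mul_distrib, Finset.prod_const,
      Finset.card_erase_of_mem (Finset.mem_univ α), Finset.card_univ, Fintype.card_fin]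
  -- The reflection `k ↦ g - 1 - k` is needed because the Hamiltonian of index `k + 1` carries the
  -- symmetric function of degree `g - 1 - k`.
  rw [lamX, Finset.prod_div_distrib, h3, h2, ← Finset.sum_range_reflect, Finset.mul_sum,
    Finset.sum_div]
  refine Finset.sum_congr rfl fun k hk => ?_
  have hk' := Finset.mem_range.mp hk
  have hsgn : (-1 : KX g) ^ (g - 1) * (-1) ^ k = (-1) ^ (g - 1 - k) := by
    rw [← pow_add, show g - 1 + k = g - 1 - k + 2 * k by omega, pow_add, pow_mul]
    simp
  rw [bmCoeff, show g - (g - 1 - k + 1) = k by omega, Algebra.smul_def, map_mul, map_pow, map_pow,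
    map_neg, map_one, ← hsgn, esymOn]
  ring

theorem adOp_adOp_That (a : Fin (g + 3) ↪ ℂ) (C : Fin (g + 3) → ℂ) (α : Fin g) (r s : KX g) :
    adOp (ofX a s) (adOp (ofX a r) (That a C α)) =
      ofX a (piX a α * (2 * (dX α r * dX α s))) := by
  rw [That_eq, map_sub, map_sub, adOp_of, map_zero, sub_zero, adOp_mul_of, adOp_mul_of,
    adOp_adOp_second (ofX a) (dhat_mul_ofX a α), ← map_mul]

theorem actX_That (a : Fin (g + 3) ↪ ℂ) (C : Fin (g + 3) → ℂ) (α : Fin g) (l : Fin (g + 3)) :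
    actX a (That a C α) (phiX a l) = piX a α * (- potX a C α) * phiX a l := by
  rw [That_eq, map_sub, LinearMap.sub_apply, map_mul, map_mul, Module.End.mul_apply,
    Module.End.mul_apply, actX_dhat, actX_dhat, dX_dX_phiX, map_zero, actX_ofX]
  ring

/-- An operator is determined by its symbol and its values on the `φ_l`. -/
theorem W0_eq_zero (a : Fin (g + 3) ↪ ℂ) {w : W0 g}
    (h2 : ∀ l m, adOp (ofX a (phiX a m)) (adOp (ofX a (phiX a l)) (tauX a w)) = 0)
    (h0 : ∀ l, actX a (tauX a w) (phiX a l) = 0) : w = 0 := by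
  have hinj := W0_injective (tauX a)
  have hτ : ∀ v l, tauX a (adOp (ofW (phiE a l)) v) = adOp (ofX a (phiX a l)) (tauX a v) := by
    intro v l
    rw [adOp_apply, adOp_apply, map_sub, map_mul, map_mul, tauX_ofW]
    rfl
  have hcomm : ∀ v : W0 g, (∀ l, adOp (ofW (phiE a l)) v = 0) → ∃ r, v = ofW r := by
    intro v hv
    refine exists_ofW_of_comm fun k => ?_
    have hv' : ∀ l, v * ofW (phiE a l) = ofW (phiE a l) * v := fun l => by
      have := hv l
      rwa [adOp_apply, sub_eq_zero] at this
    rw [← sum_esymA_succ_phiE a k, map_sum, Finset.mul_sum, Finset.sum_mul]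
    refine Finset.sum_congr rfl fun l _ => ?_
    rw [← Algebra.smul_def, map_smul, mul_smul_comm, smul_mul_assoc, hv']
  -- The constant `1 = ∑ aᵢ² φᵢ` is a combination of the `φ_l`.
  have h1 : actX a (tauX a w) 1 = 0 := by
    refine (congrArg (actX a (tauX a w)) (sum_a_sq_mul_phiX a)).symm.trans ?_
    rw [map_sum]
    refine Finset.sum_eq_zero fun l _ => ?_
    rw [← map_pow, ← Algebra.smul_def, map_smul, h0, smul_zero]
  -- With zero symbol, `[w, φ_l]` is a function. Its value is found by applying it to `1`, and `w`
  -- kills both `1` and `φ_l`.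
  have had : ∀ l, adOp (ofW (phiE a l)) w = 0 := by
    intro l
    obtain ⟨r, hr⟩ := hcomm (adOp (ofW (phiE a l)) w) fun m => hinj (by
      rw [hτ, hτ, h2, map_zero])
    have h3 := congrArg (fun v => actX a (tauX a v) 1) hr
    simp only [hτ] at h3
    rw [adOp_apply, map_sub, map_mul, map_mul, LinearMap.sub_apply, Module.End.mul_apply,
      Module.End.mul_apply, actX_ofX, actX_ofX, tauX_ofW, actX_ofX, h1, mul_one, mul_one, h0,
      mul_zero, sub_self] at h3
    rw [hr, (map_eq_zero_iff _ (iotaX g).toRingHom.injective).mp h3.symm, map_zero]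
  obtain ⟨r, rfl⟩ := hcomm w had
  have h3 := h1
  rw [tauX_ofW, actX_ofX, mul_one] at h3
  rw [(map_eq_zero_iff _ (iotaX g).toRingHom.injective).mp h3, map_zero]

theorem lamX_sum_of_pairs (a : Fin (g + 3) ↪ ℂ) {Ω : Fin (g + 3) → Fin (g + 3) → KX g}
    (hs : ∀ i j, Ω i j = Ω j i) (h0 : ∑ i, ∑ j, Ω i j = ∑ i, Ω i i)
    (h1 : ∑ i, ∑ j, aK a i * Ω i j = ∑ i, aK a i * Ω i i) (i : Fin (g + 3)) :
    algebraMap ℂ (KX g) (∏ j ∈ Finset.univ.erase i, (a i - a j)) *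
        ∑ j ∈ Finset.univ.erase i, algebraMap ℂ (KX g) (a i - a j)⁻¹ * Ω i j =
      ∑ α, lamX a i α * (piX a α *
        ((∑ i, ∑ j, Ω i j / ((xv α - aK a i) * (xv α - aK a j))
          - ∑ i, Ω i i / (xv α - aK a i) ^ 2) / 2)) := by
  have h := interp_pairs (aK_injective a) xv_injective (fun α i => xv_sub_ne α (a i)) hs h0 h1 i
  simp only [piX, aeval_PiPoly, lamX]
  rw [← h, map_prod]
  simp only [map_sub, map_inv₀, div_eq_inv_mul]

/-- Here `Ω` is a sum of two products of a function of `i` and a function of `j`, one of them `φ`.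
The double sums vanish by the moments of `φ` and by the root equation, while the diagonal `Ω i i =
Cᵢ` satisfies the degree conditions by the hypotheses on the `Cᵢ` and leaves the potential of
`T̂_α`. -/
theorem pot_identity (a : Fin (g + 3) ↪ ℂ) (C : Fin (g + 3) → ℂ)
    (hC₀ : ∑ i, C i = 0) (hC₁ : ∑ i, a i * C i = 0) (i : Fin (g + 3)) :
    algebraMap ℂ (KX g) (∏ j ∈ Finset.univ.erase i, (a i - a j)) *
        ∑ j ∈ Finset.univ.erase i, algebraMap ℂ (KX g) (a i - a j)⁻¹ * iotaX g (potE a C i j) =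
      ∑ α, lamX a i α * (piX a α * (- potX a C α)) := by
  have hΩ : ∀ i j, iotaX g (potE a C i j) =
      algebraMap ℂ (KX g) (C i / 2) / phiX a i * phiX a j
        + phiX a i * (algebraMap ℂ (KX g) (C j / 2) / phiX a j) := by
    intro i j
    rw [potE, map_add, map_mul, map_mul, AlgHom.commutes, AlgHom.commutes, map_div₀ (iotaX g),
      map_div₀ (iotaX g)]
    simp only [phiX]
    ring
  have hΩ' : ∀ i, iotaX g (potE a C i i) = algebraMap ℂ (KX g) (C i) := by
    intro i
    have := phiX_ne_zero a i
    rw [hΩ, div_mul_cancel₀ _ this, mul_div_cancel₀ _ this, ← map_add, add_halves]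
  have hsum : ∀ v w p : Fin (g + 3) → KX g, ∑ i, ∑ j, (v i * w j) * (p i * phiX a j
      + phiX a i * p j) =
      (∑ i, v i * p i) * (∑ j, w j * phiX a j) + (∑ i, v i * phiX a i) * ∑ j, w j * p j := by
    intro v w p
    simp only [Finset.sum_mul_sum, ← Finset.sum_add_distrib]
    exact Finset.sum_congr rfl fun i _ => Finset.sum_congr rfl fun j _ => by ring
  have h := lamX_sum_of_pairs a (Ω := fun i j => iotaX g (potE a C i j))
    (fun i j => by rw [hΩ, hΩ]; ring) (by
      have h1 := hsum (fun _ => 1) (fun _ => 1) fun i => algebraMap ℂ (KX g) (C i / 2) / phiX a i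
      simp only [one_mul, sum_phiX, mul_zero, zero_mul, add_zero] at h1
      simp only [hΩ']
      rw [← map_sum, hC₀, map_zero, ← h1]
      simp only [hΩ]) (by
      have h1 := hsum (fun i => aK a i) (fun _ => 1)
        fun i => algebraMap ℂ (KX g) (C i / 2) / phiX a i
      simp only [one_mul, mul_one, sum_phiX, sum_a_mul_phiX, mul_zero, zero_mul, add_zero] at h1
      simp only [hΩ', ← map_mul]
      rw [← map_sum, hC₁, map_zero, ← h1]
      simp only [hΩ]) i
  rw [h]
  refine Finset.sum_congr rfl fun α _ => ?_
  congr 2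
  have h1 := hsum (fun i => (xv α - aK a i)⁻¹) (fun i => (xv α - aK a i)⁻¹)
    fun i => algebraMap ℂ (KX g) (C i / 2) / phiX a i
  simp only [← div_eq_inv_mul, sum_phiX_div, mul_zero, zero_mul, add_zero] at h1
  have h2 : ∑ i, ∑ j, iotaX g (potE a C i j) / ((xv α - aK a i) * (xv α - aK a j)) = 0 := by
    rw [← h1]
    refine Finset.sum_congr rfl fun i _ => Finset.sum_congr rfl fun j _ => ?_
    rw [hΩ, div_eq_inv_mul, mul_inv]
    ring
  have h3 : (∑ i, iotaX g (potE a C i i) / (xv α - aK a i) ^ 2) / 2 = potX a C α := by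
    rw [potX, Finset.sum_div]
    refine Finset.sum_congr rfl fun i _ => ?_
    rw [hΩ', map_div₀, map_ofNat, div_right_comm]
  rw [h2, ← h3]
  ring

/-- The coefficients `pE` in the variables `x₁, …, x_g`. -/
def pX (a : Fin (g + 3) ↪ ℂ) (l i : Fin (g + 3)) : KX g := iotaX g (pE a l i)

/-- Only the moments of `w` of order `0, 1, 2` enter: they are `0, 0, 1` for `w = φ` and all zero
for `w = φ / (x_α - a)`. -/
theorem sum_mul_pX (a : Fin (g + 3) ↪ ℂ) (w : Fin (g + 3) → KX g) (l : Fin (g + 3)) :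
    ∑ i, w i * pX a l i = w l + algebraMap ℂ (KX g) (cN a l 1) * (∑ i, w i * aK a i)
      - phiX a l * (algebraMap ℂ (KX g) (esymOn Finset.univ a 2) * (∑ i, w i)
        - algebraMap ℂ (KX g) (esymOn Finset.univ a 1) * (∑ i, w i * aK a i)
        + ∑ i, w i * aK a i ^ 2) := by
  have h : ∀ i, w i * pX a l i = (if l = i then w i else 0)
      + algebraMap ℂ (KX g) (cN a l 1) * (w i * aK a i)
      - phiX a l * (algebraMap ℂ (KX g) (esymOn Finset.univ a 2) * w i
        - algebraMap ℂ (KX g) (esymOn Finset.univ a 1) * (w i * aK a i) + w i * aK a i ^ 2) := by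
    intro i
    rw [pX, pE, map_sub, map_mul, AlgHom.commutes, AlgHom.commutes, esymA_two]
    simp only [map_sub, map_add, map_mul, map_pow, phiX]
    split_ifs
    · rw [map_one]; ring
    · rw [map_zero]; ring
  simp only [h, Finset.sum_add_distrib, Finset.sum_sub_distrib, ← Finset.mul_sum]
  simp

theorem sum_phiX_pX (a : Fin (g + 3) ↪ ℂ) (l : Fin (g + 3)) : ∑ i, phiX a i * pX a l i = 0 := by
  have h1 := sum_a_mul_phiX a
  have h2 := sum_a_sq_mul_phiX a
  simp only [mul_comm (aK a _), mul_comm (aK a _ ^ 2)] at h1 h2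
  rw [sum_mul_pX, sum_phiX, h1, h2]
  ring

theorem sum_phiX_div_pX (a : Fin (g + 3) ↪ ℂ) (l : Fin (g + 3)) (α : Fin g) :
    ∑ i, phiX a i / (xv α - aK a i) * pX a l i = dX α (phiX a l) := by
  rw [sum_mul_pX, sum_phiX_div, sum_a_mul_phiX_div, sum_a_sq_mul_phiX_div, dX_phiX]
  ring

/-- The diagonal vanishes and the double sums are polarized variances. The means of `pX` being `0`
for the weight `φ` and `∂φ_l/∂x_α` for the weight `φ / (x_α - a)`, only the product of the two
derivatives survives. -/
theorem kin_identity (a : Fin (g + 3) ↪ ℂ) (l m i : Fin (g + 3)) :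
    algebraMap ℂ (KX g) (∏ j ∈ Finset.univ.erase i, (a i - a j)) *
        ∑ j ∈ Finset.univ.erase i, algebraMap ℂ (KX g) (a i - a j)⁻¹ *
          (- (phiX a i * phiX a j * ((pX a l i - pX a l j) * (pX a m i - pX a m j)))) =
      ∑ α, lamX a i α * (piX a α * (dX α (phiX a l) * dX α (phiX a m))) := by
  rw [lamX_sum_of_pairs a
    (Ω := fun i j => - (phiX a i * phiX a j * ((pX a l i - pX a l j) * (pX a m i - pX a m j))))
    (fun i j => by ring) ?_ ?_ i]
  · refine Finset.sum_congr rfl fun α _ => ?_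
    congr 2
    have h := sum_pairs_mul (fun i => phiX a i / (xv α - aK a i))
      (fun i => phiX a i / (xv α - aK a i)) (pX a l) (pX a m)
    rw [sum_phiX_div_pX, sum_phiX_div_pX, sum_phiX_div] at h
    have h1 : ∑ i, ∑ j, - (phiX a i * phiX a j * ((pX a l i - pX a l j) * (pX a m i - pX a m j))) /
        ((xv α - aK a i) * (xv α - aK a j)) =
        - ∑ i, ∑ j, phiX a i / (xv α - aK a i) * (phiX a j / (xv α - aK a j)) *
          ((pX a l i - pX a l j) * (pX a m i - pX a m j)) := by
      simp only [← Finset.sum_neg_distrib]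
      refine Finset.sum_congr rfl fun i _ => Finset.sum_congr rfl fun j _ => ?_
      have := xv_sub_ne α (a i)
      have := xv_sub_ne α (a j)
      field_simp
    rw [h1, h]
    simp only [sub_self, zero_mul, mul_zero, neg_zero, zero_div, Finset.sum_const_zero]
    ring
  · have h := sum_pairs_mul (phiX a) (phiX a) (pX a l) (pX a m)
    rw [sum_phiX_pX, sum_phiX_pX, sum_phiX] at h
    simp only [Finset.sum_neg_distrib, h]
    simp
  · have h := sum_pairs_mul (fun i => aK a i * phiX a i) (phiX a) (pX a l) (pX a m)
    rw [sum_phiX_pX, sum_phiX_pX, sum_phiX, sum_a_mul_phiX] at h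
    simp only [mul_neg, Finset.sum_neg_distrib, ← mul_assoc] at h ⊢
    rw [h]
    simp

theorem tauX_hitchW (a : Fin (g + 3) ↪ ℂ) (C : Fin (g + 3) → ℂ)
    (hC₀ : ∑ i, C i = 0) (hC₁ : ∑ i, a i * C i = 0) (i : Fin (g + 3)) :
    (∏ j ∈ Finset.univ.erase i, (a i - a j)) • tauX a (hitchW a C i) =
      ∑ α, ofX a (lamX a i α) * That a C α := by
  -- The right side is lifted to `W0`, where the criterion `W0_eq_zero` applies.
  obtain ⟨w', hw'⟩ := psiX_surjective a
    (∑ k ∈ Finset.range g, ((-1) ^ k * a i ^ k : ℂ) • HBM a C (k + 1))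
  have hw : tauX a w' = ∑ α, ofX a (lamX a i α) * That a C α := by
    rw [← psiX_coe, hw', sum_HBM]
  have hz : (∏ j ∈ Finset.univ.erase i, (a i - a j)) • hitchW a C i - w' = 0 := by
    apply W0_eq_zero a
    · intro l m
      rw [map_sub, map_smul, hw, map_sub, map_sub, map_smul, map_smul, sub_eq_zero]
      have e1 : adOp (ofX a (phiX a m)) (adOp (ofX a (phiX a l)) (tauX a (hitchW a C i))) =
          tauX a (adOp (ofW (phiE a m)) (adOp (ofW (phiE a l)) (hitchW a C i))) := by
        simp only [adOp_apply, map_sub, map_mul, tauX_ofW]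
        rfl
      rw [e1, hitchW]
      simp only [map_sum, map_smul, adOp_adOp_pairW, adOp_mul_of, adOp_adOp_That, tauX_ofW]
      simp only [← map_smul, ← map_mul, ← map_sum]
      congr 1
      -- The factor `2` is the one of the double commutator with a square.
      have h := congrArg (fun z => z * 2) (kin_identity a l m i)
      simp only [Finset.sum_mul, Finset.mul_sum] at h
      simp only [Algebra.smul_def, Finset.mul_sum, dVW_phiE]
      refine Eq.trans (Finset.sum_congr rfl fun j _ => ?_)
        (h.trans (Finset.sum_congr rfl fun α _ => ?_))
      · simp only [map_mul, map_neg, map_sub, map_ofNat, pX, phiX]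
        ring
      · ring
    · intro l
      rw [map_sub, map_smul, hw, map_sub, map_smul, LinearMap.sub_apply, LinearMap.smul_apply,
        sub_eq_zero, hitchW]
      simp only [map_sum, map_smul, LinearMap.sum_apply, LinearMap.smul_apply, actX_pairW, map_mul,
        Module.End.mul_apply, actX_That, actX_ofX]
      have h := congrArg (fun z => z * phiX a l) (pot_identity a C hC₀ hC₁ i)
      simp only [Finset.sum_mul, Finset.mul_sum] at h
      simp only [Algebra.smul_def, Finset.mul_sum]
      refine Eq.trans (Finset.sum_congr rfl fun j _ => ?_)
        (h.trans (Finset.sum_congr rfl fun α _ => ?_))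
      · ring
      · ring
  rw [← hw, ← map_smul, sub_eq_zero.mp hz]

theorem psiX_hitchW (a : Fin (g + 3) ↪ ℂ) (C : Fin (g + 3) → ℂ)
    (hC₀ : ∑ i, C i = 0) (hC₁ : ∑ i, a i * C i = 0) (i : Fin (g + 3)) :
    psiX a (hitchW a C i) = (∏ j ∈ Finset.univ.erase i, (a i - a j))⁻¹ •
      ∑ k ∈ Finset.range g, ((-1) ^ k * a i ^ k : ℂ) • HBM a C (k + 1) := by
  rw [eq_inv_smul_iff₀ (prod_erase_ne_zero a.injective i)]
  apply Subtype.ext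
  rw [sum_HBM, ← tauX_hitchW a C hC₀ hC₁ i]
  rfl

/-! ### Residues at infinity -/

section Residue

variable {F F' : Type} [Field F'] [Field F]

/-- The map on Laurent series given by a homomorphism of coefficient fields. -/
def mapLaurent (f : F →+* F') : LaurentSeries F →+* LaurentSeries F' where
  toFun x := HahnSeries.map x f
  map_zero' := by ext n; simp
  map_one' := by
    ext n
    rw [HahnSeries.map_coeff, HahnSeries.coeff_one, HahnSeries.coeff_one]
    split_ifs <;> simp
  map_add' x y := by ext n; simp
  map_mul' x y := by
    ext n
    rw [HahnSeries.map_coeff, HahnSeries.coeff_mul, HahnSeries.coeff_mul, map_sum]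
    refine Finset.sum_congr ?_ fun ij _ => by simp
    ext ij
    simp [HahnSeries.mem_support]

theorem coeff_mapLaurent (f : F →+* F') (x : LaurentSeries F) (n : ℤ) :
    (mapLaurent f x).coeff n = f (x.coeff n) := rfl

theorem mapLaurent_C (f : F →+* F') (c : F) :
    mapLaurent f (HahnSeries.C c) = HahnSeries.C (f c) := HahnSeries.map_C c f

theorem mapLaurent_atInfty (f : F →+* F') (P : Polynomial F) :
    mapLaurent f (atInfty F P) = atInfty F' (P.map f) := by
  have : (mapLaurent f).comp (atInfty F) = (atInfty F').comp (Polynomial.mapRingHom f) := by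
    refine Polynomial.ringHom_ext' ?_ ?_
    · refine RingHom.ext fun c => ?_
      simp only [RingHom.comp_apply, atInfty, Polynomial.coe_eval₂RingHom, Polynomial.eval₂_C,
        Polynomial.coe_mapRingHom, Polynomial.map_C, mapLaurent_C]
    · simp only [RingHom.comp_apply, atInfty, Polynomial.coe_eval₂RingHom, Polynomial.eval₂_X,
        Polynomial.coe_mapRingHom, Polynomial.map_X]
      ext n
      rw [coeff_mapLaurent, HahnSeries.coeff_single, HahnSeries.coeff_single]
      split_ifs <;> simp
  exact congrArg (fun h : Polynomial F →+* LaurentSeries F' => h P) this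

/-- Allows the residue to be computed after embedding in a field where the polynomial splits. -/
theorem map_resInfty (f : F →+* F') (P φ : Polynomial F) (b : F) :
    f (resInfty P φ b) = resInfty (P.map f) (φ.map f) (f b) := by
  rw [resInfty, resInfty, map_neg, ← coeff_mapLaurent]
  simp only [map_mul, map_div₀, map_sub, mapLaurent_atInfty, mapLaurent_C,
    Polynomial.map_X, Polynomial.map_C, Polynomial.derivative_map, Polynomial.eval_map,
    Polynomial.eval₂_at_apply]

theorem atInfty_C (c : F) : atInfty F (Polynomial.C c) = HahnSeries.C c := by
  simp [atInfty]

theorem resInfty_C_mul {c : F} (hc : c ≠ 0) (P φ : Polynomial F) (b : F) :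
    resInfty (Polynomial.C c * P) φ b = resInfty P φ b := by
  have h : (HahnSeries.C c : LaurentSeries F) ≠ 0 := HahnSeries.C_ne_zero hc
  rw [resInfty, resInfty, Polynomial.derivative_C_mul, map_mul, map_mul, atInfty_C,
    mul_div_mul_left _ _ h, Polynomial.eval_mul, Polynomial.eval_mul, Polynomial.eval_C,
    mul_div_mul_left _ _ hc]

/-- The expansion of `(t - x)⁻¹` at infinity. -/
def geomInfty (x : F) : LaurentSeries F :=
  HahnSeries.single (1 : ℤ) (1 : F) * HahnSeries.ofPowerSeries ℤ F (PowerSeries.mk fun n => x ^ n)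

theorem atInfty_mul_geomInfty (x : F) :
    atInfty F (Polynomial.X - Polynomial.C x) * geomInfty x = 1 := by
  have h : (PowerSeries.mk fun n => x ^ n) * (1 - PowerSeries.C x * PowerSeries.X) = 1 := by
    ext n
    cases n with
    | zero => simp [mul_sub, ← mul_assoc]
    | succ n =>
      rw [mul_sub, mul_one, ← mul_assoc, map_sub, PowerSeries.coeff_succ_mul_X, mul_comm,
        PowerSeries.coeff_C_mul, PowerSeries.coeff_mk, PowerSeries.coeff_mk,
        PowerSeries.coeff_one, if_neg (by omega), pow_succ]
      ring
  have h2 := congrArg (HahnSeries.ofPowerSeries ℤ F) h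
  rw [map_mul, map_sub, map_mul, map_one, HahnSeries.ofPowerSeries_C,
    HahnSeries.ofPowerSeries_X] at h2
  have h3 : atInfty F (Polynomial.X - Polynomial.C x) =
      HahnSeries.single (-1 : ℤ) (1 : F) - HahnSeries.C x := by
    simp [atInfty]
  have h4 : HahnSeries.single (-1 : ℤ) (1 : F) * HahnSeries.single (1 : ℤ) (1 : F) = 1 := by
    rw [HahnSeries.single_mul_single]
    simp
  rw [h3, geomInfty, ← h2]
  linear_combination (HahnSeries.ofPowerSeries ℤ F (PowerSeries.mk fun n => x ^ n)) * h4

theorem coeff_geomInfty (x : F) : (geomInfty x).coeff 1 = 1 := by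
  have h := HahnSeries.coeff_single_mul_add (r := (1 : F)) (a := (0 : ℤ)) (b := (1 : ℤ))
    (x := HahnSeries.ofPowerSeries ℤ F (PowerSeries.mk fun n => x ^ n))
  have h0 := HahnSeries.ofPowerSeries_apply_coeff (Γ := ℤ) (PowerSeries.mk fun n => x ^ n) 0
  rw [zero_add] at h
  rw [geomInfty, h, one_mul]
  simpa using h0

theorem coeff_atInfty (P : Polynomial F) : (atInfty F P).coeff (1 : ℤ) = 0 := by
  induction P using Polynomial.induction_on' with
  | add p q hp hq => rw [map_add, HahnSeries.coeff_add, hp, hq, add_zero]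
  | monomial n c =>
    rw [atInfty, Polynomial.coe_eval₂RingHom, Polynomial.eval₂_monomial, HahnSeries.single_pow,
      HahnSeries.C_mul_eq_smul, HahnSeries.coeff_smul, HahnSeries.coeff_single, if_neg, smul_zero]
    simp
    omega

/-- Write `φ = (t - x) ψ + φ(x)`: the polynomial `ψ` has no term in `t⁻¹`, and `(t - x)⁻¹` begins
with `t⁻¹`. -/
theorem coeff_geomInfty_mul (x : F) (φ : Polynomial F) :
    (geomInfty x * atInfty F φ).coeff 1 = φ.eval x := by
  obtain ⟨ψ, hψ⟩ : Polynomial.X - Polynomial.C x ∣ φ - Polynomial.C (φ.eval x) :=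
    Polynomial.X_sub_C_dvd_sub_C_eval
  have h : geomInfty x * atInfty F φ = atInfty F ψ + HahnSeries.C (φ.eval x) * geomInfty x := by
    have h1 := congrArg (atInfty F) hψ
    rw [map_sub, map_mul, atInfty_C] at h1
    linear_combination geomInfty x * h1 + atInfty F ψ * atInfty_mul_geomInfty x
  rw [h, HahnSeries.coeff_add, coeff_atInfty, zero_add, HahnSeries.C_mul_eq_smul,
    HahnSeries.coeff_smul, coeff_geomInfty, smul_eq_mul, mul_one]

theorem atInfty_ne_zero (x : F) : atInfty F (Polynomial.X - Polynomial.C x) ≠ 0 :=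
  left_ne_zero_of_mul_eq_one (atInfty_mul_geomInfty x)

theorem geomInfty_eq (x : F) : geomInfty x = (atInfty F (Polynomial.X - Polynomial.C x))⁻¹ :=
  eq_inv_of_mul_eq_one_right (atInfty_mul_geomInfty x)

theorem derivative_div_prod {ι : Type*} [Fintype ι] [DecidableEq ι] {E : Type*} [Field E]
    (x : ι → F) (f : Polynomial F →+* E)
    (h : ∀ i, f (Polynomial.X - Polynomial.C (x i)) ≠ 0) :
    f (Polynomial.derivative (∏ i, (Polynomial.X - Polynomial.C (x i)))) /
      f (∏ i, (Polynomial.X - Polynomial.C (x i))) =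
      ∑ i, (f (Polynomial.X - Polynomial.C (x i)))⁻¹ := by
  rw [Polynomial.derivative_prod_finset, map_sum, Finset.sum_div]
  refine Finset.sum_congr rfl fun i _ => ?_
  rw [← Finset.mul_prod_erase _ _ (Finset.mem_univ i), Polynomial.derivative_X_sub_C, mul_one,
    map_mul]
  have h2 : f (∏ j ∈ Finset.univ.erase i, (Polynomial.X - Polynomial.C (x j))) ≠ 0 := by
    rw [map_prod]
    exact Finset.prod_ne_zero_iff.mpr fun j _ => h j
  have := h i
  field_simp

/-- By partial fractions `P'/P = ∑ (t - xᵢ)⁻¹`, and `((t - xᵢ)⁻¹ - (b - xᵢ)⁻¹) / (t - b) = -((b -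
xᵢ)(t - xᵢ))⁻¹`; so the residue at infinity is a sum over the roots. -/
theorem resInfty_prod {n : ℕ} (x : Fin n → F) (φ : Polynomial F) {b : F}
    (hb : ∀ i, b - x i ≠ 0) :
    resInfty (∏ i, (Polynomial.X - Polynomial.C (x i))) φ b = ∑ i, φ.eval (x i) / (b - x i) := by
  have h1 := derivative_div_prod x (atInfty F) fun i => atInfty_ne_zero (x i)
  have h2 := derivative_div_prod x (Polynomial.evalRingHom b) fun i => by simpa using hb i
  simp only [Polynomial.coe_evalRingHom, Polynomial.eval_sub, Polynomial.eval_X,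
    Polynomial.eval_C] at h2
  rw [resInfty, h1, h2, map_sum, ← Finset.sum_sub_distrib]
  have h3 : ∀ i, (atInfty F (Polynomial.X - Polynomial.C (x i)))⁻¹ -
      HahnSeries.C (b - x i)⁻¹ = atInfty F (Polynomial.X - Polynomial.C b) *
        (- HahnSeries.C (b - x i)⁻¹ * geomInfty (x i)) := by
    intro i
    have e1 := atInfty_mul_geomInfty (x i)
    have e2 : (HahnSeries.C (b - x i)⁻¹ : LaurentSeries F) * HahnSeries.C (b - x i) = 1 := by
      rw [← map_mul, inv_mul_cancel₀ (hb i), map_one]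
    have e3 : atInfty F (Polynomial.X - Polynomial.C b) =
        atInfty F (Polynomial.X - Polynomial.C (x i)) - HahnSeries.C (b - x i) := by
      rw [← atInfty_C, ← map_sub]
      congr 1
      rw [map_sub]
      ring
    rw [← geomInfty_eq, e3]
    linear_combination - geomInfty (x i) * e2 + HahnSeries.C (b - x i)⁻¹ * e1
  simp only [h3]
  rw [← Finset.mul_sum, mul_div_cancel_left₀ _ (atInfty_ne_zero b), Finset.sum_mul,
    HahnSeries.coeff_sum, ← Finset.sum_neg_distrib]
  refine Finset.sum_congr rfl fun i _ => ?_
  rw [neg_mul, neg_mul, HahnSeries.coeff_neg, neg_neg, mul_assoc, HahnSeries.C_mul_eq_smul,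
    HahnSeries.coeff_smul, coeff_geomInfty_mul, smul_eq_mul, div_eq_inv_mul]

end Residue

/-! ### The vector fields `Ŷ[φ]` and `Ŵ[φ]` -/

theorem permK_esymOn_erase (s : Equiv.Perm (Fin g)) (α : Fin g) (m : ℕ) :
    permK s (esymOn (Finset.univ.erase α) xv m) = esymOn (Finset.univ.erase (s α)) xv m := by
  have he : (Finset.univ.erase (s α)) = (Finset.univ.erase α).map s.toEmbedding := by
    rw [Finset.map_erase, Finset.map_univ_equiv]
    rfl
  rw [esymOn, esymOn, he, Finset.powersetCard_map, Finset.sum_map]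
  simp [permK_xv, Finset.prod_map]

/-- The coefficient of `∂/∂e_{k+1}` in `Ŷ[φ]`, as a function of `x₁, …, x_g`. -/
def RX (φ : Polynomial ℂ) (k : Fin g) : KX g :=
  2 * ∑ α, Polynomial.aeval (xv α) φ * dX α (eX g (k + 1))

theorem exists_rcoef (φ : Polynomial ℂ) (k : Fin g) : ∃ r, iotaX g r = RX φ k := by
  refine exists_iotaX_eq fun s => ?_
  rw [RX, map_mul, map_ofNat, map_sum]
  congr 1
  rw [← Equiv.sum_comp s fun α => Polynomial.aeval (xv α) φ * dX α (eX g (k + 1))]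
  refine Finset.sum_congr rfl fun α _ => ?_
  rw [map_mul, permK_aeval, dX_eX, dX_eX, permK_esymOn_erase]

/-- The coefficient of `∂/∂e_{k+1}` in `Ŷ[φ]`. -/
def rcoef (φ : Polynomial ℂ) (k : Fin g) : KX g := (exists_rcoef φ k).choose

theorem iotaX_rcoef (φ : Polynomial ℂ) (k : Fin g) : iotaX g (rcoef φ k) = RX φ k :=
  (exists_rcoef φ k).choose_spec

/-- `Ŷ[φ]` in the coordinates `e₁, …, e_g`. -/
def yphi (g : ℕ) (φ : Polynomial ℂ) : W0 g := ∑ k : Fin g, ofW (rcoef φ k) * yW k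

theorem psiX_yphi (a : Fin (g + 3) ↪ ℂ) (φ : Polynomial ℂ) : psiX a (yphi g φ) = Yhat a φ := by
  apply Subtype.ext
  change tauX a (yphi g φ) =
    ∑ α, ofX a (Polynomial.aeval (xv α) φ / Polynomial.aeval (xv α) (PiPoly a)) * yv a α
  have h : ∀ α, ofX a (Polynomial.aeval (xv α) φ / Polynomial.aeval (xv α) (PiPoly a)) * yv a α =
      ∑ k : Fin g, ofX a (2 * (Polynomial.aeval (xv α) φ * dX α (eX g (k + 1)))) * Dhat a k := by
    intro α
    rw [yv_eq, ← mul_assoc, ← map_mul, dhat_eq, Finset.mul_sum]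
    refine Finset.sum_congr rfl fun k _ => ?_
    rw [← mul_assoc, ← map_mul]
    congr 2
    have hp : Polynomial.aeval (xv α) (PiPoly a) ≠ 0 := piX_ne_zero a α
    rw [twoPi]
    field_simp
  rw [Finset.sum_congr rfl fun α _ => h α, Finset.sum_comm, yphi, map_sum]
  refine Finset.sum_congr rfl fun k _ => ?_
  rw [map_mul, tauX_ofW, tauX_yW, iotaX_rcoef, ← Finset.sum_mul, ← map_sum, RX, Finset.mul_sum]

/-- The coefficient of `fᵢ*` in `Ŵ[φ]`. -/
def uW (a : Fin (g + 3) ↪ ℂ) (φ : Polynomial ℂ) (i : Fin (g + 3)) : OU a :=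
  ∑ k : Fin g, cN a i k.succ.succ.succ • (rho a (rcoef φ k) * eps a 2)

/-- The coefficient of `hᵢ` in `Ŵ[φ]`. -/
def cW (a : Fin (g + 3) ↪ ℂ) (φ : Polynomial ℂ) (i : Fin (g + 3)) : OU a :=
  (-1 / 2 : ℂ) • (uW a φ i * fInv a i)

theorem cW_mul_fv (a : Fin (g + 3) ↪ ℂ) (φ : Polynomial ℂ) (i : Fin (g + 3)) :
    cW a φ i * fv a i = (-1 / 2 : ℂ) • uW a φ i := by
  rw [cW, smul_mul_assoc, mul_assoc, mul_comm (fInv a i), fv_mul_fInv, mul_one]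

/-- The field `∑ uᵢ fᵢ*` is a combination of the `∂/∂ε_m` with `m ≥ 3`, so it kills `ε₀`, `ε₁`,
`ε₂`. -/
theorem sum_esymA_mul_uW (a : Fin (g + 3) ↪ ℂ) (φ : Polynomial ℂ) {m : Fin (g + 3)}
    (hm : ∀ k : Fin g, m ≠ k.succ.succ.succ) : ∑ i, esymA a m i • uW a φ i = 0 := by
  simp only [uW, Finset.smul_sum, smul_smul]
  rw [Finset.sum_comm]
  refine Finset.sum_eq_zero fun k _ => ?_
  rw [← Finset.sum_smul, sum_esymA_mul_cN, if_neg (hm k), zero_smul]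

theorem sum_uW (a : Fin (g + 3) ↪ ℂ) (φ : Polynomial ℂ) : ∑ i, uW a φ i = 0 := by
  have h := sum_esymA_mul_uW a φ fin_zero_ne_succ
  simpa [esymA_zero] using h

theorem sum_a_mul_uW (a : Fin (g + 3) ↪ ℂ) (φ : Polynomial ℂ) : ∑ i, a i • uW a φ i = 0 := by
  have h := sum_esymA_mul_uW a φ fin_one_ne_succ
  rw [Fin.val_one] at h
  have e : ∀ i, a i • uW a φ i = esymOn Finset.univ a 1 • uW a φ i - esymA a 1 i • uW a φ i := by
    intro i
    rw [esymA_one]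
    simp only [Algebra.smul_def, map_sub]
    ring
  rw [Finset.sum_congr rfl fun i _ => e i, Finset.sum_sub_distrib, h, ← Finset.smul_sum, sum_uW,
    smul_zero, sub_zero]

theorem sum_ofU_mul_hv (a : Fin (g + 3) ↪ ℂ) (c : Fin (g + 3) → OU a) :
    ∑ i, ofU a (c i) * hv a i = (-2 : ℂ) • ∑ i, ofU a (c i * fv a i) * yU a i := by
  rw [Finset.smul_sum]
  refine Finset.sum_congr rfl fun i _ => ?_
  rw [hv, mul_smul_comm, ← mul_assoc, ← map_mul]

theorem sum_cW_hv (a : Fin (g + 3) ↪ ℂ) (φ : Polynomial ℂ) :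
    ∑ i, ofU a (cW a φ i) * hv a i = tauU a (yphi g φ) := by
  rw [sum_ofU_mul_hv]
  simp only [cW_mul_fv, map_smul, smul_mul_assoc, ← Finset.smul_sum]
  rw [smul_smul, show (-2 : ℂ) * (-1 / 2) = 1 by norm_num, one_smul, yphi, map_sum]
  simp only [uW, map_sum, map_smul, Finset.sum_mul, smul_mul_assoc]
  rw [Finset.sum_comm]
  refine Finset.sum_congr rfl fun k _ => ?_
  rw [map_mul (tauU a), tauU_ofW, tauU_yW, DkU, theta, Finset.mul_sum, Finset.mul_sum]
  refine Finset.sum_congr rfl fun i _ => ?_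
  rw [mul_smul_comm, mul_smul_comm, map_mul, mul_assoc]

instance (a : Fin (g + 3) ↪ ℂ) : IsLocalHom (eta a : OU a →+* KS g) where
  map_nonunit _ h := isUnit_of_eta_ne_zero h.ne_zero

/-- The embedding of the residue field. -/
def etaF (a : Fin (g + 3) ↪ ℂ) : FU a →+* KS g := IsLocalRing.ResidueField.lift (eta a : OU a →+* KS g)

theorem etaF_residue (a : Fin (g + 3) ↪ ℂ) (r : OU a) :
    etaF a (IsLocalRing.residue (OU a) r) = eta a r := rfl

theorem etaF_algebraMap (a : Fin (g + 3) ↪ ℂ) (c : ℂ) :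
    etaF a (algebraMap ℂ (FU a) c) = constS g (algebraMap ℂ (KX g) c) := by
  have : algebraMap ℂ (FU a) c = IsLocalRing.residue (OU a) (algebraMap ℂ (OU a) c) := rfl
  rw [this, etaF_residue, AlgHom.commutes, AlgHom.commutes]

/-- `P_f` normalized by `∑ aᵢ² fᵢ = 1`. -/
def QE (a : Fin (g + 3) ↪ ℂ) : Polynomial (KX g) :=
  ∑ i, Polynomial.C (phiE a i) * ∏ j ∈ Finset.univ.erase i, (Polynomial.X - Polynomial.C (aK a j))

/-- The scalar `s` cancels in the logarithmic derivative, so the residues are functions of the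
`e_k`. -/
theorem map_Pf (a : Fin (g + 3) ↪ ℂ) :
    (Pf a).map (etaF a) = Polynomial.C (sS g) * (QE a).map (constS g : KX g →+* KS g) := by
  simp only [Pf, QE, Polynomial.map_sum, Polynomial.map_mul, Polynomial.map_prod,
    Polynomial.map_sub, Polynomial.map_X, Polynomial.map_C, etaF_residue, eta_fv, etaF_algebraMap,
    Finset.mul_sum, RingHom.coe_coe]
  refine Finset.sum_congr rfl fun i _ => ?_
  rw [← mul_assoc, ← Polynomial.C_mul, mul_comm (sS g)]

theorem map_QE (a : Fin (g + 3) ↪ ℂ) :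
    (QE a).map (iotaX g : KX g →+* KX g) = ∏ α, (Polynomial.X - Polynomial.C (xv α)) := by
  have h1 : (QE a).map (iotaX g : KX g →+* KX g) = ∑ i, Polynomial.C (phiX a i) *
      ∏ j ∈ Finset.univ.erase i, (Polynomial.X - Polynomial.C (aK a j)) := by
    simp only [QE, Polynomial.map_sum, Polynomial.map_mul, Polynomial.map_prod,
      Polynomial.map_sub, Polynomial.map_X, Polynomial.map_C, RingHom.coe_coe, AlgHom.commutes]
    rfl
  have : Infinite (KX g) := Infinite.of_injective _ (algebraMap ℂ (KX g)).injective
  rw [h1]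
  refine Polynomial.funext fun y => ?_
  simp only [Polynomial.eval_finsetSum, Polynomial.eval_mul, Polynomial.eval_prod,
    Polynomial.eval_sub, Polynomial.eval_X, Polynomial.eval_C]
  exact sum_phiX_prod a y

theorem etaF_resCoeff (a : Fin (g + 3) ↪ ℂ) (φ : Polynomial ℂ) (i : Fin (g + 3)) :
    etaF a (resCoeff a φ i) =
      constS g (resInfty (QE a) (φ.map (algebraMap ℂ (KX g))) (aK a i)) := by
  have h := map_resInfty (constS g : KX g →+* KS g) (QE a) (φ.map (algebraMap ℂ (KX g))) (aK a i)
  rw [RingHom.coe_coe] at h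
  rw [h, resCoeff, map_resInfty, map_Pf, resInfty_C_mul (sS_ne_zero (g := g)), etaF_algebraMap,
    Polynomial.map_map, Polynomial.map_map]
  congr 2
  exact RingHom.ext fun c => etaF_algebraMap a c

theorem resInfty_QE (a : Fin (g + 3) ↪ ℂ) (φ : Polynomial ℂ) (i : Fin (g + 3)) :
    iotaX g (resInfty (QE a) (φ.map (algebraMap ℂ (KX g))) (aK a i)) =
      ∑ α, Polynomial.aeval (xv α) φ / (aK a i - xv α) := by
  have h := map_resInfty (iotaX g : KX g →+* KX g) (QE a) (φ.map (algebraMap ℂ (KX g))) (aK a i)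
  rw [RingHom.coe_coe] at h
  rw [h, map_QE, AlgHom.commutes, Polynomial.map_map, resInfty_prod _ _ fun α => by
    rw [← neg_sub, neg_ne_zero]
    exact xv_sub_ne α (a i)]
  refine Finset.sum_congr rfl fun α _ => ?_
  rw [show (iotaX g : KX g →+* KX g).comp (algebraMap ℂ (KX g)) = algebraMap ℂ (KX g) from
    RingHom.ext fun c => (iotaX g).commutes c, Polynomial.eval_map, Polynomial.aeval_def]

/-- Both sides are `∑_α φ(x_α) / (aᵢ - x_α)`: on one side as `-½ (Ŷ[φ] φᵢ) / φᵢ`, with `Ŷ[φ] = 2 ∑_α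
φ(x_α) ∂/∂x_α`; on the other as the sum over the roots of `P_f`. -/
theorem residue_cW (a : Fin (g + 3) ↪ ℂ) (φ : Polynomial ℂ) (i : Fin (g + 3)) :
    IsLocalRing.residue (OU a) (cW a φ i) = resCoeff a φ i := by
  apply (etaF a).injective
  have hφ : constS g (phiE a i) ≠ 0 := (map_ne_zero_iff _ constS_injective).mpr (phiE_ne_zero a i)
  have hs := sS_ne_zero (g := g)
  have h1 : eta a (cW a φ i) = constS g (algebraMap ℂ (KX g) (-1 / 2) *
      ((∑ k : Fin g, algebraMap ℂ (KX g) (cN a i k.succ.succ.succ) * rcoef φ k) / phiE a i)) := by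
    simp only [cW, uW, map_mul, map_sum, map_div₀, eta_rho, eta_eps_two, eta_fInv,
      Algebra.smul_def, AlgHom.commutes, ← mul_assoc, ← Finset.sum_mul]
    field_simp
  rw [etaF_residue, etaF_resCoeff, h1]
  congr 1
  apply (iotaX g).toRingHom.injective
  change iotaX g _ = iotaX g _
  rw [resInfty_QE]
  simp only [map_mul, map_div₀, map_sum, AlgHom.commutes, iotaX_rcoef, RX]
  have h2 : ∀ α, ∑ k : Fin g, algebraMap ℂ (KX g) (cN a i k.succ.succ.succ) *
      dX α (eX g (k + 1)) = dX α (phiX a i) := by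
    intro α
    rw [phiX, phiE, map_add, map_sum, map_add, AlgHom.commutes, dX_algebraMap, zero_add, map_sum]
    refine Finset.sum_congr rfl fun k _ => ?_
    rw [map_mul, AlgHom.commutes, iotaX_xv, Derivation.leibniz, dX_algebraMap, smul_zero, add_zero,
      smul_eq_mul]
  have h3 : ∑ k : Fin g, algebraMap ℂ (KX g) (cN a i k.succ.succ.succ) *
      (2 * ∑ α, Polynomial.aeval (xv α) φ * dX α (eX g (k + 1))) =
      2 * ∑ α, Polynomial.aeval (xv α) φ * (phiX a i / (xv α - aK a i)) := by
    simp only [← dX_phiX, ← h2, Finset.mul_sum]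
    rw [Finset.sum_comm]
    exact Finset.sum_congr rfl fun α _ => Finset.sum_congr rfl fun k _ => by ring
  rw [h3, Finset.mul_sum, Finset.sum_div, Finset.mul_sum]
  refine Finset.sum_congr rfl fun α _ => ?_
  have e1 := xv_sub_ne α (a i)
  have e2 : aK a i - xv α ≠ 0 := by
    rw [← neg_sub, neg_ne_zero]
    exact e1
  have e3 := phiX_ne_zero a i
  have e4 : iotaX g (phiE a i) = phiX a i := rfl
  rw [e4, map_neg, map_ofNat, map_one]
  field_simp
  ring

/-- Independence of the lifts. The two linear conditions remove `θ₀` and `θ₁`; the remaining `θ_m`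
commute with `ε₀` and `ε₁`, so coefficients vanishing on the subspace put the operator in `Î`. -/
theorem sum_hv_mem_of_eta (a : Fin (g + 3) ↪ ℂ) {d : Fin (g + 3) → OU a}
    (hd : ∀ i, eta a (d i) = 0) (h0 : ∑ i, d i * fv a i = 0)
    (h1 : ∑ i, a i • (d i * fv a i) = 0) : ∑ i, ofU a (d i) * hv a i ∈ IHat a := by
  rw [sum_ofU_mul_hv]
  refine smul_mem_IHat _ ?_
  have e : ∑ i, ofU a (d i * fv a i) * yU a i =
      ∑ m : Fin (g + 3), ofU a (∑ i, esymA a m i • (d i * fv a i)) * theta a m := by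
    simp only [yU_eq_sum_theta, Finset.mul_sum, map_sum, Finset.sum_mul, map_smul, mul_smul_comm,
      smul_mul_assoc]
    rw [Finset.sum_comm]
  have e0 : ∑ i, esymA a 0 i • (d i * fv a i) = 0 := by simpa [esymA_zero] using h0
  have e1 : ∑ i, esymA a 1 i • (d i * fv a i) = 0 := by
    have : ∀ i, esymA a 1 i • (d i * fv a i) =
        esymOn Finset.univ a 1 • (d i * fv a i) - a i • (d i * fv a i) := by
      intro i
      rw [esymA_one]
      simp only [Algebra.smul_def, map_sub]
      ring
    rw [Finset.sum_congr rfl fun i _ => this i, Finset.sum_sub_distrib, ← Finset.smul_sum, h0, h1,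
      smul_zero, sub_zero]
  have hη : ∀ m : ℕ, eta a (∑ i, esymA a m i • (d i * fv a i)) = 0 := by
    intro m
    rw [map_sum]
    refine Finset.sum_eq_zero fun i _ => ?_
    rw [map_smul, map_mul, hd, zero_mul, smul_zero]
  rw [e, sum_fin_three, Fin.val_zero, Fin.val_one, e0, e1, map_zero, zero_mul, zero_mul, zero_add,
    zero_add]
  refine Ideal.add_mem _ ?_ (Submodule.sum_mem _ fun k _ => ?_)
  · exact ofU_mul_mem_of_eta (hη _) (theta_mul_eps_zero a fin_zero_ne_two)
      (theta_mul_eps_one a fin_one_ne_two)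
  · exact ofU_mul_mem_of_eta (hη _) (theta_mul_eps_zero a (fin_zero_ne_succ k))
      (theta_mul_eps_one a (fin_one_ne_succ k))

theorem isWhat_psiU (a : Fin (g + 3) ↪ ℂ) (φ : Polynomial ℂ) :
    IsWhat a φ (psiU a (yphi g φ)) := by
  refine ⟨cW a φ, residue_cW a φ, ?_, ?_, ?_⟩
  · simp only [cW_mul_fv]
    rw [← Finset.smul_sum, sum_uW, smul_zero]
  · simp only [cW_mul_fv, smul_comm (a _)]
    rw [← Finset.smul_sum, sum_a_mul_uW, smul_zero]
  · rw [sum_cW_hv]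
    exact ⟨tauU_mem a _, rfl⟩

theorem IsWhat.eq {a : Fin (g + 3) ↪ ℂ} {φ : Polynomial ℂ} {w : AU a} (h : IsWhat a φ w) :
    w = psiU a (yphi g φ) := by
  obtain ⟨c, hc, h0, h1, hu, rfl⟩ := h
  rw [psiU_apply, cls_eq_cls_iff, ← sum_cW_hv, ← Finset.sum_sub_distrib]
  have e : ∀ i, ofU a (c i) * hv a i - ofU a (cW a φ i) * hv a i =
      ofU a (c i - cW a φ i) * hv a i := fun i => by rw [map_sub, sub_mul]
  rw [Finset.sum_congr rfl fun i _ => e i]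
  refine sum_hv_mem_of_eta a (fun i => ?_) ?_ ?_
  · rw [map_sub, sub_eq_zero, ← residue_eq_iff_eta, hc, residue_cW]
  · simp only [sub_mul, Finset.sum_sub_distrib, h0, cW_mul_fv, ← Finset.smul_sum, sum_uW,
      smul_zero, sub_zero]
  · simp only [sub_mul, smul_sub, Finset.sum_sub_distrib, h1, cW_mul_fv, smul_comm (a _),
      ← Finset.smul_sum, sum_a_mul_uW, smul_zero, sub_zero]

/-! ### The isomorphism `Λ̂` -/

/-- The isomorphism `Λ̂`. -/
def lambdaHat (a : Fin (g + 3) ↪ ℂ) : AX a ≃ₐ[ℂ] AU a := (equivX a).symm.trans (equivU a)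

theorem lambdaHat_psiX (a : Fin (g + 3) ↪ ℂ) (w : W0 g) : lambdaHat a (psiX a w) = psiU a w := by
  change equivU a ((equivX a).symm (equivX a w)) = psiU a w
  rw [AlgEquiv.symm_apply_apply]
  rfl

theorem psiX_ofW_xv (a : Fin (g + 3) ↪ ℂ) (k : Fin g) :
    psiX a (ofW (xv k)) = esymX a (k + 1) := by
  apply Subtype.ext
  change tauX a (ofW (xv k)) = ofX a _
  rw [tauX_ofW, iotaX_xv, eX_eq]

theorem eta_sv (a : Fin (g + 3) ↪ ℂ) : eta a (sv a) = sS g := by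
  have h := eta_eps_two a
  have h0 := eta_eps_zero a
  have h1 := eta_eps_one a
  rw [eps_zero] at h0
  rw [eps_one, map_sub, map_smul, h0, smul_zero, zero_sub, neg_eq_zero] at h1
  rwa [eps_two, map_add, map_sub, map_smul, map_smul, h0, h1, smul_zero, smul_zero, sub_zero,
    zero_add] at h

theorem eta_fNorm (a : Fin (g + 3) ↪ ℂ) (i : Fin (g + 3)) :
    eta a (fNorm a i) = constS g (phiE a i) := by
  have h : fNorm a i * sv a = fv a i := by
    rw [fNorm, mul_assoc, IsUnit.val_inv_mul, mul_one]
  have h2 := congrArg (eta a) h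
  rw [map_mul, eta_sv, eta_fv] at h2
  exact mul_right_cancel₀ sS_ne_zero h2

/-- On the subspace `∑ aⱼ² fⱼ` coincides with `ε₂`, so `f̄ᵢ` restricts to `φᵢ`. -/
theorem isClassOf_fNorm (a : Fin (g + 3) ↪ ℂ) (k : Fin g) :
    IsClassOf a (ofU a (∑ i, esymA a (k + 3) i • fNorm a i)) (psiU a (ofW (xv k))) := by
  have h : ofU a (∑ i, esymA a (k + 3) i • fNorm a i) - tauU a (ofW (xv k)) ∈ IHat a := by
    rw [tauU_ofW, ← map_sub]
    apply ofU_mem_IHat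
    rw [map_sub, eta_rho, sub_eq_zero, ← sum_esymA_succ_phiE a k, map_sum, map_sum]
    refine Finset.sum_congr rfl fun i _ => ?_
    rw [map_smul, eta_fNorm, Algebra.smul_def, map_mul, AlgHom.commutes]
  have hN : ofU a (∑ i, esymA a (k + 3) i • fNorm a i) ∈ NHat a := by
    have := (NHat a).add_mem (IHat_le_NHat h) (tauU_mem a (ofW (xv k)))
    rwa [sub_add_cancel] at this
  refine ⟨hN, ?_⟩
  rw [psiU_apply, eq_comm, cls_eq_cls_iff]
  exact h

theorem isLambdaHat_lambdaHat (a : Fin (g + 3) ↪ ℂ) : IsLambdaHat a (lambdaHat a) := by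
  refine ⟨fun k h1 hk => ?_, fun φ => ?_⟩
  · have h := isClassOf_fNorm a ⟨k - 1, by omega⟩
    rw [← lambdaHat_psiX, psiX_ofW_xv] at h
    simpa only [Nat.sub_add_cancel h1, show k - 1 + 3 = k + 2 by omega] using h
  · rw [← psiX_yphi, lambdaHat_psiX]
    exact isWhat_psiU a φ

theorem IsClassOf.unique {a : Fin (g + 3) ↪ ℂ} {u : DU a} {w w' : AU a} (h : IsClassOf a u w)
    (hw : IsClassOf a u w') : w = w' := by
  obtain ⟨_, rfl⟩ := h
  obtain ⟨_, rfl⟩ := hw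
  rfl

/-- The matrix of the vector fields `Ŷ[X^j]` in the basis `∂/∂e_{k+1}`. -/
def matY (g : ℕ) : Matrix (Fin g) (Fin g) (KX g) := fun j k => rcoef (Polynomial.X ^ (j : ℕ)) k

/-- In the variables `x_α` the matrix is twice a transposed Vandermonde matrix times the Jacobian of
`x ↦ e`. -/
theorem det_matY_ne_zero : (matY g).det ≠ 0 := by
  let J : Matrix (Fin g) (Fin g) (KX g) := fun α k => esymOn (Finset.univ.erase α) xv k
  let L : Matrix (Fin g) (Fin g) (KX g) := fun k α => lagN xv α k
  have hJ : J.det ≠ 0 := by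
    have h : L * J = 1 := by
      ext k m
      rw [Matrix.mul_apply, Matrix.one_apply]
      simp only [L, J]
      simp_rw [mul_comm (lagN xv _ _)]
      rw [sum_esymOn_mul_lagN xv_injective]
      simp [eq_comm]
    have h2 := congrArg Matrix.det h
    rw [Matrix.det_mul, Matrix.det_one] at h2
    exact right_ne_zero_of_mul_eq_one h2
  have hV : (Matrix.vandermonde (xv (g := g))).det ≠ 0 :=
    Matrix.det_vandermonde_ne_zero_iff.mpr xv_injective
  have hm : (iotaX g : KX g →+* KX g).mapMatrix (matY g) =
      (2 : KX g) • ((Matrix.vandermonde xv).transpose * J) := by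
    ext j k
    rw [RingHom.mapMatrix_apply, Matrix.map_apply, Matrix.smul_apply, Matrix.mul_apply]
    change iotaX g (rcoef _ k) = _
    rw [iotaX_rcoef, RX, smul_eq_mul]
    congr 1
    refine Finset.sum_congr rfl fun α _ => ?_
    rw [dX_eX, map_pow, Polynomial.aeval_X]
    rfl
  intro h0
  have h1 := RingHom.map_det (iotaX g : KX g →+* KX g) (matY g)
  rw [h0, map_zero, hm, Matrix.det_smul, Matrix.det_mul, Matrix.det_transpose] at h1
  exact mul_ne_zero (pow_ne_zero _ two_ne_zero) (mul_ne_zero hV hJ) h1.symm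

theorem yW_eq_sum_yphi (k : Fin g) :
    yW k = ∑ j : Fin g, ofW ((matY g)⁻¹ k j) * yphi g (Polynomial.X ^ (j : ℕ)) := by
  have h : (matY g)⁻¹ * matY g = 1 :=
    Matrix.nonsing_inv_mul _ (isUnit_iff_ne_zero.mpr det_matY_ne_zero)
  simp only [yphi, Finset.mul_sum, ← mul_assoc, ← map_mul]
  rw [Finset.sum_comm]
  simp only [← Finset.sum_mul, ← map_sum]
  have h2 : ∀ l, ∑ j : Fin g, (matY g)⁻¹ k j * rcoef (Polynomial.X ^ (j : ℕ)) l =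
      if k = l then 1 else 0 := by
    intro l
    have h3 := congrFun (congrFun h k) l
    rw [Matrix.mul_apply, Matrix.one_apply] at h3
    exact h3
  simp only [h2]
  rw [Finset.sum_eq_single k]
  · simp
  · intro l _ hl
    simp [hl.symm]
  · simp

/-- The prescribed values fix `Λ` on the functions of the `e_k` and on the `Ŷ[X^j]`, hence on the
`∂/∂e_k`, which are combinations of the latter. -/
theorem IsLambdaHat.eq {a : Fin (g + 3) ↪ ℂ} {Λ : AX a ≃ₐ[ℂ] AU a} (h : IsLambdaHat a Λ) :
    Λ = lambdaHat a := by
  have hw : (Λ : AX a →ₐ[ℂ] AU a).comp (psiX a) = psiU a := by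
    have ho : ∀ r, Λ (psiX a (ofW r)) = psiU a (ofW r) := by
      have : ((Λ : AX a →ₐ[ℂ] AU a).comp (psiX a)).comp ofW = (psiU a).comp ofW :=
        locGen_xv.algHom_ext fun k => by
          change Λ (psiX a (ofW (xv k))) = psiU a (ofW (xv k))
          rw [psiX_ofW_xv]
          exact (h.1 (k + 1) (by omega) (by omega)).unique (isClassOf_fNorm a k)
      exact fun r => congrArg (fun f : KX g →ₐ[ℂ] AU a => f r) this
    refine Weyl.algHom_ext ho fun k => ?_
    change Λ (psiX a (yW k)) = psiU a (yW k)
    rw [yW_eq_sum_yphi, map_sum, map_sum, map_sum]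
    refine Finset.sum_congr rfl fun j _ => ?_
    rw [map_mul, map_mul, map_mul, ho, psiX_yphi, (h.2 _).eq]
  refine AlgEquiv.ext fun u => ?_
  obtain ⟨w, rfl⟩ := psiX_surjective a u
  rw [lambdaHat_psiX, ← hw]
  rfl

/-! ### The formulas for the Hamiltonians -/

theorem sum_lagrange_pow (a : Fin (g + 3) ↪ ℂ) {k : ℕ} (hk : k < g + 3) :
    ∑ i, Polynomial.C ((∏ j ∈ Finset.univ.erase i, (a i - a j))⁻¹ * a i ^ k) *
      ∏ j ∈ Finset.univ.erase i, (Polynomial.X - Polynomial.C (a j)) = Polynomial.X ^ k := by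
  have h := Lagrange.eq_interpolate (s := Finset.univ) (v := a) (f := Polynomial.X ^ k)
    a.injective.injOn (by
      rw [Polynomial.degree_X_pow, Finset.card_univ, Fintype.card_fin]
      exact_mod_cast hk)
  rw [Lagrange.interpolate_apply] at h
  conv_rhs => rw [h]
  refine Finset.sum_congr rfl fun i _ => ?_
  simp only [Lagrange.basis, Lagrange.basisDivisor, Polynomial.eval_pow, Polynomial.eval_X,
    Finset.prod_mul_distrib]
  rw [← map_prod, Finset.prod_inv_distrib, mul_comm (∏ j ∈ _, (a i - a j))⁻¹, Polynomial.C_mul,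
    mul_assoc]

theorem cls_HHitch_eq {a : Fin (g + 3) ↪ ℂ} {C : Fin (g + 3) → ℂ}
    (hC₀ : ∑ i, C i = 0) (hC₁ : ∑ i, a i * C i = 0) {Λ : AX a ≃ₐ[ℂ] AU a} (hΛ : IsLambdaHat a Λ)
    (i : Fin (g + 3)) (h : HHitch a C i ∈ NHat a) :
    cls a (HHitch a C i) h = Λ ((∏ j ∈ Finset.univ.erase i, (a i - a j))⁻¹ •
      ∑ k ∈ Finset.range g, ((-1) ^ k * a i ^ k : ℂ) • HBM a C (k + 1)) := by
  rw [cls_HHitch, hΛ.eq, ← psiX_hitchW a C hC₀ hC₁, lambdaHat_psiX]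

theorem C_smul_mul_map {A : Type*} [Ring A] [Algebra ℂ A] (c : ℂ) (x : A) (P : Polynomial ℂ) :
    Polynomial.C (c • x) * P.map (algebraMap ℂ A) =
      Polynomial.C x * (Polynomial.C c * P).map (algebraMap ℂ A) := by
  rw [Algebra.smul_def, Algebra.commutes, Polynomial.map_mul, Polynomial.map_C, Polynomial.C_mul,
    mul_assoc]

/-- Lagrange interpolation of each `X^k`, of degree below `g + 3`, at the points `aᵢ`. -/
theorem sum_hamiltonians {A : Type*} [Ring A] [Algebra ℂ A] (a : Fin (g + 3) ↪ ℂ) (M : ℕ → A) :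
    ∑ k ∈ Finset.range g, (-1 : Polynomial A) ^ k * Polynomial.X ^ k * Polynomial.C (M k) =
      ∑ i, Polynomial.C ((∏ j ∈ Finset.univ.erase i, (a i - a j))⁻¹ •
        ∑ k ∈ Finset.range g, ((-1) ^ k * a i ^ k : ℂ) • M k) *
        (∏ j ∈ Finset.univ.erase i, (Polynomial.X - Polynomial.C (a j))).map (algebraMap ℂ A) := by
  simp only [Finset.smul_sum, smul_smul, map_sum, Finset.sum_mul, C_smul_mul_map]
  rw [Finset.sum_comm]
  refine Finset.sum_congr rfl fun k hk => ?_
  have hk' : k < g + 3 := by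
    have := Finset.mem_range.mp hk
    omega
  have h := congrArg (fun P => Polynomial.C ((-1 : ℂ) ^ k) * P) (sum_lagrange_pow a hk')
  simp only [Finset.mul_sum, ← mul_assoc, ← Polynomial.C_mul] at h
  rw [← Finset.mul_sum, ← Polynomial.map_sum]
  have e : ∀ i, Polynomial.C ((∏ j ∈ Finset.univ.erase i, (a i - a j))⁻¹ * ((-1) ^ k * a i ^ k)) *
      ∏ j ∈ Finset.univ.erase i, (Polynomial.X - Polynomial.C (a j)) =
      Polynomial.C ((-1) ^ k * (∏ j ∈ Finset.univ.erase i, (a i - a j))⁻¹ * a i ^ k) *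
      ∏ j ∈ Finset.univ.erase i, (Polynomial.X - Polynomial.C (a j)) := by
    intro i
    congr 2
    ring
  rw [Finset.sum_congr rfl fun i _ => e i, h]
  simp only [Polynomial.map_mul, Polynomial.map_pow, Polynomial.map_neg, Polynomial.map_one,
    Polynomial.map_X, map_pow, map_neg, map_one]
  rw [mul_assoc, Polynomial.X_pow_mul_C, ← mul_assoc,
    ((Commute.neg_one_left (Polynomial.C (M k))).pow_left k).eq, mul_assoc]

/-- Inversion by the matrix `esymA`: the entry of `cN` in column `g + 2 - k'` is, up to sign, `aᵢ^k'
/ ∏_{j ≠ i} (aᵢ - aⱼ)`, so row `g + 3 - k` selects `k' + 1 = k`. -/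
theorem HBM_eq_sum {A : Type*} [Ring A] [Algebra ℂ A] (a : Fin (g + 3) ↪ ℂ) (M : ℕ → A) {k : ℕ}
    (h1 : 1 ≤ k) (hk : k ≤ g) :
    M k = (-1 : ℂ) ^ g • ∑ i, esymA a (g + 3 - k) i •
      (∏ j ∈ Finset.univ.erase i, (a i - a j))⁻¹ •
        ∑ k ∈ Finset.range g, ((-1) ^ k * a i ^ k : ℂ) • M (k + 1) := by
  have h : ∀ k' ∈ Finset.range g, ∑ i, (-1 : ℂ) ^ g * (esymA a (g + 3 - k) i *
      ((∏ j ∈ Finset.univ.erase i, (a i - a j))⁻¹ * ((-1) ^ k' * a i ^ k'))) =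
      if k' + 1 = k then 1 else 0 := by
    intro k' hk'
    have hk'' := Finset.mem_range.mp hk'
    have h3 := sum_esymA_mul_cN a ⟨g + 3 - k, by omega⟩ ⟨g + 2 - k', by omega⟩
    have h4 : (if (⟨g + 3 - k, by omega⟩ : Fin (g + 3)) = ⟨g + 2 - k', by omega⟩ then (1 : ℂ)
        else 0) = if k' + 1 = k then 1 else 0 := by
      simp only [Fin.mk.injEq]
      congr 1
      rw [eq_iff_iff]
      omega
    rw [← h4, ← h3]
    refine Finset.sum_congr rfl fun i _ => ?_
    have hs : (-1 : ℂ) ^ (g + 2 - k') = (-1) ^ g * (-1) ^ k' := by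
      have e : (-1 : ℂ) ^ (g + 2 - k') * (-1) ^ k' = (-1) ^ g := by
        rw [← pow_add, Nat.sub_add_cancel (by omega), pow_add]
        norm_num
      have e2 : (-1 : ℂ) ^ k' * (-1) ^ k' = 1 := by
        rw [← mul_pow]
        norm_num
      rw [← e, mul_assoc, e2, mul_one]
    rw [cN, lagN, hs, show g + 3 - 1 - (g + 2 - k') = k' by omega]
    ring
  simp only [Finset.smul_sum, smul_smul]
  rw [Finset.sum_comm]
  simp only [← Finset.sum_smul]
  rw [Finset.sum_congr rfl fun k' hk' => by rw [h k' hk'], Finset.sum_eq_single (k - 1)]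
  · rw [Nat.sub_add_cancel h1, if_pos rfl, one_smul]
  · intro k' _ hne
    rw [if_neg (by omega), zero_smul]
  · intro hne
    exact absurd (Finset.mem_range.mpr (by omega)) hne

end QIS

/-- Isomorphism of quantum integrable systems. -/
theorem mainTheorem8 (g : ℕ) (a : Fin (g + 3) ↪ ℂ) (C : Fin (g + 3) → ℂ)
    (hC₀ : ∑ i, C i = 0) (hC₁ : ∑ i, a i * C i = 0) :
    -- the elements `Ŵ[φ]` of `A_U` are well defined, and so is the isomorphism `Λ̂`
    (∀ φ : Polynomial ℂ, ∃! w : QIS.AU a, QIS.IsWhat a φ w) ∧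
    (∃! Λ : QIS.AX a ≃ₐ[ℂ] QIS.AU a, QIS.IsLambdaHat a Λ) ∧
    -- the Hitchin Hamiltonians have classes in `A_U`
    ∃ hN : ∀ i, QIS.HHitch a C i ∈ QIS.NHat a,
      ∀ Λ : QIS.AX a ≃ₐ[ℂ] QIS.AU a, QIS.IsLambdaHat a Λ →
        (∑ k ∈ Finset.range g, (-1 : Polynomial (QIS.AU a)) ^ k * Polynomial.X ^ k
            * Polynomial.C (Λ (QIS.HBM a C (k + 1)))
          = ∑ i, Polynomial.C (QIS.cls a (QIS.HHitch a C i) (hN i)) *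
              (∏ j ∈ Finset.univ.erase i,
                (Polynomial.X - Polynomial.C (a j))).map (algebraMap ℂ (QIS.AU a))) ∧
        (∀ i, QIS.cls a (QIS.HHitch a C i) (hN i)
          = (∏ j ∈ Finset.univ.erase i, (a i - a j))⁻¹ •
              ∑ k ∈ Finset.range g, ((-1) ^ k * a i ^ k : ℂ) • Λ (QIS.HBM a C (k + 1))) ∧
        (∀ k : ℕ, 1 ≤ k → k ≤ g → QIS.HBM a C k
          = (-1 : ℂ) ^ g • ∑ i, QIS.esymA a (g + 3 - k) i •
              Λ.symm (QIS.cls a (QIS.HHitch a C i) (hN i))) := by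
  refine ⟨fun φ => ⟨_, QIS.isWhat_psiU a φ, fun w hw => hw.eq⟩,
    ⟨_, QIS.isLambdaHat_lambdaHat a, fun Λ hΛ => hΛ.eq⟩, QIS.HHitch_mem a C, fun Λ hΛ => ?_⟩
  have h2 := fun i => QIS.cls_HHitch_eq hC₀ hC₁ hΛ i (QIS.HHitch_mem a C i)
  have h2' : ∀ i, QIS.cls a (QIS.HHitch a C i) (QIS.HHitch_mem a C i)
      = (∏ j ∈ Finset.univ.erase i, (a i - a j))⁻¹ •
          ∑ k ∈ Finset.range g, ((-1) ^ k * a i ^ k : ℂ) • Λ (QIS.HBM a C (k + 1)) := by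
    intro i
    rw [h2 i, map_smul, map_sum]
    simp only [map_smul]
  refine ⟨?_, h2', fun k h1 hk => ?_⟩
  · rw [QIS.sum_hamiltonians a fun k => Λ (QIS.HBM a C (k + 1))]
    exact Finset.sum_congr rfl fun i _ => by rw [h2' i]
  · refine (QIS.HBM_eq_sum a (QIS.HBM a C) h1 hk).trans ?_
    congr 1
    refine Finset.sum_congr rfl fun i _ => ?_
    rw [h2 i, AlgEquiv.symm_apply_apply]

end
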